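/- Let $L,H>0$, $\mathbb T_L=\mathbb R/L\mathbb Z$ and $D=\mathbb T_L\times(0,H)$, with $\bar D=\mathbb T_L\times[0,H]$ and coordinates $\mathbf x=(x_1,x_2)$. Let $\Lambda_1$ be the first (smallest) eigenvalue of the problem $$-\Delta u=\Lambda u\ \text{ in } D,\qquad u|_{x_2=0}=u|_{x_2=H}=\text{constant},\qquad \int_D u\,d\mathbf x=0,$$ that is, the smallest real $\Lambda$ for which it has a solution $u\in C^2(\bar D)$, $u\not\equiv0$ (the constant is not prescribed). Let $g\in C^1(\mathbb R)$, $\lambda\in\mathbb R$, and let $\bar\psi\in C^2(\bar D)$ satisfy $$-\Delta\bar\psi=g(\bar\psi-\lambda x_2)\ \text{ in } D,$$ with $\bar\psi$ constant on each of the two boundary components $\{x_2=0\}$ and $\{x_2=H\}$ (the two constants may differ). Put $\bar\omega:=-\Delta\bar\psi$ and fix $1<p<\infty$. Suppose that $$0\le\min_{\bar D}g'(\bar\psi-\lambda x_2)\le\max_{\bar D}g'(\bar\psi-\lambda x_2)<\Lambda_1 .$$ Then: (i) $\bar\psi$ depends only on $x_2$ (a shear flow). (ii) The associated steady flow is Lyapunov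 stable in the $L^p$ norm of the vorticity: for every $\varepsilon>0$ there is $\delta>0$ such that for every classical solution $(\mathbf v,P)$ of the incompressible Euler equation $$\partial_t\mathbf v+(\mathbf v\cdot\nabla)\mathbf v=-\nabla P,\quad \nabla\cdot\mathbf v=0\ \text{ in }\mathbb R\times D,\qquad v_2|_{x_2=0}=v_2|_{x_2=H}=0,$$ with $\mathbf v\in C^2(\mathbb R\times\bar D)$ and $P(t,\cdot)\in C^1(D)$ for each $t\in\mathbb R$, whose vorticity is $\omega=\partial_{x_1}v_2-\partial_{x_2}v_1$, $$\|\omega(0,\cdot)-\bar\omega\|_{L^p(D)}<\delta\quad\Longrightarrow\quad\|\omega(t,\cdot)-\bar\omega\|_{L^p(D)}<\varepsilon\quad\text{for all }t\in\mathbb R.$$ -/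

import Mathlib

open Set MeasureTheory

noncomputable section

namespace PeriodicChannel

/-- The open channel `D = 𝕋_L × (0, H)`, in the covering coordinates `(x₁, x₂) ∈ ℝ × (0, H)`.
Functions on `D` (or on its closure) are represented by functions on the strip that are
`L`-periodic in `x₁`; their values off the closed strip play no role. -/
def channel (H : ℝ) : Set (ℝ × ℝ) := univ ×ˢ Ioo 0 H

/-- The closed channel `𝕋_L × [0, H]`, in covering coordinates. -/
def closedChannel (H : ℝ) : Set (ℝ × ℝ) := univ ×ˢ Icc 0 H

/-- One period cell of the channel; integrals and `L^p` norms over `D` are taken over it. -/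
def cell (L H : ℝ) : Set (ℝ × ℝ) := Ioo 0 L ×ˢ Ioo 0 H

/-- `f` is `L`-periodic in `x₁` on the set `s`. -/
def PeriodicOn {α : Type*} (L : ℝ) (f : ℝ × ℝ → α) (s : Set (ℝ × ℝ)) : Prop :=
  ∀ x ∈ s, f (x.1 + L, x.2) = f x

/-- `∂f/∂x₁`. -/
def partial1 (f : ℝ × ℝ → ℝ) (x : ℝ × ℝ) : ℝ := fderiv ℝ f x (1, 0)

/-- `∂f/∂x₂`. -/
def partial2 (f : ℝ × ℝ → ℝ) (x : ℝ × ℝ) : ℝ := fderiv ℝ f x (0, 1)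

/-- The Laplacian `∂²f/∂x₁² + ∂²f/∂x₂²`. -/
def laplacian (f : ℝ × ℝ → ℝ) (x : ℝ × ℝ) : ℝ :=
  partial1 (partial1 f) x + partial2 (partial2 f) x

/-- `f` belongs to `C²` of the closed channel: it is `L`-periodic in `x₁` and twice continuously
differentiable up to the boundary. -/
def IsC2 (L H : ℝ) (f : ℝ × ℝ → ℝ) : Prop :=
  PeriodicOn L f (closedChannel H) ∧ ContDiffOn ℝ 2 f (closedChannel H)

/-- `ψ ∈ C²` of the closed channel solves `-Δψ = g(ψ - λ x₂)` in `D`, and `ψ` is constant on each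
of the two boundary components `{x₂ = 0}` and `{x₂ = H}`. -/
structure IsSemilinearSolution (L H : ℝ) (g : ℝ → ℝ) (lam : ℝ) (ψ : ℝ × ℝ → ℝ) : Prop where
  c2 : IsC2 L H ψ
  eqn : ∀ x ∈ channel H, -laplacian ψ x = g (ψ x - lam * x.2)
  bottom : ∃ c : ℝ, ∀ s : ℝ, ψ (s, 0) = c
  top : ∃ c : ℝ, ∀ s : ℝ, ψ (s, H) = c

/-- `Λ` is an eigenvalue of the problem `-Δu = Λ u` in `D`, `u|_{x₂=0} = u|_{x₂=H} = constant`,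
`∫_D u = 0`. -/
def IsEigenvalue (L H Lam : ℝ) : Prop :=
  ∃ u : ℝ × ℝ → ℝ, IsC2 L H u ∧
    (∃ x ∈ closedChannel H, u x ≠ 0) ∧
    (∀ x ∈ channel H, -laplacian u x = Lam * u x) ∧
    (∃ c : ℝ, ∀ s : ℝ, u (s, 0) = c ∧ u (s, H) = c) ∧
    ∫ x in cell L H, u x = 0

/-- The first (smallest) eigenvalue `Λ₁`. -/
def firstEigenvalue (L H : ℝ) : ℝ := sInf {Lam : ℝ | IsEigenvalue L H Lam}

/-- The scalar vorticity `∂₁ v₂ - ∂₂ v₁` of a planar velocity field. -/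
def vorticity (v : ℝ × ℝ → ℝ × ℝ) (x : ℝ × ℝ) : ℝ :=
  partial1 (fun y => (v y).2) x - partial2 (fun y => (v y).1) x

/-- `(v, P)` is a classical solution, global in time, of the incompressible Euler equation in the
channel with impermeable walls. The velocity is `C²` in `(t, x)` up to the boundary, and the
pressure is `C¹` in `x` in the open channel at each time. -/
structure IsEulerFlow (L H : ℝ) (v : ℝ → ℝ × ℝ → ℝ × ℝ) (P : ℝ → ℝ × ℝ → ℝ) : Prop where
  periodic_v : ∀ t, PeriodicOn L (v t) (closedChannel H)
  periodic_P : ∀ t, PeriodicOn L (P t) (channel H)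
  smooth_v : ContDiffOn ℝ 2 (fun q : ℝ × (ℝ × ℝ) => v q.1 q.2) (univ ×ˢ closedChannel H)
  smooth_P : ∀ t, ContDiffOn ℝ 1 (P t) (channel H)
  momentum1 : ∀ t, ∀ x ∈ channel H,
    deriv (fun s => (v s x).1) t
      + ((v t x).1 * partial1 (fun y => (v t y).1) x + (v t x).2 * partial2 (fun y => (v t y).1) x)
      = -partial1 (P t) x
  momentum2 : ∀ t, ∀ x ∈ channel H,
    deriv (fun s => (v s x).2) t
      + ((v t x).1 * partial1 (fun y => (v t y).2) x + (v t x).2 * partial2 (fun y => (v t y).2) x)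
      = -partial2 (P t) x
  div_free : ∀ t, ∀ x ∈ channel H,
    partial1 (fun y => (v t y).1) x + partial2 (fun y => (v t y).2) x = 0
  impermeable_bottom : ∀ t s, (v t (s, 0)).2 = 0
  impermeable_top : ∀ t s, (v t (s, H)).2 = 0

end PeriodicChannel

end

/-! Shear structure. For a horizontal shift `h`, the difference `ξ = ψ(x₁ + h, x₂) - ψ(x₁, x₂)`
vanishes on both walls and has mean zero. Green's identity and the bound `g' ≤ M < Λ₁` give `∫|∇ξ|²
≤ M ∫ξ²`. The Poincaré inequality (`C1On.poincare`) gives `poincareConst * ∫ξ² ≤ ∫|∇ξ|²`, and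
explicit trigonometric modes show `Λ₁ ≤ poincareConst`, so `ξ = 0`. No spectral theory is needed:
only this upper bound on `Λ₁` enters.

Stability is an energy-Casimir argument. A smooth Euler flow conserves the energy, the momentum
`∫v₁`, the impulse `∫x₂ω` and every Casimir `∫F(ω)`. Write `Ω = g(Ψ)` with `Ψ = φ - λx₂` for the
shear vorticity, and let `η` be the mean-zero stream function of the deviation, after removal of a
uniform translation so that `η` has the same constant on both walls. Then `½∫|∇η|² + ∫(ω - Ω)Ψ -
∫(F(ω) - F(Ω))` is conserved.

Take for `F` the Legendre transform of a primitive `G` of `g`, with the supremum restricted to `|ρ|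
≤ R`. Testing the supremum at `ρ = Ψ + η` cut off at height `K` bounds the functional by `-½∫|∇η|² +
(M/2)∫η²`, plus a cut-off error and a total-vorticity term. Since `M` is below the Poincaré
constant, a negative multiple of `∫|∇η|²` survives (`StableShear.exists_concave`). The restriction
makes `F` Lipschitz, so the initial functional is bounded below by a multiple of the `L¹` deviation.
The cut-off error is `K⁻¹∫|ω - Ω|η²`, and Sobolev and Young absorb it for every `p > 1`, because the
conserved Casimir `|s|ᵖ` bounds `ω` in `Lᵖ` for all time. Hence the kinetic energy of the deviation
stays small (`StableShear.exists_energy_control`).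

Small energy means only weak closeness of vorticities. It becomes `Lᵖ` closeness through the Bregman
distance of `|s|ᵖ`: its integral is `∫|ω|ᵖ - ∫|Ω|ᵖ`, nearly zero by conservation, minus a linear
moment of `ω - Ω` against a function of `x₂` alone. That moment is small by the energy control
(`StableShear.exists_moment_control`). The Bregman integral controls `∫|ω - Ω|ᵖ` up to an
arbitrarily small error (`exists_abs_sub_rpow_le_bregman`). -/

noncomputable section
-- Integration and Green's identity on the periodic channel
namespace PeriodicChannel

/-- A function that is continuous on the closed channel and periodic, with partial derivatives in the
open channel that extend continuously to the closed channel. -/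
structure C1On (L H : ℝ) (f f1 f2 : ℝ × ℝ → ℝ) : Prop where
  cont : ContinuousOn f (closedChannel H)
  cont1 : ContinuousOn f1 (closedChannel H)
  cont2 : ContinuousOn f2 (closedChannel H)
  periodic : PeriodicOn L f (closedChannel H)
  deriv1 : ∀ x ∈ channel H, HasDerivAt (fun s => f (s, x.2)) (f1 x) x.1
  deriv2 : ∀ x ∈ channel H, HasDerivAt (fun s => f (x.1, s)) (f2 x) x.2

variable {L H : ℝ} {f f1 f2 g g1 g2 : ℝ × ℝ → ℝ}

lemma measurableSet_cell : MeasurableSet (cell L H) := measurableSet_Ioo.prod measurableSet_Ioo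

lemma cell_subset_channel : cell L H ⊆ channel H := fun _ hx => ⟨mem_univ _, hx.2⟩

lemma channel_subset_closedChannel : channel H ⊆ closedChannel H :=
  fun _ hx => ⟨mem_univ _, Ioo_subset_Icc_self hx.2⟩

lemma cell_subset_closedChannel : cell L H ⊆ closedChannel H :=
  cell_subset_channel.trans channel_subset_closedChannel

lemma isOpen_channel : IsOpen (channel H) := isOpen_univ.prod isOpen_Ioo

lemma cell_subset_Icc : cell L H ⊆ Icc 0 L ×ˢ Icc 0 H :=
  prod_mono Ioo_subset_Icc_self Ioo_subset_Icc_self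

lemma Icc_subset_closedChannel (a b : ℝ) : Icc a b ×ˢ Icc 0 H ⊆ closedChannel H :=
  prod_mono (subset_univ _) subset_rfl

lemma volume_cell_lt_top : volume (cell L H) < ⊤ :=
  (measure_mono cell_subset_Icc).trans_lt (isCompact_Icc.prod isCompact_Icc).measure_lt_top

instance : IsFiniteMeasure (volume.restrict (cell L H)) :=
  ⟨by simpa using volume_cell_lt_top⟩

lemma measureReal_cell (hL : 0 ≤ L) (hH : 0 ≤ H) : volume.real (cell L H) = L * H := by
  rw [cell, Measure.volume_eq_prod, measureReal_prod_prod]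
  simp [hL, hH]

lemma setIntegral_cell_const (hL : 0 ≤ L) (hH : 0 ≤ H) (c : ℝ) :
    ∫ _ in cell L H, c = L * H * c := by
  rw [setIntegral_const, measureReal_cell hL hH, smul_eq_mul]

lemma integrableOn_cell (hf : ContinuousOn f (closedChannel H)) : IntegrableOn f (cell L H) :=
  ((hf.mono (Icc_subset_closedChannel 0 L)).integrableOn_compact
    (isCompact_Icc.prod isCompact_Icc)).mono_set cell_subset_Icc

lemma exists_bound_cell (L : ℝ) (hf : ContinuousOn f (closedChannel H)) :
    ∃ B, 0 ≤ B ∧ ∀ x ∈ cell L H, |f x| ≤ B := by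
  obtain ⟨B, hB⟩ := (isCompact_Icc.prod isCompact_Icc).exists_bound_of_continuousOn
    (hf.mono (Icc_subset_closedChannel 0 L))
  exact ⟨max B 0, le_max_right _ _, fun x hx => (hB x (cell_subset_Icc hx)).trans (le_max_left _ _)⟩

lemma mk_mem_closedChannel {x y : ℝ} (hy : y ∈ Icc 0 H) : (x, y) ∈ closedChannel H :=
  ⟨mem_univ _, hy⟩

lemma mk_mem_channel {x y : ℝ} (hy : y ∈ Ioo 0 H) : (x, y) ∈ channel H :=
  ⟨mem_univ _, hy⟩

lemma continuousOn_row (hf : ContinuousOn f (closedChannel H)) {y : ℝ} (hy : y ∈ Icc 0 H) :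
    Continuous fun x => f (x, y) :=
  continuousOn_univ.1 <| hf.comp (by fun_prop) fun _ _ => mk_mem_closedChannel hy

lemma continuousOn_column (hf : ContinuousOn f (closedChannel H)) (x : ℝ) :
    ContinuousOn (fun y => f (x, y)) (Icc 0 H) :=
  hf.comp (by fun_prop) fun _ hy => mk_mem_closedChannel hy

lemma setIntegral_cell_eq (hL : 0 ≤ L) (hH : 0 ≤ H) (hf : ContinuousOn f (closedChannel H)) :
    ∫ x in cell L H, f x = ∫ x in (0 : ℝ)..L, ∫ y in (0 : ℝ)..H, f (x, y) := by
  have := integrableOn_cell (L := L) hf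
  rw [cell, Measure.volume_eq_prod] at *
  rw [setIntegral_prod _ this, intervalIntegral.integral_of_le hL, integral_Ioc_eq_integral_Ioo]
  simp_rw [intervalIntegral.integral_of_le hH, integral_Ioc_eq_integral_Ioo]

lemma setIntegral_cell_eq' (hL : 0 ≤ L) (hH : 0 ≤ H) (hf : ContinuousOn f (closedChannel H)) :
    ∫ x in cell L H, f x = ∫ y in (0 : ℝ)..H, ∫ x in (0 : ℝ)..L, f (x, y) := by
  have := integrableOn_cell (L := L) hf
  rw [cell, Measure.volume_eq_prod, IntegrableOn, ← Measure.prod_restrict] at *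
  rw [integral_prod_symm _ this, intervalIntegral.integral_of_le hH, integral_Ioc_eq_integral_Ioo]
  simp_rw [intervalIntegral.integral_of_le hL, integral_Ioc_eq_integral_Ioo]

lemma intervalIntegral_congr_Ioo {a b : ℝ} (hab : a ≤ b) {f g : ℝ → ℝ}
    (h : ∀ x ∈ Ioo a b, f x = g x) : ∫ x in a..b, f x = ∫ x in a..b, g x := by
  rw [intervalIntegral.integral_of_le hab, intervalIntegral.integral_of_le hab,
    integral_Ioc_eq_integral_Ioo, integral_Ioc_eq_integral_Ioo]
  exact setIntegral_congr_fun measurableSet_Ioo h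

/-- Differentiation under an integral over a subset of a compact set. -/
lemma hasDerivAt_setIntegral {α : Type*} [TopologicalSpace α] [T2Space α] [MeasurableSpace α]
    [SecondCountableTopology α] [BorelSpace α] {μ : Measure α} [IsFiniteMeasureOnCompacts μ]
    {K A : Set α} (hK : IsCompact K) (hA : MeasurableSet A) (hAK : A ⊆ K)
    {F F' : ℝ → α → ℝ} {t₀ a b : ℝ} (ht : t₀ ∈ Ioo a b)
    (hF : ContinuousOn (fun q : ℝ × α => F q.1 q.2) (Icc a b ×ˢ K))
    (hF' : ContinuousOn (fun q : ℝ × α => F' q.1 q.2) (Icc a b ×ˢ K))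
    (hd : ∀ t ∈ Ioo a b, ∀ x ∈ A, HasDerivAt (fun s => F s x) (F' t x) t) :
    HasDerivAt (fun t => ∫ x in A, F t x ∂μ) (∫ x in A, F' t₀ x ∂μ) t₀ := by
  obtain ⟨B, hB⟩ := (isCompact_Icc.prod hK).exists_bound_of_continuousOn hF'
  have slice : ∀ {G : ℝ → α → ℝ}, ContinuousOn (fun q : ℝ × α => G q.1 q.2) (Icc a b ×ˢ K) →
      ∀ t ∈ Icc a b, IntegrableOn (G t) A μ := fun {G} hG t ht =>
    ((hG.comp (f := fun x : α => (t, x)) (s := K) (by fun_prop)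
      fun x hx => ⟨ht, hx⟩).integrableOn_compact hK).mono_set hAK
  have hnhds : Ioo a b ∈ nhds t₀ := isOpen_Ioo.mem_nhds ht
  have hfin : IsFiniteMeasure (μ.restrict A) :=
    ⟨by simpa using (measure_mono hAK).trans_lt hK.measure_lt_top⟩
  refine (hasDerivAt_integral_of_dominated_loc_of_deriv_le (μ := μ.restrict A) (F := F) (F' := F')
    (bound := fun _ => B) hnhds ?_ (slice hF t₀ (Ioo_subset_Icc_self ht))
    (slice hF' t₀ (Ioo_subset_Icc_self ht)).aestronglyMeasurable ?_ (integrable_const _) ?_).2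
  · filter_upwards [hnhds] with t ht using (slice hF t (Ioo_subset_Icc_self ht)).aestronglyMeasurable
  · filter_upwards [ae_restrict_mem hA] with x hx t ht
      using hB (t, x) ⟨Ioo_subset_Icc_self ht, hAK hx⟩
  · filter_upwards [ae_restrict_mem hA] with x hx t ht using hd t ht x hx

/-- Continuity of an integral over a subset of a compact set in a compact parameter range. -/
lemma continuousOn_setIntegral {α : Type*} [TopologicalSpace α] [T2Space α] [MeasurableSpace α]
    [SecondCountableTopology α] [BorelSpace α] {μ : Measure α} [IsFiniteMeasureOnCompacts μ]
    {K A : Set α} {T : Set ℝ} (hT : IsCompact T) (hK : IsCompact K) (hA : MeasurableSet A)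
    (hAK : A ⊆ K) {F : ℝ → α → ℝ} (hF : ContinuousOn (fun q : ℝ × α => F q.1 q.2) (T ×ˢ K)) :
    ContinuousOn (fun t => ∫ x in A, F t x ∂μ) T := by
  obtain ⟨B, hB⟩ := (hT.prod hK).exists_bound_of_continuousOn hF
  have hfin : IsFiniteMeasure (μ.restrict A) :=
    ⟨by simpa using (measure_mono hAK).trans_lt hK.measure_lt_top⟩
  refine continuousOn_of_dominated (bound := fun _ => B) (fun t ht => ?_) (fun t ht => ?_)
    (integrable_const _) ?_
  · exact (((hF.comp (f := fun x : α => (t, x)) (s := K) (by fun_prop)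
      fun x hx => ⟨ht, hx⟩).integrableOn_compact hK).mono_set hAK).aestronglyMeasurable
  · filter_upwards [ae_restrict_mem hA] with x hx using hB (t, x) ⟨ht, hAK hx⟩
  · filter_upwards [ae_restrict_mem hA] with x hx
    exact hF.comp (f := fun t => (t, x)) (by fun_prop) fun t ht => ⟨ht, hAK hx⟩

/-- The mean over horizontal lines, up to the factor `L`, is continuous. -/
lemma continuousOn_integral_row (hL : 0 ≤ L) (hf : ContinuousOn f (closedChannel H)) :
    ContinuousOn (fun y => ∫ x in (0 : ℝ)..L, f (x, y)) (Icc 0 H) := by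
  simp_rw [intervalIntegral.integral_of_le hL]
  refine continuousOn_setIntegral (F := fun y x => f (x, y)) isCompact_Icc
    (isCompact_Icc (a := (0 : ℝ)) (b := L)) measurableSet_Ioc Ioc_subset_Icc_self ?_
  exact hf.comp (by fun_prop) fun q hq => mk_mem_closedChannel hq.1

lemma continuousOn_integral_column (hH : 0 ≤ H) (hf : ContinuousOn f (closedChannel H)) (a b : ℝ) :
    ContinuousOn (fun x => ∫ y in (0 : ℝ)..H, f (x, y)) (Icc a b) := by
  simp_rw [intervalIntegral.integral_of_le hH]
  refine continuousOn_setIntegral (F := fun x y => f (x, y)) isCompact_Icc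
    (isCompact_Icc (a := (0 : ℝ)) (b := H)) measurableSet_Ioc Ioc_subset_Icc_self ?_
  exact hf.comp (by fun_prop) fun q hq => mk_mem_closedChannel hq.2

lemma C1On.integral_row_deriv1 (hf : C1On L H f f1 f2) {y : ℝ} (hy : y ∈ Ioo 0 H) :
    ∫ x in (0 : ℝ)..L, f1 (x, y) = 0 := by
  have hy' := Ioo_subset_Icc_self hy
  rw [intervalIntegral.integral_eq_sub_of_hasDerivAt (f := fun x => f (x, y))
    (fun x _ => hf.deriv1 (x, y) (mk_mem_channel hy))
    ((continuousOn_row hf.cont1 hy').intervalIntegrable _ _)]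
  have := hf.periodic (0, y) (mk_mem_closedChannel hy')
  simp_all

lemma C1On.integral_column_deriv2 (hf : C1On L H f f1 f2) (hH : 0 ≤ H) (x : ℝ) :
    ∫ y in (0 : ℝ)..H, f2 (x, y) = f (x, H) - f (x, 0) :=
  intervalIntegral.integral_eq_sub_of_hasDerivAt_of_le hH (continuousOn_column hf.cont x)
    (fun y hy => hf.deriv2 (x, y) (mk_mem_channel hy))
    ((continuousOn_column hf.cont2 x).intervalIntegrable_of_Icc hH)

lemma C1On.setIntegral_deriv1 (hf : C1On L H f f1 f2) (hL : 0 ≤ L) (hH : 0 ≤ H) :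
    ∫ x in cell L H, f1 x = 0 := by
  rw [setIntegral_cell_eq' hL hH hf.cont1,
    intervalIntegral_congr_Ioo hH (g := fun _ => 0) fun y hy => hf.integral_row_deriv1 hy]
  simp

lemma C1On.setIntegral_deriv2 (hf : C1On L H f f1 f2) (hL : 0 ≤ L) (hH : 0 ≤ H) :
    ∫ x in cell L H, f2 x = ∫ x in (0 : ℝ)..L, (f (x, H) - f (x, 0)) := by
  rw [setIntegral_cell_eq hL hH hf.cont2]
  simp_rw [hf.integral_column_deriv2 hH]

lemma C1On.mul (hf : C1On L H f f1 f2) (hg : C1On L H g g1 g2) :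
    C1On L H (fun x => f x * g x) (fun x => f1 x * g x + f x * g1 x)
      (fun x => f2 x * g x + f x * g2 x) where
  cont := hf.cont.mul hg.cont
  cont1 := (hf.cont1.mul hg.cont).add (hf.cont.mul hg.cont1)
  cont2 := (hf.cont2.mul hg.cont).add (hf.cont.mul hg.cont2)
  periodic x hx := by simp only [hf.periodic x hx, hg.periodic x hx]
  deriv1 x hx := (hf.deriv1 x hx).mul (hg.deriv1 x hx)
  deriv2 x hx := (hf.deriv2 x hx).mul (hg.deriv2 x hx)

lemma C1On.sub (hf : C1On L H f f1 f2) (hg : C1On L H g g1 g2) :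
    C1On L H (fun x => f x - g x) (fun x => f1 x - g1 x) (fun x => f2 x - g2 x) where
  cont := hf.cont.sub hg.cont
  cont1 := hf.cont1.sub hg.cont1
  cont2 := hf.cont2.sub hg.cont2
  periodic x hx := by simp only [hf.periodic x hx, hg.periodic x hx]
  deriv1 x hx := (hf.deriv1 x hx).sub (hg.deriv1 x hx)
  deriv2 x hx := (hf.deriv2 x hx).sub (hg.deriv2 x hx)

lemma C1On.neg (hf : C1On L H f f1 f2) :
    C1On L H (fun x => -f x) (fun x => -f1 x) (fun x => -f2 x) where
  cont := hf.cont.neg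
  cont1 := hf.cont1.neg
  cont2 := hf.cont2.neg
  periodic x hx := by simp only [hf.periodic x hx]
  deriv1 x hx := (hf.deriv1 x hx).neg
  deriv2 x hx := (hf.deriv2 x hx).neg

/-- Composition with a differentiable function of one variable. -/
lemma C1On.comp (hf : C1On L H f f1 f2) {φ φ' : ℝ → ℝ} (hφ : ∀ s, HasDerivAt φ (φ' s) s)
    (hφ' : Continuous φ') :
    C1On L H (fun x => φ (f x)) (fun x => φ' (f x) * f1 x) (fun x => φ' (f x) * f2 x) where
  cont := (continuous_iff_continuousAt.2 fun s => (hφ s).continuousAt).comp_continuousOn hf.cont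
  cont1 := (hφ'.comp_continuousOn hf.cont).mul hf.cont1
  cont2 := (hφ'.comp_continuousOn hf.cont).mul hf.cont2
  periodic x hx := by simp only [hf.periodic x hx]
  deriv1 x hx := (hφ (f x)).comp x.1 (hf.deriv1 x hx)
  deriv2 x hx := (hφ (f x)).comp x.2 (hf.deriv2 x hx)

/-- Functions of the vertical coordinate alone. -/
lemma C1On.of_vertical {a a' : ℝ → ℝ} (ha : ContinuousOn a (Icc 0 H))
    (ha' : ContinuousOn a' (Icc 0 H)) (hd : ∀ y ∈ Ioo 0 H, HasDerivAt a (a' y) y) :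
    C1On L H (fun x => a x.2) (fun _ => 0) (fun x => a' x.2) where
  cont := ha.comp continuousOn_snd fun _ hx => hx.2
  cont1 := continuousOn_const
  cont2 := ha'.comp continuousOn_snd fun _ hx => hx.2
  periodic _ _ := rfl
  deriv1 x _ := hasDerivAt_const x.1 (a x.2)
  deriv2 x hx := hd x.2 hx.2

lemma C1On.const (c : ℝ) : C1On L H (fun _ => c) (fun _ => 0) (fun _ => 0) where
  cont := continuousOn_const
  cont1 := continuousOn_const
  cont2 := continuousOn_const
  periodic _ _ := rfl
  deriv1 _ _ := hasDerivAt_const _ _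
  deriv2 _ _ := hasDerivAt_const _ _

lemma C1On.setIntegral_deriv2_of_eq (hf : C1On L H f f1 f2) (hL : 0 ≤ L) (hH : 0 ≤ H)
    (h : ∀ x, f (x, H) = f (x, 0)) : ∫ x in cell L H, f2 x = 0 := by
  rw [hf.setIntegral_deriv2 hL hH]; simp [h]

/-- Green's identity for a function with the same constant value on both walls. -/
lemma C1On.green {f11 f12 f21 f22 : ℝ × ℝ → ℝ} {c : ℝ} (hL : 0 ≤ L) (hH : 0 ≤ H)
    (hf : C1On L H f f1 f2) (hf1 : C1On L H f1 f11 f12) (hf2 : C1On L H f2 f21 f22)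
    (h0 : ∀ s, f (s, 0) = c) (h1 : ∀ s, f (s, H) = c) :
    ∫ x in cell L H, (f1 x ^ 2 + f2 x ^ 2)
      = -(∫ x in cell L H, f x * (f11 x + f22 x)) + c * ∫ x in cell L H, (f11 x + f22 x) := by
  have e1 := (hf.mul hf1).setIntegral_deriv1 hL hH
  have e2 := (hf.mul hf2).setIntegral_deriv2 hL hH
  have e3 := hf1.setIntegral_deriv1 hL hH
  have e4 := hf2.setIntegral_deriv2 hL hH
  -- The wall value `c` factors out of the boundary flux, and the divergence theorem turns the
  -- remaining flux back into the integral of the Laplacian.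
  simp only [h0, h1, ← mul_sub] at e2
  rw [intervalIntegral.integral_const_mul, ← e4] at e2
  have c0 := hf.cont; have c1 := hf.cont1; have c2 := hf.cont2
  have c11 := hf1.cont1; have c22 := hf2.cont2
  have I : ∀ {k : ℝ × ℝ → ℝ}, ContinuousOn k (closedChannel H) → IntegrableOn k (cell L H) :=
    integrableOn_cell
  have i1 := I c11; have i2 := I c22
  rw [integral_add i1 i2, e3, zero_add, ← e2, ← sub_eq_iff_eq_add', sub_neg_eq_add,
    ← integral_add (I (by fun_prop)) (I (by fun_prop)), ← sub_eq_zero,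
    ← integral_sub (I (by fun_prop)) (I (by fun_prop)), ← e1]
  congr 1; ext x; ring

/-- A continuous function whose square has integral zero over a period cell vanishes. -/
lemma eq_zero_of_setIntegral_sq_eq_zero (hL : 0 < L) (hH : 0 < H)
    (hf : ContinuousOn f (closedChannel H)) (hp : PeriodicOn L f (closedChannel H))
    (h : ∫ x in cell L H, f x ^ 2 = 0) : ∀ x ∈ closedChannel H, f x = 0 := by
  have hcell : ∀ x ∈ cell L H, f x = 0 := by
    have hae := (setIntegral_eq_zero_iff_of_nonneg_ae (Filter.Eventually.of_forall fun x => sq_nonneg (f x))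
      (integrableOn_cell (hf.pow 2))).1 h
    have := Measure.eqOn_open_of_ae_eq hae (isOpen_Ioo.prod isOpen_Ioo)
      ((hf.pow 2).mono cell_subset_closedChannel) continuousOn_const
    intro x hx
    simpa using this hx
  have hclos : ∀ x ∈ Icc 0 L ×ˢ Icc 0 H, f x = 0 := by
    have hcl : closure (cell L H) = Icc 0 L ×ˢ Icc 0 H := by
      rw [cell, closure_prod_eq, closure_Ioo hL.ne, closure_Ioo hH.ne]
    have : EqOn f (fun _ => 0) (Icc 0 L ×ˢ Icc 0 H) := by
      rw [← hcl]
      exact EqOn.of_subset_closure (s := cell L H) hcell (hcl ▸ hf.mono (Icc_subset_closedChannel 0 L))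
        continuousOn_const subset_closure subset_rfl
    exact this
  rintro ⟨x, y⟩ ⟨-, hy⟩
  have hper : Function.Periodic (fun s => f (s, y)) L := fun s => hp (s, y) ⟨mem_univ _, hy⟩
  obtain ⟨x', hx', he⟩ := hper.exists_mem_Ico₀ hL x
  rw [show f (x, y) = f (x', y) from he]
  exact hclos _ ⟨Ico_subset_Icc_self hx', hy⟩

end PeriodicChannel
end

/-! ### Wirtinger and Poincaré inequalities -/

noncomputable section
namespace PeriodicChannel

/-- Wirtinger's inequality for functions vanishing at both ends of an interval. -/
lemma wirtinger_dirichlet {H : ℝ} (hH : 0 < H) {u u' : ℝ → ℝ} (hu : ContinuousOn u (Icc 0 H))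
    (hu' : ContinuousOn u' (Icc 0 H)) (hd : ∀ y ∈ Ioo 0 H, HasDerivAt u (u' y) y)
    (h0 : u 0 = 0) (h1 : u H = 0) :
    (Real.pi / H) ^ 2 * ∫ y in (0 : ℝ)..H, u y ^ 2 ≤ ∫ y in (0 : ℝ)..H, u' y ^ 2 := by
  have key : ∀ k ∈ Ioo 0 (Real.pi / H),
      k ^ 2 * ∫ y in (0 : ℝ)..H, u y ^ 2 ≤ ∫ y in (0 : ℝ)..H, u' y ^ 2 := by
    rintro k ⟨hk0, hk1⟩
    have hkH : k * H < Real.pi := (lt_div_iff₀ hH).1 hk1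
    -- For `k < π/H` the centred phase stays strictly between `0` and `π` on the closed interval, so
    -- `sin θ` is a positive solution of `s'' = -k² s`. With `h = k u² cot θ` one has `u'² - k²u² -
    -- h' = (u' - k u cot θ)²`, and `h` vanishes at both ends. The sharp constant follows as `k`
    -- increases to `π/H`.
    set θ : ℝ → ℝ := fun y => k * y + (Real.pi - k * H) / 2 with hθ
    have hθd : ∀ y, HasDerivAt θ k y := fun y => by
      simpa [hθ] using ((hasDerivAt_id y).const_mul k).add_const ((Real.pi - k * H) / 2)
    have hsin : ∀ y ∈ Icc 0 H, 0 < Real.sin (θ y) := fun y hy =>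
      Real.sin_pos_of_pos_of_lt_pi (by have := mul_nonneg hk0.le hy.1; simp only [hθ]; linarith)
        (by have := mul_le_mul_of_nonneg_left hy.2 hk0.le; simp only [hθ]; linarith)
    have hsin' : ∀ y ∈ Icc 0 H, Real.sin (θ y) ≠ 0 := fun y hy => (hsin y hy).ne'
    have hθc : Continuous θ := by fun_prop
    have hc : ContinuousOn (fun y => Real.cos (θ y)) (Icc 0 H) := by fun_prop
    have hs : ContinuousOn (fun y => Real.sin (θ y)) (Icc 0 H) := by fun_prop
    set h : ℝ → ℝ := fun y => k * u y ^ 2 * (Real.cos (θ y) / Real.sin (θ y))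
    set h' : ℝ → ℝ := fun y => 2 * k * u y * u' y * (Real.cos (θ y) / Real.sin (θ y))
      - k ^ 2 * u y ^ 2 / Real.sin (θ y) ^ 2 with hh'
    have hcot : ContinuousOn (fun y => Real.cos (θ y) / Real.sin (θ y)) (Icc 0 H) := hc.div hs hsin'
    have hcont : ContinuousOn h (Icc 0 H) := (continuousOn_const.mul (hu.pow 2)).mul hcot
    have hcont' : ContinuousOn h' (Icc 0 H) :=
      (((continuousOn_const.mul hu).mul hu').mul hcot).sub
        ((continuousOn_const.mul (hu.pow 2)).div (hs.pow 2) fun y hy => pow_ne_zero 2 (hsin' y hy))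
    have hderiv : ∀ y ∈ Ioo 0 H, HasDerivAt h (h' y) y := fun y hy => by
      have hne := hsin' y (Ioo_subset_Icc_self hy)
      have := (((hd y hy).pow 2).const_mul k).mul (((hθd y).cos).div ((hθd y).sin) hne)
      refine this.congr_deriv ?_
      have hsc := Real.sin_sq_add_cos_sq (θ y)
      simp only [hh', Pi.pow_apply, Pi.div_apply, Nat.cast_ofNat, Nat.add_one_sub_one, pow_one]
      field_simp
      linear_combination (-k * u y ^ 2) * hsc
    have hint : ∫ y in (0 : ℝ)..H, h' y = 0 := by
      rw [intervalIntegral.integral_eq_sub_of_hasDerivAt_of_le hH.le hcont hderiv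
        (hcont'.intervalIntegrable_of_Icc hH.le)]
      simp [h, h0, h1]
    have hnn : 0 ≤ ∫ y in (0 : ℝ)..H, (u' y ^ 2 - k ^ 2 * u y ^ 2 - h' y) := by
      refine intervalIntegral.integral_nonneg hH.le fun y hy => ?_
      have hne := hsin' y hy
      have hsc := Real.sin_sq_add_cos_sq (θ y)
      have : u' y ^ 2 - k ^ 2 * u y ^ 2 - h' y
          = (u' y - k * u y * (Real.cos (θ y) / Real.sin (θ y))) ^ 2 := by
        simp only [hh']
        field_simp
        linear_combination (-k ^ 2 * u y ^ 2) * hsc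
      rw [this]; positivity
    have i1 : IntervalIntegrable (fun y => u' y ^ 2) volume 0 H :=
      (hu'.pow 2).intervalIntegrable_of_Icc hH.le
    have i2 : IntervalIntegrable (fun y => k ^ 2 * u y ^ 2) volume 0 H :=
      (continuousOn_const.mul (hu.pow 2)).intervalIntegrable_of_Icc hH.le
    rw [intervalIntegral.integral_sub (i1.sub i2) (hcont'.intervalIntegrable_of_Icc hH.le),
      intervalIntegral.integral_sub i1 i2, intervalIntegral.integral_const_mul, hint] at hnn
    linarith
  have hpos : 0 < Real.pi / H := div_pos Real.pi_pos hH
  have ht : Filter.Tendsto (fun k : ℝ => k ^ 2 * ∫ y in (0 : ℝ)..H, u y ^ 2)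
      (nhdsWithin (Real.pi / H) (Iio (Real.pi / H)))
      (nhds ((Real.pi / H) ^ 2 * ∫ y in (0 : ℝ)..H, u y ^ 2)) :=
    (Continuous.tendsto (by fun_prop) _).mono_left nhdsWithin_le_nhds
  exact le_of_tendsto ht (by filter_upwards [Ioo_mem_nhdsLT hpos] with k hk using key k hk)

/-- Wirtinger's inequality for periodic functions of mean zero. -/
lemma wirtinger_periodic {T : ℝ} (hT : 0 < T) {u u' : ℝ → ℝ} (hu : ContinuousOn u (Icc 0 T))
    (hu' : ContinuousOn u' (Icc 0 T)) (hd : ∀ y ∈ Ioo 0 T, HasDerivAt u (u' y) y)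
    (hp : u T = u 0) (hm : ∫ y in (0 : ℝ)..T, u y = 0) :
    (2 * Real.pi / T) ^ 2 * ∫ y in (0 : ℝ)..T, u y ^ 2 ≤ ∫ y in (0 : ℝ)..T, u' y ^ 2 := by
  have hmem : ∀ {w : ℝ → ℝ}, ContinuousOn w (Icc 0 T) →
      MemLp (fun x => (w x : ℂ)) 2 (volume.restrict (Ioc 0 T)) := fun {w} hw => by
    have hc : ContinuousOn (fun x => (w x : ℂ)) (Icc 0 T) := by fun_prop
    obtain ⟨B, hB⟩ := isCompact_Icc.exists_bound_of_continuousOn hc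
    refine MemLp.of_bound ((hc.integrableOn_Icc).mono_set Ioc_subset_Icc_self).aestronglyMeasurable
      B ?_
    filter_upwards [ae_restrict_mem measurableSet_Ioc] with x hx
      using hB x (Ioc_subset_Icc_self hx)
  have hs := hasSum_sq_fourierCoeffOn hT (hmem hu)
  have hs' := hasSum_sq_fourierCoeffOn hT (hmem hu')
  -- Parseval reduces the claim to single modes. The zero mode vanishes because the mean does. For
  -- the others, integration by parts multiplies the coefficient by `2πin/T`, and `|n| ≥ 1`.
  have hle : ∀ n : ℤ, (2 * Real.pi / T) ^ 2 * ‖fourierCoeffOn hT (fun x => (u x : ℂ)) n‖ ^ 2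
      ≤ ‖fourierCoeffOn hT (fun x => (u' x : ℂ)) n‖ ^ 2 := by
    intro n
    rcases eq_or_ne n 0 with rfl | hn
    · have : fourierCoeffOn hT (fun x => (u x : ℂ)) 0 = 0 := by
        rw [fourierCoeffOn_eq_integral]
        have : ∫ x in (0 : ℝ)..T, (u x : ℂ) = 0 := by
          rw [intervalIntegral.integral_ofReal, hm]; simp
        simp [this]
      rw [this]; simp
    · have h := fourierCoeffOn_of_hasDerivAt_Ioo hT (f := fun x => (u x : ℂ))
        (f' := fun x => (u' x : ℂ)) hn (by rw [uIcc_of_le hT.le]; fun_prop)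
        (fun x hx => by
          rw [min_eq_left hT.le, max_eq_right hT.le] at hx
          exact (hd x hx).ofReal_comp)
        (ContinuousOn.intervalIntegrable_of_Icc hT.le (by fun_prop))
      rw [hp, sub_self, mul_zero, zero_sub] at h
      rw [h]
      have hn1 : (1 : ℝ) ≤ |(n : ℝ)| := by exact_mod_cast Int.one_le_abs hn
      have hn2 : (1 : ℝ) ≤ (n : ℝ) ^ 2 := by rw [← sq_abs]; nlinarith
      rw [Complex.ofReal_zero, sub_zero]
      simp only [norm_mul, norm_div, norm_one, norm_neg, Complex.norm_ofNat,
        Complex.norm_real, Real.norm_eq_abs, Complex.norm_I, Complex.norm_intCast, mul_one,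
        abs_of_pos Real.pi_pos, abs_of_pos hT]
      set X := ‖fourierCoeffOn hT (fun x => (u' x : ℂ)) n‖
      have hpi := Real.pi_pos
      have : (2 * Real.pi / T) ^ 2 * (1 / (2 * Real.pi * |(n : ℝ)|) * (T * X)) ^ 2
          = X ^ 2 / (n : ℝ) ^ 2 := by
        rw [← sq_abs (n : ℝ)]
        field_simp
      rw [this]
      exact div_le_self (sq_nonneg _) hn2
  have := hasSum_le hle (hs.mul_left _) hs'
  simp only [sub_zero, smul_eq_mul, Complex.norm_real, Real.norm_eq_abs, sq_abs] at this
  rw [mul_left_comm] at this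
  exact le_of_mul_le_mul_left this (inv_pos.2 hT)

/-- The optimal constant in the Poincaré inequality for functions of mean zero with the same
constant value on both walls. -/
def poincareConst (L H : ℝ) : ℝ :=
  min ((2 * Real.pi / H) ^ 2) ((Real.pi / H) ^ 2 + (2 * Real.pi / L) ^ 2)

variable {L H : ℝ} {f f1 f2 : ℝ × ℝ → ℝ}

lemma hasDerivAt_integral_row (hL : 0 ≤ L) (hf : C1On L H f f1 f2) {y : ℝ} (hy : y ∈ Ioo 0 H) :
    HasDerivAt (fun y => ∫ x in (0 : ℝ)..L, f (x, y)) (∫ x in (0 : ℝ)..L, f2 (x, y)) y := by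
  simp_rw [intervalIntegral.integral_of_le hL]
  have hsub : ∀ {g : ℝ × ℝ → ℝ}, ContinuousOn g (closedChannel H) →
      ContinuousOn (fun q : ℝ × ℝ => g (q.2, q.1)) (Icc 0 H ×ˢ Icc 0 L) := fun hg =>
    hg.comp (by fun_prop) fun q hq => mk_mem_closedChannel hq.1
  exact hasDerivAt_setIntegral (F := fun y x => f (x, y)) (F' := fun y x => f2 (x, y))
    isCompact_Icc measurableSet_Ioc Ioc_subset_Icc_self hy (hsub hf.cont) (hsub hf.cont2)
    fun t ht x _ => hf.deriv2 (x, t) (mk_mem_channel ht)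

/-- The horizontal mean as a function on the channel. -/
lemma C1On.mean (hL : 0 ≤ L) (hf : C1On L H f f1 f2) :
    C1On L H (fun x => L⁻¹ * ∫ s in (0 : ℝ)..L, f (s, x.2)) (fun _ => 0)
      (fun x => L⁻¹ * ∫ s in (0 : ℝ)..L, f2 (s, x.2)) :=
  C1On.of_vertical (a := fun y => L⁻¹ * ∫ s in (0 : ℝ)..L, f (s, y))
    (a' := fun y => L⁻¹ * ∫ s in (0 : ℝ)..L, f2 (s, y))
    (continuousOn_const.mul (continuousOn_integral_row hL hf.cont))
    (continuousOn_const.mul (continuousOn_integral_row hL hf.cont2))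
    fun _ hy => (hasDerivAt_integral_row hL hf hy).const_mul _

lemma C1On.wirtinger_column (hL : 0 ≤ L) (hH : 0 < H) (hf : C1On L H f f1 f2)
    (h0 : ∀ s, f (s, 0) = 0) (h1 : ∀ s, f (s, H) = 0) :
    (Real.pi / H) ^ 2 * ∫ x in cell L H, f x ^ 2 ≤ ∫ x in cell L H, f2 x ^ 2 := by
  rw [setIntegral_cell_eq (f := fun x => f x ^ 2) hL hH.le (hf.cont.pow 2),
    setIntegral_cell_eq (f := fun x => f2 x ^ 2) hL hH.le (hf.cont2.pow 2),
    ← intervalIntegral.integral_const_mul]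
  refine intervalIntegral.integral_mono_on hL ?_ ?_ fun x _ =>
    wirtinger_dirichlet hH (continuousOn_column hf.cont x) (continuousOn_column hf.cont2 x)
      (fun y hy => hf.deriv2 (x, y) (mk_mem_channel hy)) (h0 x) (h1 x)
  · exact (continuousOn_const.mul (continuousOn_integral_column hH.le (hf.cont.pow 2) 0 L)
      ).intervalIntegrable_of_Icc hL
  · exact (continuousOn_integral_column hH.le (hf.cont2.pow 2) 0 L).intervalIntegrable_of_Icc hL

lemma C1On.wirtinger_row (hL : 0 < L) (hH : 0 ≤ H) (hf : C1On L H f f1 f2)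
    (h : ∀ y ∈ Icc 0 H, ∫ x in (0 : ℝ)..L, f (x, y) = 0) :
    (2 * Real.pi / L) ^ 2 * ∫ x in cell L H, f x ^ 2 ≤ ∫ x in cell L H, f1 x ^ 2 := by
  rw [setIntegral_cell_eq' (f := fun x => f x ^ 2) hL.le hH (hf.cont.pow 2),
    setIntegral_cell_eq' (f := fun x => f1 x ^ 2) hL.le hH (hf.cont1.pow 2),
    ← intervalIntegral.integral_const_mul]
  refine intervalIntegral.integral_mono_on_of_le_Ioo hH ?_ ?_ fun y hy => ?_
  · exact (continuousOn_const.mul (continuousOn_integral_row hL.le (hf.cont.pow 2))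
      ).intervalIntegrable_of_Icc hH
  · exact (continuousOn_integral_row hL.le (hf.cont1.pow 2)).intervalIntegrable_of_Icc hH
  · have hy' := Ioo_subset_Icc_self hy
    refine wirtinger_periodic hL (continuousOn_row hf.cont hy').continuousOn
      (continuousOn_row hf.cont1 hy').continuousOn
      (fun x _ => hf.deriv1 (x, y) (mk_mem_channel hy)) ?_ (h y hy')
    simpa using hf.periodic (0, y) (mk_mem_closedChannel hy')

/-- The Poincaré inequality for functions of mean zero with the same constant value on both
walls. -/
lemma C1On.poincare {c : ℝ} (hL : 0 < L) (hH : 0 < H) (hf : C1On L H f f1 f2)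
    (h0 : ∀ s, f (s, 0) = c) (h1 : ∀ s, f (s, H) = c) (hm : ∫ x in cell L H, f x = 0) :
    poincareConst L H * ∫ x in cell L H, f x ^ 2 ≤ ∫ x in cell L H, (f1 x ^ 2 + f2 x ^ 2) := by
  -- The function splits orthogonally into its horizontal mean `a` and a remainder. The remainder
  -- vanishes on the walls and has mean zero on every horizontal line, so it satisfies both
  -- one-dimensional inequalities and their constants add.
  set a : ℝ → ℝ := fun y => L⁻¹ * ∫ s in (0 : ℝ)..L, f (s, y) with ha
  set a' : ℝ → ℝ := fun y => L⁻¹ * ∫ s in (0 : ℝ)..L, f2 (s, y) with ha'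
  have hA : C1On L H (fun x => a x.2) (fun _ => 0) (fun x => a' x.2) := hf.mean hL.le
  have hac : ContinuousOn a (Icc 0 H) :=
    continuousOn_const.mul (continuousOn_integral_row hL.le hf.cont)
  have hac' : ContinuousOn a' (Icc 0 H) :=
    continuousOn_const.mul (continuousOn_integral_row hL.le hf.cont2)
  have hξ := hf.sub hA
  have hrow : ∀ {k : ℝ × ℝ → ℝ}, ContinuousOn k (closedChannel H) → ∀ y ∈ Icc 0 H,
      IntervalIntegrable (fun x => k (x, y)) volume 0 L := fun hk y hy =>
    (continuousOn_row hk hy).intervalIntegrable _ _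
  have hmean : ∀ y ∈ Icc 0 H, ∫ x in (0 : ℝ)..L, (f (x, y) - a y) = 0 := fun y hy => by
    rw [intervalIntegral.integral_sub (hrow hf.cont y hy) (by simp)]
    simp only [intervalIntegral.integral_const, sub_zero, smul_eq_mul, ha]
    field_simp; simp
  have hmean' : ∀ y ∈ Icc 0 H, ∫ x in (0 : ℝ)..L, (f2 (x, y) - a' y) = 0 := fun y hy => by
    rw [intervalIntegral.integral_sub (hrow hf.cont2 y hy) (by simp)]
    simp only [intervalIntegral.integral_const, sub_zero, smul_eq_mul, ha']
    field_simp; simp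
  have w1 := hξ.wirtinger_row hL hH.le hmean
  have w2 := hξ.wirtinger_column hL.le hH
    (by intro s; simp only [ha, h0]; simp; field_simp; simp)
    (by intro s; simp only [ha, h1]; simp; field_simp; simp)
  have hcell : ∀ {b : ℝ → ℝ}, ContinuousOn b (Icc 0 H) →
      ∫ x in cell L H, b x.2 = L * ∫ y in (0 : ℝ)..H, b y := fun {b} hb => by
    rw [setIntegral_cell_eq' (f := fun x => b x.2) hL.le hH.le (hb.comp continuousOn_snd fun _ hx => hx.2)]
    simp
  -- The mean takes the same unprescribed value at both walls and integrates to zero, so it is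
  -- treated as an `H`-periodic function: the constant is `2π/H`, not `π/H`.
  have w3 : (2 * Real.pi / H) ^ 2 * ∫ x in cell L H, a x.2 ^ 2 ≤ ∫ x in cell L H, a' x.2 ^ 2 := by
    rw [hcell (b := fun y => a y ^ 2) (hac.pow 2), hcell (b := fun y => a' y ^ 2) (hac'.pow 2),
      mul_left_comm]
    refine mul_le_mul_of_nonneg_left (wirtinger_periodic hH hac hac'
      (fun y hy => (hasDerivAt_integral_row hL.le hf hy).const_mul _) ?_ ?_) hL.le
    · simp [ha, h0, h1]
    · rw [setIntegral_cell_eq' hL.le hH.le hf.cont] at hm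
      simp [ha, hm]
  have orth : ∀ {k : ℝ × ℝ → ℝ} {b : ℝ → ℝ}, ContinuousOn k (closedChannel H) →
      ContinuousOn b (Icc 0 H) → (∀ y ∈ Icc 0 H, ∫ x in (0 : ℝ)..L, (k (x, y) - b y) = 0) →
      ∫ x in cell L H, k x ^ 2
        = (∫ x in cell L H, (k x - b x.2) ^ 2) + ∫ x in cell L H, b x.2 ^ 2 := by
    intro k b hk hb h
    have hb' : ContinuousOn (fun x : ℝ × ℝ => b x.2) (closedChannel H) :=
      hb.comp continuousOn_snd fun _ hx => hx.2
    have hb2 : ContinuousOn (fun x : ℝ × ℝ => 2 * b x.2 * (k x - b x.2)) (closedChannel H) :=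
      (continuousOn_const.mul hb').mul (hk.sub hb')
    have hb3 : ContinuousOn (fun x : ℝ × ℝ => (k x - b x.2) ^ 2) (closedChannel H) :=
      (hk.sub hb').pow 2
    have hb4 : ContinuousOn (fun x : ℝ × ℝ => b x.2 ^ 2) (closedChannel H) := hb'.pow 2
    have hb5 : ContinuousOn (fun x : ℝ × ℝ => (k x - b x.2) ^ 2 + b x.2 ^ 2) (closedChannel H) :=
      hb3.add hb4
    have hz : ∫ x in cell L H, 2 * b x.2 * (k x - b x.2) = 0 := by
      rw [setIntegral_cell_eq' hL.le hH.le hb2,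
        intervalIntegral_congr_Ioo hH.le (g := fun _ => 0) fun y hy => ?_]
      · simp
      · simp only [intervalIntegral.integral_const_mul, h y (Ioo_subset_Icc_self hy), mul_zero]
    rw [← add_zero ((∫ x in cell L H, _) + _), ← hz,
      ← integral_add (integrableOn_cell hb3) (integrableOn_cell hb4),
      ← integral_add (integrableOn_cell hb5) (integrableOn_cell hb2)]
    congr 1; ext x; ring
  have hc1 := hf.cont1; have hc2 := hf.cont2
  rw [integral_add (integrableOn_cell (by fun_prop)) (integrableOn_cell (by fun_prop)),
    orth hf.cont hac hmean, orth hf.cont2 hac' hmean', mul_add]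
  simp only [sub_zero] at w1
  have p1 : 0 ≤ ∫ x in cell L H, (f x - a x.2) ^ 2 := integral_nonneg fun x => sq_nonneg _
  have p2 : 0 ≤ ∫ x in cell L H, a x.2 ^ 2 := integral_nonneg fun x => sq_nonneg _
  have q1 := mul_le_mul_of_nonneg_right
    (min_le_right ((2 * Real.pi / H) ^ 2) ((Real.pi / H) ^ 2 + (2 * Real.pi / L) ^ 2)) p1
  have q2 := mul_le_mul_of_nonneg_right
    (min_le_left ((2 * Real.pi / H) ^ 2) ((Real.pi / H) ^ 2 + (2 * Real.pi / L) ^ 2)) p2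
  rw [poincareConst]
  linarith

lemma poincareConst_pos (hL : 0 < L) (hH : 0 < H) : 0 < poincareConst L H := by
  have := Real.pi_pos
  rw [poincareConst]; positivity

end PeriodicChannel
end

/-! ### Sobolev inequalities in the channel -/

noncomputable section
namespace PeriodicChannel

variable {L H : ℝ} {f f1 f2 : ℝ × ℝ → ℝ}

/-- Cauchy–Schwarz, from the discriminant of the nonnegative quadratic `t ↦ ∫(a + t b)²`. -/
lemma sq_setIntegral_mul_le {a b : ℝ × ℝ → ℝ} (ha : ContinuousOn a (closedChannel H))
    (hb : ContinuousOn b (closedChannel H)) :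
    (∫ x in cell L H, a x * b x) ^ 2
      ≤ (∫ x in cell L H, a x ^ 2) * ∫ x in cell L H, b x ^ 2 := by
  have i1 : IntegrableOn (fun x => a x ^ 2) (cell L H) := integrableOn_cell (ha.pow 2)
  have i2 : IntegrableOn (fun x => a x * b x) (cell L H) := integrableOn_cell (ha.mul hb)
  have i3 : IntegrableOn (fun x => b x ^ 2) (cell L H) := integrableOn_cell (hb.pow 2)
  have key : ∀ t : ℝ, 0 ≤ (∫ x in cell L H, b x ^ 2) * (t * t)
      + (2 * ∫ x in cell L H, a x * b x) * t + ∫ x in cell L H, a x ^ 2 := by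
    intro t
    have : 0 ≤ ∫ x in cell L H, (a x + t * b x) ^ 2 := integral_nonneg fun x => sq_nonneg _
    convert this using 1
    have e : ∀ x, (a x + t * b x) ^ 2 = t * t * b x ^ 2 + 2 * t * (a x * b x) + a x ^ 2 :=
      fun x => by ring
    simp_rw [e]
    rw [integral_add, integral_add (i3.const_mul _) (i2.const_mul _), integral_const_mul,
      integral_const_mul]
    · ring
    · exact (i3.const_mul _).add (i2.const_mul _)
    · exact i1
  have := discrim_le_zero key
  rw [discrim] at this
  linarith

lemma C1On.abs_le_column (hf : C1On L H f f1 f2) (h0 : ∀ s, f (s, 0) = 0) (x : ℝ) {y : ℝ}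
    (hy : y ∈ Icc 0 H) : |f (x, y)| ≤ ∫ s in (0 : ℝ)..H, |f2 (x, s)| := by
  have hc := (continuousOn_column hf.cont2 x)
  have e : ∫ s in (0 : ℝ)..y, f2 (x, s) = f (x, y) - f (x, 0) :=
    intervalIntegral.integral_eq_sub_of_hasDerivAt_of_le hy.1
      ((continuousOn_column hf.cont x).mono (Icc_subset_Icc_right hy.2))
      (fun s hs => hf.deriv2 (x, s) (mk_mem_channel ⟨hs.1, hs.2.trans_le hy.2⟩))
      ((hc.mono (Icc_subset_Icc_right hy.2)).intervalIntegrable_of_Icc hy.1)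
  rw [h0, sub_zero] at e
  rw [← e]
  refine (intervalIntegral.abs_integral_le_integral_abs hy.1).trans ?_
  exact intervalIntegral.integral_mono_interval le_rfl hy.1 hy.2
    (Filter.Eventually.of_forall fun s => abs_nonneg _)
    (hc.abs.intervalIntegrable_of_Icc (hy.1.trans hy.2))

/-- There is no zero to start from along a horizontal line, so the value at `x` is compared with the
value at every `s` of the period and the comparison is averaged over `s`. -/
lemma C1On.abs_le_row (hL : 0 < L) (hf : C1On L H f f1 f2) {x y : ℝ} (hx : x ∈ Icc 0 L)
    (hy : y ∈ Ioo 0 H) :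
    |f (x, y)| ≤ L⁻¹ * (∫ s in (0 : ℝ)..L, |f (s, y)|) + ∫ s in (0 : ℝ)..L, |f1 (s, y)| := by
  have hy' := Ioo_subset_Icc_self hy
  have hc := continuousOn_row hf.cont hy'
  have hc1 := continuousOn_row hf.cont1 hy'
  have key : ∀ s ∈ Icc 0 L, |f (x, y)| ≤ |f (s, y)| + ∫ s in (0 : ℝ)..L, |f1 (s, y)| := by
    intro s hs
    have e : ∫ r in s..x, f1 (r, y) = f (x, y) - f (s, y) :=
      intervalIntegral.integral_eq_sub_of_hasDerivAt (f := fun r => f (r, y))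
        (fun r _ => hf.deriv1 (r, y) (mk_mem_channel hy)) (hc1.intervalIntegrable _ _)
    have h2 : |∫ r in s..x, f1 (r, y)| ≤ ∫ s in (0 : ℝ)..L, |f1 (s, y)| := by
      refine (intervalIntegral.norm_integral_le_integral_norm_uIoc (f := fun r => f1 (r, y))
        (μ := volume)).trans ?_
      rw [intervalIntegral.integral_of_le hL.le]
      refine setIntegral_mono_set ?_ (Filter.Eventually.of_forall fun s => norm_nonneg _) ?_
      · exact (hc1.norm.integrableOn_Icc).mono_set Ioc_subset_Icc_self
      · exact Filter.Eventually.of_forall (Ioc_subset_Ioc (le_min hs.1 hx.1) (max_le hs.2 hx.2))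
    rw [e] at h2
    have := abs_sub_abs_le_abs_sub (f (x, y)) (f (s, y))
    linarith
  have hi := intervalIntegral.integral_mono_on hL.le (continuous_const.intervalIntegrable (μ := volume) _ _)
    ((hc.abs.add continuous_const).intervalIntegrable 0 L) key
  simp only [Pi.add_apply] at hi
  rw [intervalIntegral.integral_add (hc.abs.intervalIntegrable _ _) (by simp)] at hi
  simp only [intervalIntegral.integral_const, sub_zero, smul_eq_mul] at hi
  refine le_of_mul_le_mul_left ?_ hL
  rw [mul_add, mul_inv_cancel_left₀ hL.ne']
  exact hi

/-- The Gagliardo–Nirenberg inequality `‖f‖₂ ≲ ‖∇f‖₁` in the channel. -/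
lemma C1On.sobolev_one (hL : 0 < L) (hH : 0 < H) (hf : C1On L H f f1 f2)
    (h0 : ∀ s, f (s, 0) = 0) :
    ∫ x in cell L H, f x ^ 2 ≤ (H / L + 1) * (∫ x in cell L H, (|f1 x| + |f2 x|)) ^ 2 := by
  set B : ℝ → ℝ := fun y =>
    L⁻¹ * (∫ s in (0 : ℝ)..L, |f (s, y)|) + ∫ s in (0 : ℝ)..L, |f1 (s, y)| with hB
  have hBc : ContinuousOn B (Icc 0 H) :=
    (continuousOn_const.mul (continuousOn_integral_row hL.le hf.cont.abs)).add
      (continuousOn_integral_row hL.le hf.cont1.abs)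
  set A : ℝ → ℝ := fun x => ∫ s in (0 : ℝ)..H, |f2 (x, s)| with hA
  have hAc : ContinuousOn A (Icc 0 L) := continuousOn_integral_column hH.le hf.cont2.abs 0 L
  have e1 : ∫ x in cell L H, |f x| = ∫ y in (0 : ℝ)..H, ∫ s in (0 : ℝ)..L, |f (s, y)| :=
    setIntegral_cell_eq' hL.le hH.le hf.cont.abs
  have e2 : ∫ x in cell L H, |f1 x| = ∫ y in (0 : ℝ)..H, ∫ s in (0 : ℝ)..L, |f1 (s, y)| :=
    setIntegral_cell_eq' hL.le hH.le hf.cont1.abs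
  have e3 : ∫ x in cell L H, |f2 x| = ∫ x in (0 : ℝ)..L, A x :=
    setIntegral_cell_eq hL.le hH.le hf.cont2.abs
  have e4 : ∫ x in cell L H, |f x| ≤ H * ∫ x in cell L H, |f2 x| := by
    rw [setIntegral_cell_eq (f := fun x => |f x|) hL.le hH.le hf.cont.abs, e3,
      ← intervalIntegral.integral_const_mul]
    refine intervalIntegral.integral_mono_on hL.le ?_ ?_ fun x _ => ?_
    · exact (continuousOn_integral_column hH.le hf.cont.abs 0 L).intervalIntegrable_of_Icc hL.le
    · exact (continuousOn_const.mul hAc).intervalIntegrable_of_Icc hL.le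
    · have := intervalIntegral.integral_mono_on hH.le
        ((continuousOn_column hf.cont.abs x).intervalIntegrable_of_Icc hH.le)
        (continuous_const.intervalIntegrable (μ := volume) _ _)
        (fun y hy => hf.abs_le_column h0 x hy)
      simpa using this
  have e5 : ∫ y in (0 : ℝ)..H, B y
      = L⁻¹ * (∫ x in cell L H, |f x|) + ∫ x in cell L H, |f1 x| := by
    rw [e1, e2, ← intervalIntegral.integral_const_mul, ← intervalIntegral.integral_add]
    · exact (continuousOn_const.mul (continuousOn_integral_row hL.le hf.cont.abs)
        ).intervalIntegrable_of_Icc hH.le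
    · exact (continuousOn_integral_row hL.le hf.cont1.abs).intervalIntegrable_of_Icc hH.le
  -- One factor of `f²` is bounded by a function of `x₁` alone, the other by a function of `x₂`
  -- alone, so the double integral factors.
  have main : ∫ x in cell L H, f x ^ 2 ≤ (∫ x in (0 : ℝ)..L, A x) * ∫ y in (0 : ℝ)..H, B y := by
    rw [setIntegral_cell_eq (f := fun x => f x ^ 2) hL.le hH.le (hf.cont.pow 2),
      ← intervalIntegral.integral_mul_const]
    refine intervalIntegral.integral_mono_on hL.le ?_ ?_ fun x hx => ?_
    · exact (continuousOn_integral_column hH.le (hf.cont.pow 2) 0 L).intervalIntegrable_of_Icc hL.le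
    · exact (hAc.mul continuousOn_const).intervalIntegrable_of_Icc hL.le
    · rw [← intervalIntegral.integral_const_mul]
      refine intervalIntegral.integral_mono_on_of_le_Ioo hH.le ?_ ?_ fun y hy => ?_
      · exact (continuousOn_column (hf.cont.pow 2) x).intervalIntegrable_of_Icc hH.le
      · exact (continuousOn_const.mul hBc).intervalIntegrable_of_Icc hH.le
      · rw [← sq_abs, sq]
        have h1 := hf.abs_le_column h0 x (Ioo_subset_Icc_self hy)
        exact mul_le_mul h1 (hf.abs_le_row hL hx hy) (abs_nonneg _) ((abs_nonneg _).trans h1)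
  rw [← e3, e5] at main
  have p1 : 0 ≤ ∫ x in cell L H, |f1 x| := integral_nonneg fun x => abs_nonneg _
  have p2 : 0 ≤ ∫ x in cell L H, |f2 x| := integral_nonneg fun x => abs_nonneg _
  rw [integral_add (integrableOn_cell hf.cont1.abs) (integrableOn_cell hf.cont2.abs)]
  set N1 := ∫ x in cell L H, |f1 x|
  set N2 := ∫ x in cell L H, |f2 x|
  have hr : 0 ≤ H / L := by positivity
  calc _ ≤ N2 * (L⁻¹ * (H * N2) + N1) := main.trans (by gcongr)
    _ = N2 * (H / L * N2 + N1) := by ring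
    _ ≤ _ := by nlinarith [mul_nonneg hr (sq_nonneg N1), mul_nonneg hr (mul_nonneg p1 p2),
                  mul_nonneg p1 p2, sq_nonneg N1, sq_nonneg N2]

/-- The Sobolev inequality in the channel for functions vanishing on the lower wall. -/
lemma sobolev_zero (hL : 0 < L) (hH : 0 < H) (k : ℕ) :
    ∃ C : ℝ, 0 ≤ C ∧ ∀ f f1 f2 : ℝ × ℝ → ℝ, C1On L H f f1 f2 → (∀ s, f (s, 0) = 0) →
      ∫ x in cell L H, f x ^ (2 * k) ≤ C * (∫ x in cell L H, (f1 x ^ 2 + f2 x ^ 2)) ^ k := by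
  induction k with
  | zero =>
    refine ⟨L * H, by positivity, fun f f1 f2 _ _ => ?_⟩
    simp [setIntegral_cell_const hL.le hH.le]
  | succ k ih =>
    obtain ⟨C, hC, h⟩ := ih
    refine ⟨(H / L + 1) * (k + 1) ^ 2 * (C * 2), by positivity, fun f f1 f2 hf h0 => ?_⟩
    -- The `L¹` inequality is applied to `f^(k+1)`, with gradient `(k+1) f^k ∇f`. Cauchy–Schwarz
    -- separates `f^k`, covered by the induction hypothesis, from `∇f`.
    have hw := (hf.comp (φ := fun s => s ^ (k + 1)) (φ' := fun s => (k + 1) * s ^ k)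
      (fun s => by simpa using hasDerivAt_pow (k + 1) s) (by fun_prop)).sobolev_one hL hH
      (fun s => by simp [h0])
    have hc := hf.cont; have hc1 := hf.cont1; have hc2 := hf.cont2
    set X := ∫ x in cell L H, (f1 x ^ 2 + f2 x ^ 2)
    have hX : 0 ≤ X := integral_nonneg fun x => by positivity
    have e1 : ∀ x, |(k + 1) * f x ^ k * f1 x| + |(k + 1) * f x ^ k * f2 x|
        = (k + 1) * (|f x ^ k| * (|f1 x| + |f2 x|)) := fun x => by
      simp only [abs_mul, abs_of_nonneg (by positivity : (0 : ℝ) ≤ k + 1)]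
      ring
    simp_rw [e1, integral_const_mul] at hw
    have cs := sq_setIntegral_mul_le (L := L) (hc.pow k).abs (hc1.abs.add hc2.abs)
    have e2 : ∫ x in cell L H, (|f1 x| + |f2 x|) ^ 2 ≤ 2 * X := by
      rw [← integral_const_mul]
      refine setIntegral_mono (integrableOn_cell (by fun_prop)) (integrableOn_cell (by fun_prop))
        fun x => ?_
      have := sq_nonneg (|f1 x| - |f2 x|)
      simp only
      nlinarith [sq_abs (f1 x), sq_abs (f2 x)]
    have e3 : ∫ x in cell L H, |f x ^ k| ^ 2 = ∫ x in cell L H, f x ^ (2 * k) := by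
      congr 1; ext x; rw [sq_abs, ← pow_mul, mul_comm]
    have hk := h f f1 f2 hf h0
    calc ∫ x in cell L H, f x ^ (2 * (k + 1))
        = ∫ x in cell L H, (f x ^ (k + 1)) ^ 2 := by congr 1; ext x; rw [← pow_mul, mul_comm]
      _ ≤ _ := hw
      _ ≤ (H / L + 1) * ((k + 1) ^ 2 * ((C * X ^ k) * (2 * X))) := by
        rw [mul_pow]
        refine mul_le_mul_of_nonneg_left (mul_le_mul_of_nonneg_left (cs.trans ?_) (by positivity))
          (by positivity)
        have e4 : ∫ x in cell L H, |f x ^ k| ^ 2 ≤ C * X ^ k := e3.trans_le hk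
        exact mul_le_mul e4 e2 (integral_nonneg fun x => sq_nonneg _) (by positivity)
      _ = _ := by ring

/-- The wall value of a function of mean zero is controlled by its Dirichlet energy. -/
lemma C1On.sq_wall_le {c : ℝ} (hL : 0 < L) (hH : 0 < H) (hf : C1On L H f f1 f2)
    (h0 : ∀ s, f (s, 0) = c) (hm : ∫ x in cell L H, f x = 0) :
    c ^ 2 ≤ H / L * ∫ x in cell L H, (f1 x ^ 2 + f2 x ^ 2) := by
  have hg := hf.sub (C1On.const c)
  have hc := hf.cont; have hc1 := hf.cont1; have hc2 := hf.cont2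
  have e3 : ∫ x in cell L H, |f x - c| ≤ H * ∫ x in cell L H, |f2 x| := by
    rw [setIntegral_cell_eq (f := fun x => |f x - c|) hL.le hH.le hg.cont.abs,
      setIntegral_cell_eq (f := fun x => |f2 x|) hL.le hH.le hc2.abs,
      ← intervalIntegral.integral_const_mul]
    refine intervalIntegral.integral_mono_on hL.le ?_ ?_ fun x _ => ?_
    · exact (continuousOn_integral_column hH.le hg.cont.abs 0 L).intervalIntegrable_of_Icc hL.le
    · exact (continuousOn_const.mul (continuousOn_integral_column hH.le hc2.abs 0 L)
        ).intervalIntegrable_of_Icc hL.le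
    · have := intervalIntegral.integral_mono_on hH.le
        ((continuousOn_column hg.cont.abs x).intervalIntegrable_of_Icc hH.le)
        (continuous_const.intervalIntegrable (μ := volume) _ _) (fun y hy => hg.abs_le_column (by simp [h0]) x hy)
      simpa using this
  have e4 : L * H * |c| ≤ ∫ x in cell L H, |f x - c| := by
    have : |∫ x in cell L H, (f x - c)| ≤ ∫ x in cell L H, |f x - c| := abs_integral_le_integral_abs
    rw [integral_sub (integrableOn_cell hc) (integrable_const _), hm,
      setIntegral_cell_const hL.le hH.le, zero_sub, abs_neg, abs_mul,
      abs_of_pos (mul_pos hL hH)] at this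
    exact this
  have cs := sq_setIntegral_mul_le (L := L) (H := H) (a := fun _ => 1) continuousOn_const hc2.abs
  simp only [one_mul, one_pow, sq_abs] at cs
  rw [setIntegral_cell_const hL.le hH.le, mul_one] at cs
  have e5 : ∫ x in cell L H, f2 x ^ 2 ≤ ∫ x in cell L H, (f1 x ^ 2 + f2 x ^ 2) :=
    setIntegral_mono (integrableOn_cell (by fun_prop)) (integrableOn_cell (by fun_prop))
      fun x => by simpa using sq_nonneg (f1 x)
  -- As `f` has mean zero, `L H |c| = |∫(f - c)|`. Integration along columns bounds `∫|f - c|` by `H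
  -- ∫|f2|`.
  have e6 : L * |c| ≤ ∫ x in cell L H, |f2 x| := by
    refine le_of_mul_le_mul_left ?_ hH
    linarith
  have e7 : (L * |c|) ^ 2 ≤ (∫ x in cell L H, |f2 x|) ^ 2 := pow_le_pow_left₀ (by positivity) e6 2
  rw [mul_pow, sq_abs] at e7
  refine le_of_mul_le_mul_left ?_ (pow_pos hL 2)
  calc L ^ 2 * c ^ 2 ≤ L * H * ∫ x in cell L H, f2 x ^ 2 := e7.trans cs
    _ ≤ L * H * ∫ x in cell L H, (f1 x ^ 2 + f2 x ^ 2) := by gcongr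
    _ = _ := by field_simp

/-- The Sobolev inequality in the channel for functions of mean zero with constant value on the
lower wall. -/
lemma sobolev (hL : 0 < L) (hH : 0 < H) (k : ℕ) :
    ∃ C : ℝ, 0 ≤ C ∧ ∀ (f f1 f2 : ℝ × ℝ → ℝ) (c : ℝ), C1On L H f f1 f2 → (∀ s, f (s, 0) = c) →
      ∫ x in cell L H, f x = 0 →
      ∫ x in cell L H, f x ^ (2 * k) ≤ C * (∫ x in cell L H, (f1 x ^ 2 + f2 x ^ 2)) ^ k := by
  obtain ⟨C, hC, h⟩ := sobolev_zero hL hH k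
  refine ⟨2 ^ (2 * k - 1) * (C + L * H * (H / L) ^ k), by positivity, fun f f1 f2 c hf h0 hm => ?_⟩
  have hc := hf.cont
  have h1 := h _ _ _ (hf.sub (C1On.const c)) (by simp [h0])
  have h2 := hf.sq_wall_le hL hH h0 hm
  simp only [sub_zero] at h1
  set X := ∫ x in cell L H, (f1 x ^ 2 + f2 x ^ 2)
  have h3 : c ^ (2 * k) ≤ (H / L) ^ k * X ^ k := by
    rw [pow_mul, ← mul_pow]; exact pow_le_pow_left₀ (sq_nonneg _) h2 k
  have h4 : ∀ x, f x ^ (2 * k) ≤ 2 ^ (2 * k - 1) * ((f x - c) ^ (2 * k) + c ^ (2 * k)) := fun x => by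
    have := (even_two_mul k).add_pow_le (a := f x - c) (b := c)
    simpa using this
  have h5 : ∫ x in cell L H, f x ^ (2 * k)
      ≤ ∫ x in cell L H, 2 ^ (2 * k - 1) * ((f x - c) ^ (2 * k) + c ^ (2 * k)) :=
    setIntegral_mono (integrableOn_cell (by fun_prop)) (integrableOn_cell (by fun_prop)) h4
  rw [integral_const_mul, integral_add (integrableOn_cell (by fun_prop)) (integrable_const _),
    setIntegral_cell_const hL.le hH.le] at h5
  have h6 := mul_le_mul_of_nonneg_left h3 (mul_pos hL hH).le
  refine h5.trans ?_
  calc _ ≤ 2 ^ (2 * k - 1) * (C * X ^ k + L * H * ((H / L) ^ k * X ^ k)) := by gcongr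
    _ = _ := by ring

end PeriodicChannel
end

/-! ### Derivatives up to the boundary and the bound on the first eigenvalue -/

noncomputable section
namespace PeriodicChannel

open scoped Pointwise

section DirectionalDerivative

variable {E : Type*} [NormedAddCommGroup E] [NormedSpace ℝ E] {Ω : Set E} {f g : E → ℝ} {q e e' : E}

/-- The directional derivative relative to a set. -/
def dirDeriv (Ω : Set E) (e : E) (f : E → ℝ) (q : E) : ℝ := fderivWithin ℝ f Ω q e

lemma contDiffOn_dirDeriv (hΩ : UniqueDiffOn ℝ Ω) {m n : WithTop ℕ∞} (hf : ContDiffOn ℝ n f Ω)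
    (hmn : m + 1 ≤ n) (e : E) : ContDiffOn ℝ m (dirDeriv Ω e f) Ω :=
  (hf.fderivWithin hΩ hmn).clm_apply contDiffOn_const

lemma dirDeriv_of_mem_nhds (hq : Ω ∈ nhds q) : dirDeriv Ω e f q = fderiv ℝ f q e := by
  rw [dirDeriv, fderivWithin_of_mem_nhds hq]

lemma dirDeriv_eventuallyEq (hq : Ω ∈ nhds q) :
    dirDeriv Ω e f =ᶠ[nhds q] fun y => fderiv ℝ f y e := by
  filter_upwards [eventually_eventually_nhds.2 hq] with y hy using dirDeriv_of_mem_nhds hy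

lemma dirDeriv_dirDeriv (hq : Ω ∈ nhds q) :
    dirDeriv Ω e (dirDeriv Ω e' f) q = fderiv ℝ (fun y => fderiv ℝ f y e') q e := by
  rw [dirDeriv_of_mem_nhds hq, (dirDeriv_eventuallyEq hq).fderiv_eq]

lemma dirDeriv_comm (hf : ContDiffOn ℝ 2 f Ω) (hq : Ω ∈ nhds q) :
    dirDeriv Ω e (dirDeriv Ω e' f) q = dirDeriv Ω e' (dirDeriv Ω e f) q := by
  have hc : ContDiffAt ℝ 2 f q := hf.contDiffAt hq
  have hd : DifferentiableAt ℝ (fderiv ℝ f) q :=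
    (hc.fderiv_right (m := 1) (by norm_num)).differentiableAt (by norm_num)
  rw [dirDeriv_dirDeriv hq, dirDeriv_dirDeriv hq, fderiv_clm_apply hd (by fun_prop),
    fderiv_clm_apply hd (by fun_prop)]
  simpa using (hc.isSymmSndFDerivAt (by simp)) e e'

lemma hasDerivAt_dirDeriv (hf : ContDiffOn ℝ 1 f Ω) (hq : Ω ∈ nhds q) {γ : ℝ → E} {t : ℝ}
    (hγ : HasDerivAt γ e t) (ht : γ t = q) :
    HasDerivAt (fun s => f (γ s)) (dirDeriv Ω e f q) t := by
  subst ht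
  rw [dirDeriv_of_mem_nhds hq]
  exact ((hf.contDiffAt hq).differentiableAt (by norm_num)).hasFDerivAt.comp_hasDerivAt t hγ

lemma dirDeriv_add_of_periodic {a : E} (hΩ : ∀ x, x + a ∈ Ω ↔ x ∈ Ω) (h : ∀ x ∈ Ω, f (x + a) = f x)
    (hq : q ∈ Ω) : dirDeriv Ω e f (q + a) = dirDeriv Ω e f q := by
  have hs : a +ᵥ Ω = Ω := by
    ext x
    rw [mem_vadd_set_iff_neg_vadd_mem, ← hΩ, vadd_eq_add, add_comm, add_neg_cancel_left]
  have h1 := fderivWithin_comp_add_right (𝕜 := ℝ) (f := f) (s := Ω) (x := q) a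
  rw [hs] at h1
  rw [dirDeriv, dirDeriv, ← h1, fderivWithin_congr h (h q hq)]

end DirectionalDerivative

variable {L H : ℝ} {f f1 f2 : ℝ × ℝ → ℝ}

lemma uniqueDiffOn_closedChannel (hH : 0 < H) : UniqueDiffOn ℝ (closedChannel H) :=
  uniqueDiffOn_univ.prod (uniqueDiffOn_Icc hH)

lemma closedChannel_mem_nhds {x : ℝ × ℝ} (hx : x ∈ channel H) : closedChannel H ∈ nhds x :=
  Filter.mem_of_superset (isOpen_channel.mem_nhds hx) channel_subset_closedChannel

lemma periodicOn_dirDeriv (hf : PeriodicOn L f (closedChannel H)) (e : ℝ × ℝ) :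
    PeriodicOn L (dirDeriv (closedChannel H) e f) (closedChannel H) := by
  intro x hx
  have := dirDeriv_add_of_periodic (Ω := closedChannel H) (f := f) (e := e) (a := (L, 0))
    (fun x => by simp [closedChannel]) (fun x hx => by simpa [Prod.add_def] using hf x hx) hx
  simpa [Prod.add_def] using this

lemma C1On.of_contDiffOn (hH : 0 < H) (hp : PeriodicOn L f (closedChannel H))
    (hf : ContDiffOn ℝ 1 f (closedChannel H)) :
    C1On L H f (dirDeriv (closedChannel H) (1, 0) f) (dirDeriv (closedChannel H) (0, 1) f) where
  cont := hf.continuousOn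
  cont1 := (contDiffOn_dirDeriv (uniqueDiffOn_closedChannel hH) (m := 0) hf (by norm_num) _
    ).continuousOn
  cont2 := (contDiffOn_dirDeriv (uniqueDiffOn_closedChannel hH) (m := 0) hf (by norm_num) _
    ).continuousOn
  periodic := hp
  deriv1 x hx := hasDerivAt_dirDeriv (γ := fun s => (s, x.2)) hf (closedChannel_mem_nhds hx)
    ((hasDerivAt_id x.1).prodMk (hasDerivAt_const _ _)) rfl
  deriv2 x hx := hasDerivAt_dirDeriv (γ := fun s => (x.1, s)) hf (closedChannel_mem_nhds hx)
    ((hasDerivAt_const _ _).prodMk (hasDerivAt_id x.2)) rfl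

/-- The derivatives of a `C²` function on the closed channel. -/
lemma IsC2.exists_derivs (hH : 0 < H) (hf : IsC2 L H f) :
    ∃ f1 f2 f11 f12 f21 f22 : ℝ × ℝ → ℝ, C1On L H f f1 f2 ∧ C1On L H f1 f11 f12 ∧
      C1On L H f2 f21 f22 ∧ ∀ x ∈ channel H, laplacian f x = f11 x + f22 x := by
  have hU := uniqueDiffOn_closedChannel hH
  refine ⟨_, _, _, _, _, _, C1On.of_contDiffOn hH hf.1 (hf.2.of_le (by norm_num)),
    C1On.of_contDiffOn hH (periodicOn_dirDeriv hf.1 _) (contDiffOn_dirDeriv hU hf.2 (by norm_num) _),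
    C1On.of_contDiffOn hH (periodicOn_dirDeriv hf.1 _) (contDiffOn_dirDeriv hU hf.2 (by norm_num) _),
    fun x hx => ?_⟩
  rw [dirDeriv_dirDeriv (closedChannel_mem_nhds hx), dirDeriv_dirDeriv (closedChannel_mem_nhds hx)]
  rfl

/-- Green's identity with the eigenfunction itself: the wall term drops because `∫Δu = -Λ∫u = 0`,
leaving `∫|∇u|² = Λ∫u²`. This bounds the set of eigenvalues below, so that its infimum is a genuine
lower bound and not a default value. -/
lemma IsEigenvalue.nonneg (hL : 0 < L) (hH : 0 < H) {Lam : ℝ} (h : IsEigenvalue L H Lam) :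
    0 ≤ Lam := by
  obtain ⟨u, hu, ⟨x₀, hx₀, hne⟩, heq, ⟨c, hc⟩, hm⟩ := h
  obtain ⟨u1, u2, u11, u12, u21, u22, h0, h1, h2, hlap⟩ := hu.exists_derivs hH
  have hg := h0.green hL.le hH.le h1 h2 (fun s => (hc s).1) (fun s => (hc s).2)
  have hsum : ∀ x ∈ cell L H, u11 x + u22 x = -(Lam * u x) := fun x hx => by
    have hx' := cell_subset_channel hx
    rw [← hlap x hx', ← heq x hx', neg_neg]
  have e1 : ∫ x in cell L H, (u11 x + u22 x) = 0 := by
    rw [setIntegral_congr_fun measurableSet_cell hsum, integral_neg, integral_const_mul, hm]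
    simp
  have e2 : ∫ x in cell L H, u x * (u11 x + u22 x) = -(Lam * ∫ x in cell L H, u x ^ 2) := by
    rw [← integral_const_mul, ← integral_neg]
    refine setIntegral_congr_fun measurableSet_cell fun x hx => ?_
    simp only [hsum x hx]; ring
  rw [e1, e2] at hg
  have p1 : 0 ≤ ∫ x in cell L H, (u1 x ^ 2 + u2 x ^ 2) := integral_nonneg fun x => by positivity
  have p2 : 0 < ∫ x in cell L H, u x ^ 2 := by
    refine lt_of_le_of_ne (integral_nonneg fun x => sq_nonneg _) fun h => hne ?_
    exact eq_zero_of_setIntegral_sq_eq_zero hL hH h0.cont h0.periodic h.symm x₀ hx₀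
  by_contra! hneg
  nlinarith [mul_pos_of_neg_of_neg hneg (neg_neg_of_pos p2)]

lemma firstEigenvalue_le (hL : 0 < L) (hH : 0 < H) {Lam : ℝ} (h : IsEigenvalue L H Lam) :
    firstEigenvalue L H ≤ Lam :=
  csInf_le ⟨0, fun _ h => h.nonneg hL hH⟩ h

lemma partial1_eq {x : ℝ × ℝ} {d : ℝ} (hf : DifferentiableAt ℝ f x)
    (h : HasDerivAt (fun s => f (s, x.2)) d x.1) : partial1 f x = d :=
  (hf.hasFDerivAt.comp_hasDerivAt x.1 ((hasDerivAt_id x.1).prodMk (hasDerivAt_const x.1 x.2))).unique h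

lemma partial2_eq {x : ℝ × ℝ} {d : ℝ} (hf : DifferentiableAt ℝ f x)
    (h : HasDerivAt (fun s => f (x.1, s)) d x.2) : partial2 f x = d :=
  (hf.hasFDerivAt.comp_hasDerivAt x.2 ((hasDerivAt_const x.2 x.1).prodMk (hasDerivAt_id x.2))).unique h

lemma laplacian_trig (a b : ℝ) (x : ℝ × ℝ) :
    laplacian (fun x => Real.cos (a * x.1) * Real.sin (b * x.2)) x
      = -((a ^ 2 + b ^ 2) * (Real.cos (a * x.1) * Real.sin (b * x.2))) := by
  have hl : ∀ c s : ℝ, HasDerivAt (fun s => c * s) c s := fun c s => by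
    simpa using (hasDerivAt_id s).const_mul c
  have e1 : partial1 (fun x : ℝ × ℝ => Real.cos (a * x.1) * Real.sin (b * x.2))
      = fun x => -Real.sin (a * x.1) * a * Real.sin (b * x.2) := by
    ext x
    exact partial1_eq (by fun_prop) (((hl a x.1).cos).mul_const (Real.sin (b * x.2)))
  have e2 : partial2 (fun x : ℝ × ℝ => Real.cos (a * x.1) * Real.sin (b * x.2))
      = fun x => Real.cos (a * x.1) * (Real.cos (b * x.2) * b) := by
    ext x
    exact partial2_eq (by fun_prop) (((hl b x.2).sin).const_mul (Real.cos (a * x.1)))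
  rw [laplacian, e1, e2, partial1_eq (by fun_prop) ((((hl a x.1).sin.fun_neg).mul_const a).mul_const (Real.sin (b * x.2))),
    partial2_eq (by fun_prop) ((((hl b x.2).cos).mul_const b).const_mul (Real.cos (a * x.1)))]
  ring

/-- The modes `cos (a x₁) sin (b x₂)` are eigenfunctions. -/
lemma isEigenvalue_trig (hL : 0 < L) (hH : 0 < H) {a b : ℝ} (ha : ∃ n : ℕ, a * L = n * (2 * Real.pi))
    (hb : ∃ n : ℕ, b * H = n * Real.pi) (hb0 : b ≠ 0)
    (hm : (∫ x in (0 : ℝ)..L, Real.cos (a * x)) * (∫ y in (0 : ℝ)..H, Real.sin (b * y)) = 0) :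
    IsEigenvalue L H (a ^ 2 + b ^ 2) := by
  refine ⟨fun x => Real.cos (a * x.1) * Real.sin (b * x.2), ⟨?_, ?_⟩, ?_, ?_, ⟨0, fun s => ?_⟩, ?_⟩
  · intro x _
    obtain ⟨n, hn⟩ := ha
    simp only
    rw [mul_add, hn, Real.cos_add_nat_mul_two_pi]
  · exact ContDiff.contDiffOn (by fun_prop)
  · by_contra! h
    have h1 : ∀ y ∈ Icc 0 H, Real.sin (b * y) = 0 := fun y hy => by
      simpa using h (0, y) (mk_mem_closedChannel hy)
    -- Nontriviality of the mode: at `y = 0` the derivative of `sin (b y)` is `b ≠ 0`, which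
    -- contradicts vanishing on the whole interval.
    have h2 := (hasDerivAt_id (0 : ℝ)).const_mul b |>.sin
    have h3 : HasDerivWithinAt (fun y => Real.sin (b * y)) 0 (Icc 0 H) 0 :=
      (hasDerivWithinAt_const 0 _ (0 : ℝ)).congr h1 (h1 0 ⟨le_rfl, hH.le⟩)
    have := (uniqueDiffOn_Icc hH 0 ⟨le_rfl, hH.le⟩).eq_deriv _ h2.hasDerivWithinAt h3
    simp at this
    exact hb0 this
  · intro x _
    rw [laplacian_trig, neg_neg]
  · obtain ⟨n, hn⟩ := hb
    simp [hn, Real.sin_nat_mul_pi]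
  · rw [setIntegral_cell_eq hL.le hH.le (by fun_prop)]
    simp only [intervalIntegral.integral_const_mul, intervalIntegral.integral_mul_const]
    exact hm

/-- The two entries of the minimum are the eigenvalues of `sin(2πx₂/H)` and of `cos(2πx₁/L)
sin(πx₂/H)`. Each mode has mean zero because a full period is integrated. -/
lemma firstEigenvalue_le_poincareConst (hL : 0 < L) (hH : 0 < H) :
    firstEigenvalue L H ≤ poincareConst L H := by
  have hpi := Real.pi_pos
  refine le_min ?_ ?_
  · have := isEigenvalue_trig hL hH (a := 0) (b := 2 * Real.pi / H) ⟨0, by simp⟩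
      ⟨2, by field_simp; norm_num⟩ (by positivity) (by
        rw [intervalIntegral.integral_comp_mul_left Real.sin (by positivity), integral_sin]
        simp [hH.ne'])
    simpa using firstEigenvalue_le hL hH this
  · have := isEigenvalue_trig hL hH (a := 2 * Real.pi / L) (b := Real.pi / H)
      ⟨1, by field_simp; norm_num⟩ ⟨1, by field_simp; norm_num⟩ (by positivity) (by
        rw [intervalIntegral.integral_comp_mul_left Real.cos (by positivity), integral_cos]
        simp [hL.ne'])
    rw [add_comm]
    exact firstEigenvalue_le hL hH this

end PeriodicChannel
end

/-! ### Rigidity: solutions are shear flows -/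

noncomputable section
namespace PeriodicChannel

variable {L H : ℝ} {f f1 f2 : ℝ × ℝ → ℝ}

lemma C1On.shift (hf : C1On L H f f1 f2) (h : ℝ) :
    C1On L H (fun x => f (x.1 + h, x.2)) (fun x => f1 (x.1 + h, x.2))
      (fun x => f2 (x.1 + h, x.2)) where
  cont := hf.cont.comp (by fun_prop) fun _ hx => ⟨mem_univ _, hx.2⟩
  cont1 := hf.cont1.comp (by fun_prop) fun _ hx => ⟨mem_univ _, hx.2⟩
  cont2 := hf.cont2.comp (by fun_prop) fun _ hx => ⟨mem_univ _, hx.2⟩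
  periodic x hx := by
    have := hf.periodic (x.1 + h, x.2) ⟨mem_univ _, hx.2⟩
    simpa [add_right_comm] using this
  deriv1 x hx := (hf.deriv1 (x.1 + h, x.2) ⟨mem_univ _, hx.2⟩).comp_add_const x.1 h
  deriv2 x hx := hf.deriv2 (x.1 + h, x.2) ⟨mem_univ _, hx.2⟩

lemma C1On.setIntegral_shift (hL : 0 < L) (hH : 0 ≤ H) (hf : C1On L H f f1 f2) (h : ℝ) :
    ∫ x in cell L H, f (x.1 + h, x.2) = ∫ x in cell L H, f x := by
  rw [setIntegral_cell_eq' hL.le hH hf.cont,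
    setIntegral_cell_eq' hL.le hH (hf.shift h).cont]
  refine intervalIntegral_congr_Ioo hH fun y hy => ?_
  have hper : Function.Periodic (fun s => f (s, y)) L := fun s =>
    hf.periodic (s, y) (mk_mem_closedChannel (Ioo_subset_Icc_self hy))
  rw [intervalIntegral.integral_comp_add_right (fun s => f (s, y))]
  simpa [add_comm] using hper.intervalIntegral_add_eq h 0

lemma mul_sub_le_of_deriv_le {g : ℝ → ℝ} (hg : ContDiff ℝ 1 g) {M a b : ℝ}
    (h : ∀ r ∈ uIcc a b, deriv g r ≤ M) : (a - b) * (g a - g b) ≤ M * (a - b) ^ 2 := by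
  wlog hab : b ≤ a generalizing a b
  · have := this (by rwa [uIcc_comm]) (not_le.1 hab).le
    nlinarith
  have hd : Differentiable ℝ g := hg.differentiable (by norm_num)
  have := (convex_Icc b a).image_sub_le_mul_sub_of_deriv_le hd.continuous.continuousOn
    hd.differentiableOn (fun r hr => h r (by
      rw [uIcc_of_ge hab]; exact interior_subset hr)) b ⟨le_rfl, hab⟩ a ⟨hab, le_rfl⟩ hab
  nlinarith [mul_le_mul_of_nonneg_left this (sub_nonneg.2 hab)]

/-- Compactness of the period rectangle turns the pointwise strict inequality into a uniform gap,
which periodicity extends to the whole strip. -/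
lemma exists_max_deriv {g : ℝ → ℝ} (hg : ContDiff ℝ 1 g) {ψ : ℝ × ℝ → ℝ} {lam Λ : ℝ}
    (hL : 0 < L) (hH : 0 < H) (hp : PeriodicOn L ψ (closedChannel H))
    (hc : ContinuousOn ψ (closedChannel H))
    (hmax : ∀ x ∈ closedChannel H, deriv g (ψ x - lam * x.2) < Λ) :
    ∃ M < Λ, ∀ x ∈ closedChannel H, deriv g (ψ x - lam * x.2) ≤ M := by
  have hg' : Continuous (deriv g) := hg.continuous_deriv (by norm_num)
  have hcont : ContinuousOn (fun x => deriv g (ψ x - lam * x.2)) (closedChannel H) := by fun_prop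
  obtain ⟨x₀, hx₀, hM⟩ := (isCompact_Icc.prod isCompact_Icc).exists_isMaxOn
    ⟨((0 : ℝ), (0 : ℝ)), ⟨le_rfl, hL.le⟩, ⟨le_rfl, hH.le⟩⟩
    (hcont.mono (Icc_subset_closedChannel 0 L))
  refine ⟨_, hmax x₀ (Icc_subset_closedChannel 0 L hx₀), ?_⟩
  rintro ⟨x, y⟩ ⟨-, hy⟩
  have hper : Function.Periodic (fun s => ψ (s, y)) L := fun s => hp (s, y) ⟨mem_univ _, hy⟩
  obtain ⟨x', hx', he⟩ := hper.exists_mem_Ico₀ hL x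
  have := hM (show (x', y) ∈ Icc 0 L ×ˢ Icc 0 H from ⟨Ico_subset_Icc_self hx', hy⟩)
  simp only at he this ⊢
  rw [he]
  exact this

/-- Solutions whose linearised operator is below the Poincaré constant are shear flows. -/
lemma IsSemilinearSolution.translation_invariant {g : ℝ → ℝ} (hg : ContDiff ℝ 1 g) {ψ : ℝ × ℝ → ℝ}
    {lam M : ℝ} (hL : 0 < L) (hH : 0 < H) (hψ : IsSemilinearSolution L H g lam ψ)
    (hM : M < poincareConst L H)
    (hd : ∀ x ∈ closedChannel H, deriv g (ψ x - lam * x.2) ≤ M) (h : ℝ) :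
    ∀ x ∈ closedChannel H, ψ (x.1 + h, x.2) = ψ x := by
  obtain ⟨ψ1, ψ2, ψ11, ψ12, ψ21, ψ22, h0, h1, h2, hlap⟩ := hψ.c2.exists_derivs hH
  have k0 := (h0.shift h).sub h0
  have k1 := (h1.shift h).sub h1
  have k2 := (h2.shift h).sub h2
  obtain ⟨cb, hb⟩ := hψ.bottom
  obtain ⟨ct, ht⟩ := hψ.top
  have wb : ∀ s, ψ (s + h, 0) - ψ (s, 0) = 0 := fun s => by rw [hb, hb, sub_self]
  have wt : ∀ s, ψ (s + h, H) - ψ (s, H) = 0 := fun s => by rw [ht, ht, sub_self]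
  have hm : ∫ x in cell L H, (ψ (x.1 + h, x.2) - ψ x) = 0 := by
    rw [integral_sub (integrableOn_cell (h0.shift h).cont) (integrableOn_cell h0.cont),
      h0.setIntegral_shift hL hH.le, sub_self]
  have hP := k0.poincare hL hH wb wt hm
  have hG := k0.green hL.le hH.le k1 k2 wb wt
  rw [zero_mul, add_zero, ← integral_neg] at hG
  have hle : ∫ x in cell L H, -((ψ (x.1 + h, x.2) - ψ x) *
        (ψ11 (x.1 + h, x.2) - ψ11 x + (ψ22 (x.1 + h, x.2) - ψ22 x)))
      ≤ ∫ x in cell L H, M * (ψ (x.1 + h, x.2) - ψ x) ^ 2 := by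
    refine setIntegral_mono_on (integrableOn_cell (k0.cont.mul (k1.cont1.add k2.cont2)).neg)
      (integrableOn_cell (continuousOn_const.mul (k0.cont.pow 2))) measurableSet_cell fun x hx => ?_
    have hx' := cell_subset_channel hx
    have hx'' : (x.1 + h, x.2) ∈ channel H := ⟨mem_univ _, hx'.2⟩
    have e1 := hψ.eqn x hx'
    have e2 := hψ.eqn _ hx''
    rw [hlap _ hx'] at e1
    rw [hlap _ hx''] at e2
    have := mul_sub_le_of_deriv_le hg (M := M) (a := ψ (x.1 + h, x.2) - lam * x.2)
      (b := ψ x - lam * x.2) ?_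
    · rw [← e1] at this
      simp only at e2
      rw [← e2] at this
      nlinarith
    -- The bound on `g'` is known only at values taken by `ψ - lam x₂`. Along the horizontal segment
    -- joining the two points `lam x₂` is constant, and the intermediate value theorem shows that
    -- every value between the endpoint values is taken.
    · intro r hr
      have hrow := (continuousOn_row h0.cont (Ioo_subset_Icc_self hx'.2)).sub
        (continuous_const (y := lam * x.2))
      obtain ⟨s, -, rfl⟩ := intermediate_value_uIcc (a := x.1 + h) (b := x.1) hrow.continuousOn hr
      exact hd (s, x.2) ⟨mem_univ _, Ioo_subset_Icc_self hx'.2⟩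
  rw [integral_const_mul] at hle
  -- Poincaré from below and Green with the slope bound from above give `poincareConst * ∫ξ² ≤ M
  -- ∫ξ²` with `M < poincareConst`.
  have hz : ∫ x in cell L H, (ψ (x.1 + h, x.2) - ψ x) ^ 2 = 0 := by
    have hn : 0 ≤ ∫ x in cell L H, (ψ (x.1 + h, x.2) - ψ x) ^ 2 :=
      integral_nonneg fun x => sq_nonneg _
    have := hP.trans (hG.trans_le hle)
    nlinarith
  exact fun x hx => sub_eq_zero.1 (eq_zero_of_setIntegral_sq_eq_zero hL hH k0.cont k0.periodic hz x hx)

end PeriodicChannel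
end

/-! ### Casimir density and Bregman distance of powers -/

noncomputable section
namespace PeriodicChannel

section Casimir

lemma le_of_hasDerivAt_sign {q q' : ℝ → ℝ} (hq : ∀ s, HasDerivAt q (q' s) s) {r : ℝ}
    (h : ∀ s, (s - r) * q' s ≤ 0) (s : ℝ) : q s ≤ q r := by
  have hc : Continuous q := continuous_iff_continuousAt.2 fun s => (hq s).continuousAt
  rcases lt_trichotomy s r with hs | rfl | hs
  · obtain ⟨c, hc, he⟩ := exists_hasDerivAt_eq_slope q q' hs hc.continuousOn fun x _ => hq x
    have h1 := h c
    rw [eq_div_iff (by linarith)] at he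
    have h2 : 0 ≤ q' c := by
      by_contra! hn
      nlinarith [mul_pos_of_neg_of_neg (sub_neg.2 hc.2) hn]
    nlinarith [mul_nonneg h2 (sub_nonneg.2 hs.le)]
  · exact le_rfl
  · obtain ⟨c, hc, he⟩ := exists_hasDerivAt_eq_slope q q' hs hc.continuousOn fun x _ => hq x
    have h1 := h c
    rw [eq_div_iff (by linarith)] at he
    have h2 : q' c ≤ 0 := by
      by_contra! hn
      nlinarith [mul_pos (sub_pos.2 hc.1) hn]
    nlinarith [mul_nonneg (neg_nonneg.2 h2) (sub_nonneg.2 hs.le)]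

/-- A convex potential of `g` on `[a, b]`, with quadratically bounded Bregman distance. -/
lemma exists_potential {g : ℝ → ℝ} (hg : ContDiff ℝ 1 g) {a b M : ℝ} (hab : a ≤ b)
    (h0 : ∀ r ∈ Icc a b, 0 ≤ deriv g r) (h1 : ∀ r ∈ Icc a b, deriv g r ≤ M) :
    ∃ G : ℝ → ℝ, Continuous G ∧ ∀ r ∈ Icc a b, ∀ s, G r + g r * (s - r) ≤ G s ∧
      G s ≤ G r + g r * (s - r) + M / 2 * (s - r) ^ 2 := by
  -- Freezing `g` outside `[a, b]` gives a monotone, `M`-Lipschitz function on the whole line, so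
  -- its primitive satisfies both quadratic bounds for every `s`, although `g'` is controlled only
  -- on `[a, b]`.
  set k : ℝ → ℝ := fun r => g (projIcc a b hab r) with hk
  have hkc : Continuous k := hg.continuous.comp (continuous_subtype_val.comp continuous_projIcc)
  have hd : Differentiable ℝ g := hg.differentiable (by norm_num)
  have hM : 0 ≤ M := (h0 a ⟨le_rfl, hab⟩).trans (h1 a ⟨le_rfl, hab⟩)
  have hG : ∀ s, HasDerivAt (fun s => ∫ r in (0 : ℝ)..s, k r) (k s) s := fun s =>
    intervalIntegral.integral_hasDerivAt_right (hkc.intervalIntegrable _ _)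
      (hkc.stronglyMeasurableAtFilter _ _) hkc.continuousAt
  have hmono : ∀ r s, r ≤ s → 0 ≤ k s - k r ∧ k s - k r ≤ M * (s - r) := by
    intro r s hrs
    have hle : (projIcc a b hab r : ℝ) ≤ projIcc a b hab s := monotone_projIcc hab hrs
    have hlip : (projIcc a b hab s : ℝ) - projIcc a b hab r ≤ s - r := by
      have h := (LipschitzWith.projIcc hab).dist_le_mul s r
      rw [Subtype.dist_eq, Real.dist_eq, Real.dist_eq] at h
      simp only [NNReal.coe_one, one_mul] at h
      rw [abs_of_nonneg (sub_nonneg.2 hrs)] at h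
      exact (le_abs_self _).trans h
    constructor
    · have := (convex_Icc a b).mul_sub_le_image_sub_of_le_deriv hd.continuous.continuousOn
        hd.differentiableOn (fun r hr => h0 r (interior_subset hr)) _ (projIcc a b hab r).2 _
        (projIcc a b hab s).2 hle
      simpa [hk] using this
    · have := (convex_Icc a b).image_sub_le_mul_sub_of_deriv_le hd.continuous.continuousOn
        hd.differentiableOn (fun r hr => h1 r (interior_subset hr)) _ (projIcc a b hab r).2 _
        (projIcc a b hab s).2 hle
      exact this.trans (mul_le_mul_of_nonneg_left hlip hM)
  have hmono' : ∀ r s, 0 ≤ (s - r) * (k s - k r) ∧ (s - r) * (k s - k r) ≤ M * (s - r) ^ 2 := by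
    intro r s
    rcases le_total r s with h | h
    · obtain ⟨h2, h3⟩ := hmono r s h
      have := sub_nonneg.2 h
      exact ⟨mul_nonneg this h2, by nlinarith [mul_le_mul_of_nonneg_left h3 this]⟩
    · obtain ⟨h2, h3⟩ := hmono s r h
      have := sub_nonneg.2 h
      constructor
      · nlinarith [mul_nonneg this h2]
      · nlinarith [mul_le_mul_of_nonneg_left h3 this]
  refine ⟨_, continuous_iff_continuousAt.2 fun s => (hG s).continuousAt, fun r hr s => ?_⟩
  have hkr : k r = g r := by simp [hk, projIcc_of_mem hab hr]
  have hsub : ∀ s, HasDerivAt (fun s => s - r) 1 s := fun s => (hasDerivAt_id s).sub_const r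
  constructor
  -- Both bounds compare `G` with a parabola or a line touching it at `r`. Monotonicity of `k` for
  -- the lower one, and its Lipschitz bound for the upper one, give the difference a maximum at `r`.
  · have := le_of_hasDerivAt_sign (r := r)
      (fun s => ((hsub s).const_mul (k r)).sub (hG s)) (fun s => by
        have := (hmono' r s).1
        nlinarith) s
    simp only [Pi.sub_apply, sub_self, mul_zero, zero_sub] at this
    rw [← hkr]; linarith
  · have := le_of_hasDerivAt_sign (r := r)
      (fun s => ((hG s).sub ((hsub s).const_mul (k r))).sub (((hsub s).pow 2).const_mul (M / 2)))
      (fun s => by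
        have := (hmono' r s).2
        simp only [Nat.cast_ofNat, Nat.add_one_sub_one, pow_one, mul_one]
        nlinarith) s
    simp only [Pi.sub_apply, Pi.pow_apply, sub_self, mul_zero, sub_zero, ne_eq, OfNat.ofNat_ne_zero,
      not_false_eq_true, zero_pow] at this
    rw [← hkr]; linarith

/-- The Casimir density, a truncated Legendre transform of the potential of `g`. -/
lemma exists_casimir {g : ℝ → ℝ} (hg : ContDiff ℝ 1 g) {a b M R : ℝ} (hab : a ≤ b)
    (h0 : ∀ r ∈ Icc a b, 0 ≤ deriv g r) (h1 : ∀ r ∈ Icc a b, deriv g r ≤ M) (hR : 0 ≤ R) :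
    ∃ F : ℝ → ℝ, (∀ s s', F s - F s' ≤ R * |s - s'|) ∧
      ∀ r ∈ Icc a b, ∀ ρ ∈ Icc (-R) R, ∀ s,
        (s - g r) * ρ - M / 2 * (ρ - r) ^ 2 ≤ F s - F (g r) := by
  obtain ⟨G, hGc, hG⟩ := exists_potential hg hab h0 h1
  have hne : Nonempty (Icc (-R) R) := ⟨⟨0, by simp [hR], hR⟩⟩
  have hbdd : ∀ s, BddAbove (range fun ρ : Icc (-R) R => s * ρ - G ρ) := fun s => by
    have := (isCompact_Icc (a := -R) (b := R)).bddAbove_image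
      (f := fun ρ => s * ρ - G ρ) (Continuous.continuousOn (by fun_prop))
    rwa [image_eq_range] at this
  -- Restricting the supremum to `|ρ| ≤ R` makes `F` Lipschitz with constant `R`. At `s = g r`
  -- convexity of `G` bounds it by `g r * r - G r`. At general `s` the competitor `ρ` and the upper
  -- quadratic bound on `G` give the supporting inequality.
  refine ⟨fun s => ⨆ ρ : Icc (-R) R, (s * ρ - G ρ), fun s s' => ?_, fun r hr ρ hρ s => ?_⟩
  · rw [sub_le_iff_le_add]
    refine ciSup_le fun ρ => ?_
    have h2 := le_ciSup (hbdd s') ρ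
    have h3 : (s - s') * ρ ≤ |s - s'| * R := (le_abs_self _).trans (by
      rw [abs_mul]; exact mul_le_mul_of_nonneg_left (abs_le.2 ρ.2) (abs_nonneg _))
    nlinarith
  · have h2 := le_ciSup (hbdd s) ⟨ρ, hρ⟩
    have h3 : ⨆ ρ : Icc (-R) R, (g r * ρ - G ρ) ≤ g r * r - G r :=
      ciSup_le fun ρ => by have := (hG r hr ρ).1; nlinarith
    have h4 := (hG r hr ρ).2
    simp only at h2 ⊢
    nlinarith

end Casimir

section Powers

/-- The Bregman distance of `|s|ᵖ`. -/
def bregman (p a b : ℝ) : ℝ := |a| ^ p - |b| ^ p - p * |b| ^ (p - 2) * b * (a - b)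

variable {p : ℝ}

/-- This is the derivative of the `C¹` function `|b|ᵖ`. That view covers `1 < p < 2`, where the
factor `|b| ^ (p - 2)` alone is unbounded near `0`. -/
lemma continuous_abs_rpow_mul (hp : 1 < p) : Continuous fun b : ℝ => p * |b| ^ (p - 2) * b := by
  have h := (contDiff_norm_rpow (E := ℝ) hp).continuous_deriv (by norm_num)
  have : deriv (fun x : ℝ => ‖x‖ ^ p) = fun b : ℝ => p * |b| ^ (p - 2) * b := by
    ext b; exact (hasDerivAt_norm_rpow b hp).deriv
  rwa [this] at h

lemma abs_rpow_sub_two_mul_sq {b : ℝ} (hb : b ≠ 0) : |b| ^ (p - 2) * b ^ 2 = |b| ^ p := by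
  rw [← sq_abs, ← Real.rpow_natCast |b| 2, ← Real.rpow_add (abs_pos.2 hb)]
  simp

/-- Strict convexity. With `a = t b` the distance is `|b|ᵖ (|t|ᵖ - 1 - p (t - 1))`: strict Bernoulli
handles `t ≥ 0`, and for `t < 0` the linear part alone is positive. -/
lemma bregman_pos (hp : 1 < p) {a b : ℝ} (hab : a ≠ b) : 0 < bregman p a b := by
  rcases eq_or_ne b 0 with rfl | hb
  · simp only [bregman, abs_zero, Real.zero_rpow (by linarith : p ≠ 0), mul_zero, zero_mul, sub_zero]
    exact Real.rpow_pos_of_pos (abs_pos.2 hab) p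
  · obtain ⟨t, rfl⟩ : ∃ t, a = t * b := ⟨a / b, by field_simp⟩
    have ht : t ≠ 1 := by rintro rfl; simp at hab
    have e : bregman p (t * b) b = |b| ^ p * (|t| ^ p - 1 - p * (t - 1)) := by
      rw [bregman, abs_mul, Real.mul_rpow (abs_nonneg _) (abs_nonneg _)]
      linear_combination (-p * (t - 1)) * abs_rpow_sub_two_mul_sq (p := p) hb
    rw [e]
    refine mul_pos (Real.rpow_pos_of_pos (abs_pos.2 hb) p) ?_
    rcases le_or_gt 0 t with h | h
    · have := one_add_mul_self_lt_rpow_one_add (s := t - 1) (by linarith) (sub_ne_zero.2 ht) hp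
      rw [abs_of_nonneg h]
      rw [add_sub_cancel] at this
      linarith
    · have := Real.rpow_nonneg (abs_nonneg t) p
      nlinarith

lemma bregman_nonneg (hp : 1 < p) (a b : ℝ) : 0 ≤ bregman p a b := by
  rcases eq_or_ne a b with rfl | h
  · simp [bregman]
  · exact (bregman_pos hp h).le

lemma bregman_mul (hp : 1 < p) {r : ℝ} (hr : 0 < r) (a b : ℝ) :
    bregman p (r * a) (r * b) = r ^ p * bregman p a b := by
  rcases eq_or_ne b 0 with rfl | hb
  · simp [bregman, abs_mul, Real.mul_rpow, Real.zero_rpow (by linarith : p ≠ 0), abs_of_pos hr, hr.le]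
  · simp only [bregman, abs_mul, abs_of_pos hr, Real.mul_rpow hr.le (abs_nonneg _)]
    have := abs_rpow_sub_two_mul_sq (p := p) hr.ne'
    rw [abs_of_pos hr] at this
    linear_combination (-p * |b| ^ (p - 2) * b * (a - b)) * this

lemma continuous_bregman (hp : 1 < p) : Continuous fun q : ℝ × ℝ => bregman p q.1 q.2 := by
  have h : Continuous fun s : ℝ => |s| ^ p := continuous_abs.rpow_const fun _ => Or.inr (by linarith)
  have h2 := continuous_abs_rpow_mul hp
  exact ((h.comp continuous_fst).sub (h.comp continuous_snd)).sub
    ((h2.comp continuous_snd).mul (continuous_fst.sub continuous_snd))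

/-- The Bregman distance of `|s|ᵖ` controls `|a - b|ᵖ` up to a small error. -/
lemma exists_abs_sub_rpow_le_bregman (hp : 1 < p) {ε : ℝ} (hε : 0 < ε) :
    ∃ C : ℝ, 0 ≤ C ∧ ∀ a b : ℝ, |a - b| ^ p ≤ ε * (|a| ^ p + |b| ^ p) + C * bregman p a b := by
  have hp0 : p ≠ 0 := by linarith
  have habs : Continuous fun s : ℝ => |s| ^ p :=
    continuous_abs.rpow_const fun _ => Or.inr (by linarith)
  have hsub : Continuous fun q : ℝ × ℝ => |q.1 - q.2| ^ p :=
    habs.comp (continuous_fst.sub continuous_snd)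
  -- All terms are homogeneous of degree `p`, so the unit sphere of the sup norm suffices. On the
  -- compact part away from the diagonal the Bregman distance has a positive minimum `β`, while `|a
  -- - b| ≤ 2`. Elsewhere the `ε` term suffices, since one coordinate has modulus `1`.
  set D : Set (ℝ × ℝ) := Metric.sphere 0 1 ∩ {q | ε ≤ |q.1 - q.2| ^ p} with hD
  have hDc : IsCompact D :=
    (isCompact_sphere _ _).inter_right (isClosed_le continuous_const hsub)
  obtain ⟨β, hβ, hβD⟩ : ∃ β > 0, ∀ q ∈ D, β ≤ bregman p q.1 q.2 := by
    rcases D.eq_empty_or_nonempty with h | h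
    · exact ⟨1, one_pos, by simp [h]⟩
    · obtain ⟨q, hq, hmin⟩ := hDc.exists_isMinOn h (continuous_bregman hp).continuousOn
      refine ⟨_, bregman_pos hp fun he => ?_, fun q' hq' => hmin hq'⟩
      have : ε ≤ |q.1 - q.2| ^ p := hq.2
      rw [he, sub_self, abs_zero, Real.zero_rpow hp0] at this
      linarith
  refine ⟨2 ^ p / β, by positivity, ?_⟩
  have sphere : ∀ q : ℝ × ℝ, ‖q‖ = 1 →
      |q.1 - q.2| ^ p ≤ ε * (|q.1| ^ p + |q.2| ^ p) + 2 ^ p / β * bregman p q.1 q.2 := by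
    intro q hq
    have hq1 : |q.1| ≤ 1 := (norm_fst_le q).trans_eq hq
    have hq2 : |q.2| ≤ 1 := (norm_snd_le q).trans_eq hq
    have hnn1 := Real.rpow_nonneg (abs_nonneg q.1) p
    have hnn2 := Real.rpow_nonneg (abs_nonneg q.2) p
    have hB := bregman_nonneg hp q.1 q.2
    by_cases h : ε ≤ |q.1 - q.2| ^ p
    · have h1 := hβD q ⟨by simpa using hq, h⟩
      have h2 : |q.1 - q.2| ^ p ≤ 2 ^ p :=
        Real.rpow_le_rpow (abs_nonneg _) ((abs_sub _ _).trans (by linarith)) (by linarith)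
      have h3 : (2 : ℝ) ^ p ≤ 2 ^ p / β * bregman p q.1 q.2 := by
        rw [div_mul_eq_mul_div, le_div_iff₀ hβ]
        exact mul_le_mul_of_nonneg_left h1 (by positivity)
      nlinarith [mul_nonneg hε.le (add_nonneg hnn1 hnn2)]
    · have h1 : 1 ≤ |q.1| ^ p + |q.2| ^ p := by
        rw [Prod.norm_def, Real.norm_eq_abs, Real.norm_eq_abs] at hq
        rcases max_choice |q.1| |q.2| with h' | h' <;> rw [h'] at hq <;> rw [hq, Real.one_rpow] <;>
          linarith
      have h2 : 0 ≤ 2 ^ p / β * bregman p q.1 q.2 := mul_nonneg (by positivity) hB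
      nlinarith
  intro a b
  rcases eq_or_ne ((a, b) : ℝ × ℝ) 0 with h | h
  · obtain ⟨rfl, rfl⟩ := Prod.mk_eq_zero.1 h
    simp [bregman, Real.zero_rpow hp0]
  · set r := ‖((a, b) : ℝ × ℝ)‖
    have hr : 0 < r := norm_pos_iff.2 h
    have hs := sphere (r⁻¹ • (a, b)) (by rw [norm_smul, norm_inv, norm_norm, inv_mul_cancel₀ hr.ne'])
    simp only [Prod.smul_mk, smul_eq_mul] at hs
    have hr' : 0 < r⁻¹ := inv_pos.2 hr
    rw [bregman_mul hp hr', ← mul_sub, abs_mul, abs_mul, abs_mul, abs_of_pos hr',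
      Real.mul_rpow hr'.le (abs_nonneg _), Real.mul_rpow hr'.le (abs_nonneg _),
      Real.mul_rpow hr'.le (abs_nonneg _)] at hs
    refine le_of_mul_le_mul_left ?_ (Real.rpow_pos_of_pos hr' p)
    linarith

lemma abs_le_add_rpow (hp : 1 < p) {τ : ℝ} (hτ : 0 < τ) (s : ℝ) : |s| ≤ τ + τ ^ (1 - p) * |s| ^ p := by
  have h0 : 0 ≤ τ ^ (1 - p) * |s| ^ p := by positivity
  rcases le_or_gt |s| τ with h | h
  · linarith
  · have hs : 0 < |s| := hτ.trans h
    have h1 : |s| ^ (1 - p) ≤ τ ^ (1 - p) :=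
      Real.rpow_le_rpow_of_nonpos hτ h.le (by linarith)
    have h2 : |s| = |s| ^ (1 - p) * |s| ^ p := by rw [← Real.rpow_add hs]; simp
    nlinarith [mul_le_mul_of_nonneg_right h1 (Real.rpow_nonneg hs.le p)]

/-- A crude Young inequality: the cases are `b ≤ a^(p-1)` and its opposite, where `a b` is at most
`b` to the conjugate exponent `1 + 1/(p-1)`. Rounding that exponent up to an integer costs the `1`
and matches the Sobolev inequality for even powers. -/
lemma exists_young (hp : 1 < p) : ∃ k : ℕ, ∀ a b : ℝ, 0 ≤ a → 0 ≤ b → a * b ≤ a ^ p + 1 + b ^ k := by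
  obtain ⟨k, hk⟩ := exists_nat_ge (1 + 1 / (p - 1))
  refine ⟨k, fun a b ha hb => ?_⟩
  have hp1 : 0 < p - 1 := by linarith
  have hap : 0 ≤ a ^ p := Real.rpow_nonneg ha p
  have hbk : 0 ≤ b ^ k := by positivity
  rcases ha.eq_or_lt with rfl | ha
  · rw [zero_mul]; positivity
  rcases le_or_gt b (a ^ (p - 1)) with h | h
  · have : a * a ^ (p - 1) = a ^ p := by
      rw [← Real.rpow_one_add' ha.le (by linarith)]; simp
    nlinarith [mul_le_mul_of_nonneg_left h ha.le]
  · have hb0 : 0 < b := (Real.rpow_pos_of_pos ha _).trans h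
    have h1 : a ≤ b ^ (1 / (p - 1)) := by
      have := Real.rpow_le_rpow (Real.rpow_nonneg ha.le _) h.le (one_div_pos.2 hp1).le
      rwa [← Real.rpow_mul ha.le, mul_one_div_cancel hp1.ne', Real.rpow_one] at this
    have h2 : a * b ≤ b ^ (1 + 1 / (p - 1)) := by
      rw [Real.rpow_add hb0, Real.rpow_one, mul_comm]
      exact mul_le_mul_of_nonneg_left h1 hb
    have h3 : b ^ (1 + 1 / (p - 1)) ≤ 1 + b ^ k := by
      rcases le_total b 1 with hb1 | hb1
      · have := Real.rpow_le_one hb hb1 (show 0 ≤ 1 + 1 / (p - 1) by positivity)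
        linarith
      · have := Real.rpow_le_rpow_of_exponent_le hb1 hk
        rw [Real.rpow_natCast] at this
        linarith
    linarith

lemma abs_add_rpow_le (hp : 1 < p) (a b : ℝ) : |a + b| ^ p ≤ 2 ^ p * (|a| ^ p + |b| ^ p) := by
  have h1 : |a + b| ≤ 2 * max |a| |b| := (abs_add_le a b).trans (by
    rw [two_mul]; exact add_le_add (le_max_left _ _) (le_max_right _ _))
  have h2 := Real.rpow_le_rpow (abs_nonneg _) h1 (by linarith : 0 ≤ p)
  rw [Real.mul_rpow two_pos.le (by positivity)] at h2
  refine h2.trans (mul_le_mul_of_nonneg_left ?_ (by positivity))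
  have ha := Real.rpow_nonneg (abs_nonneg a) p
  have hb := Real.rpow_nonneg (abs_nonneg b) p
  rcases max_choice |a| |b| with h | h <;> rw [h] <;> linarith

/-- For small `d` this is uniform continuity of `|s|ᵖ` on a compact interval. For `|d|` bounded
below, `|b| ≤ B` is absorbed into a multiple of `|d|`. -/
lemma exists_abs_add_rpow_le (hp : 1 < p) {B τ : ℝ} (hB : 0 ≤ B) (hτ : 0 < τ) :
    ∃ C : ℝ, 0 ≤ C ∧ ∀ b d : ℝ, |b| ≤ B → |b + d| ^ p ≤ |b| ^ p + τ + C * |d| ^ p := by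
  have habs : Continuous fun s : ℝ => |s| ^ p :=
    continuous_abs.rpow_const fun _ => Or.inr (by linarith)
  have huc := (isCompact_Icc (a := -(B + 1)) (b := B + 1)).uniformContinuousOn_of_continuous
    habs.continuousOn
  obtain ⟨η, hη, h⟩ := Metric.uniformContinuousOn_iff.1 huc τ hτ
  set η' := min η 1 with hη'
  have hη0 : 0 < η' := lt_min hη one_pos
  refine ⟨(B / η' + 1) ^ p, by positivity, fun b d hb => ?_⟩
  have hd0 := Real.rpow_nonneg (abs_nonneg d) p
  rcases lt_or_ge |d| η' with hd | hd
  · have hd1 : |d| < 1 := hd.trans_le (min_le_right _ _)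
    have h1 := h (b + d) (abs_le.1 ((abs_add_le b d).trans (by linarith))) b
      (abs_le.1 (by linarith)) (by
        rw [Real.dist_eq]; simpa using hd.trans_le (min_le_left η 1))
    rw [Real.dist_eq] at h1
    have h2 := (abs_lt.1 h1).2
    have h3 : 0 ≤ (B / η' + 1) ^ p * |d| ^ p := by positivity
    linarith
  · have h1 : |b + d| ≤ (B / η' + 1) * |d| := by
      have : B ≤ B / η' * |d| := by
        rw [div_mul_eq_mul_div, le_div_iff₀ hη0]
        exact mul_le_mul_of_nonneg_left hd hB
      have := abs_add_le b d
      linarith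
    have h2 := Real.rpow_le_rpow (abs_nonneg _) h1 (by linarith : 0 ≤ p)
    rw [Real.mul_rpow (by positivity) (abs_nonneg _)] at h2
    have h3 := Real.rpow_nonneg (abs_nonneg b) p
    linarith

end Powers

end PeriodicChannel
end

/-! ### Stream functions, transport and space-time derivatives -/

noncomputable section
namespace PeriodicChannel

variable {L H : ℝ}

section Static

variable {f f1 f2 u u1 u2 w w1 w2 : ℝ × ℝ → ℝ}

/-- A solenoidal field tangent to the walls has a stream function. -/
lemma exists_stream (hH : 0 < H) (hu : C1On L H u u1 u2) (hw : C1On L H w w1 w2)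
    (hdiv : ∀ x ∈ channel H, u1 x + w2 x = 0) (h0 : ∀ s, w (s, 0) = 0) (h1 : ∀ s, w (s, H) = 0) :
    ∃ (χ : ℝ × ℝ → ℝ) (q : ℝ), C1On L H χ (fun x => -w x) u ∧ (∀ s, χ (s, 0) = 0) ∧
      ∀ s, χ (s, H) = q := by
  -- Integration of `u` upward from the lower wall gives `∂₂χ = u`. Incompressibility and `w = 0` on
  -- that wall give `∂₁χ = -w`. As `w = 0` on the upper wall, `χ` is constant there.
  set χ : ℝ × ℝ → ℝ := fun x => ∫ s in (0 : ℝ)..x.2, u (x.1, s) with hχ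
  have hd1 : ∀ x : ℝ, ∀ y ∈ Icc 0 H, HasDerivAt (fun x => χ (x, y)) (-w (x, y)) x := by
    intro x y hy
    have hsub : ∀ {g : ℝ × ℝ → ℝ}, ContinuousOn g (closedChannel H) →
        ContinuousOn (fun q : ℝ × ℝ => g (q.1, q.2)) (Icc (x - 1) (x + 1) ×ˢ Icc 0 y) := fun hg =>
      hg.comp (by fun_prop) fun q hq => mk_mem_closedChannel ⟨hq.2.1, hq.2.2.trans hy.2⟩
    have h := hasDerivAt_setIntegral (μ := volume) (F := fun x s => u (x, s))
      (F' := fun x s => u1 (x, s))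
      (isCompact_Icc (a := 0) (b := y)) measurableSet_Ioo Ioo_subset_Icc_self
      (t₀ := x) (a := x - 1) (b := x + 1) ⟨by linarith, by linarith⟩ (hsub hu.cont) (hsub hu.cont1)
      fun t _ s hs => hu.deriv1 (t, s) (mk_mem_channel ⟨hs.1, hs.2.trans_le hy.2⟩)
    simp only [hχ, intervalIntegral.integral_of_le hy.1, integral_Ioc_eq_integral_Ioo]
    refine h.congr_deriv ?_
    have e : ∫ s in (0 : ℝ)..y, w2 (x, s) = w (x, y) - w (x, 0) :=
      intervalIntegral.integral_eq_sub_of_hasDerivAt_of_le hy.1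
        ((continuousOn_column hw.cont x).mono (Icc_subset_Icc_right hy.2))
        (fun s hs => hw.deriv2 (x, s) (mk_mem_channel ⟨hs.1, hs.2.trans_le hy.2⟩))
        (((continuousOn_column hw.cont2 x).mono
          (Icc_subset_Icc_right hy.2)).intervalIntegrable_of_Icc hy.1)
    rw [h0, sub_zero] at e
    rw [← e, intervalIntegral.integral_of_le hy.1, integral_Ioc_eq_integral_Ioo, ← integral_neg]
    refine setIntegral_congr_fun measurableSet_Ioo fun s hs => ?_
    have := hdiv (x, s) (mk_mem_channel ⟨hs.1, hs.2.trans_le hy.2⟩)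
    linarith
  have hcont : ContinuousOn χ (closedChannel H) := by
    have hpc : Continuous fun q : (ℝ × ℝ) × ℝ => u (q.1.1, (projIcc 0 H hH.le q.2 : ℝ)) :=
      continuousOn_univ.1 <| hu.cont.comp (Continuous.continuousOn (by
        exact (continuous_fst.comp continuous_fst).prodMk
          (continuous_subtype_val.comp (continuous_projIcc.comp continuous_snd))))
        fun q _ => mk_mem_closedChannel (projIcc 0 H hH.le q.2).2
    have := intervalIntegral.continuous_parametric_intervalIntegral_of_continuous
      (μ := volume) (a₀ := 0) (f := fun (x : ℝ × ℝ) s => u (x.1, (projIcc 0 H hH.le s : ℝ))) hpc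
      continuous_snd
    refine this.continuousOn.congr fun x hx => ?_
    refine intervalIntegral.integral_congr fun s hs => ?_
    rw [uIcc_of_le hx.2.1] at hs
    simp only [projIcc_of_mem hH.le (show s ∈ Icc 0 H from ⟨hs.1, hs.2.trans hx.2.2⟩)]
  refine ⟨χ, χ (0, H), ⟨hcont, hw.cont.neg, hu.cont, fun x hx => ?_, fun x hx => ?_,
    fun x hx => ?_⟩, fun s => by simp [hχ], fun s => ?_⟩
  · refine intervalIntegral.integral_congr fun s hs => ?_
    rw [uIcc_of_le hx.2.1] at hs
    exact hu.periodic (x.1, s) (mk_mem_closedChannel ⟨hs.1, hs.2.trans hx.2.2⟩)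
  · exact hd1 x.1 x.2 (Ioo_subset_Icc_self hx.2)
  · have hc := continuousOn_column hu.cont x.1
    refine intervalIntegral.integral_hasDerivAt_right (f := fun s => u (x.1, s)) ?_ ?_ ?_
    · exact (hc.mono (Icc_subset_Icc_right hx.2.2.le)).intervalIntegrable_of_Icc hx.2.1.le
    · exact ContinuousOn.stronglyMeasurableAtFilter isOpen_Ioo
        (hc.mono Ioo_subset_Icc_self) x.2 hx.2
    · exact hc.continuousAt (Icc_mem_nhds hx.2.1 hx.2.2)
  · have hH' : H ∈ Icc 0 H := ⟨hH.le, le_rfl⟩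
    refine is_const_of_deriv_eq_zero (f := fun x => χ (x, H))
      (fun x => (hd1 x H hH').differentiableAt) (fun x => ?_) s 0
    rw [(hd1 x H hH').deriv, h1, neg_zero]

/-- Transport by a solenoidal field tangent to the walls preserves integrals. -/
lemma setIntegral_transport (hL : 0 ≤ L) (hH : 0 ≤ H) (hu : C1On L H u u1 u2)
    (hw : C1On L H w w1 w2) (hdiv : ∀ x ∈ channel H, u1 x + w2 x = 0) (h0 : ∀ s, w (s, 0) = 0)
    (h1 : ∀ s, w (s, H) = 0) (hf : C1On L H f f1 f2) :
    ∫ x in cell L H, (u x * f1 x + w x * f2 x) = 0 := by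
  have e1 := (hu.mul hf).setIntegral_deriv1 hL hH
  have e2 := (hw.mul hf).setIntegral_deriv2_of_eq hL hH (by simp [h0, h1])
  refine Eq.trans ?_ ((congrArg₂ (· + ·) e1 e2).trans (add_zero 0))
  rw [← integral_add (integrableOn_cell (hu.mul hf).cont1) (integrableOn_cell (hw.mul hf).cont2)]
  refine setIntegral_congr_fun measurableSet_cell fun x hx => ?_
  have := hdiv x (cell_subset_channel hx)
  linear_combination (-f x) * this

end Static

/-- The space-time domain. -/
def spaceTime (H : ℝ) : Set (ℝ × (ℝ × ℝ)) := univ ×ˢ closedChannel H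

lemma uniqueDiffOn_spaceTime (hH : 0 < H) : UniqueDiffOn ℝ (spaceTime H) :=
  uniqueDiffOn_univ.prod (uniqueDiffOn_closedChannel hH)

lemma spaceTime_mem_nhds {t : ℝ} {x : ℝ × ℝ} (hx : x ∈ channel H) : spaceTime H ∈ nhds (t, x) :=
  prod_mem_nhds Filter.univ_mem (closedChannel_mem_nhds hx)

lemma mk_mem_spaceTime {t : ℝ} {x : ℝ × ℝ} (hx : x ∈ closedChannel H) : (t, x) ∈ spaceTime H :=
  ⟨mem_univ _, hx⟩

/-- The time derivative on the space-time domain. -/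
def dT (H : ℝ) : (ℝ × (ℝ × ℝ) → ℝ) → ℝ × (ℝ × ℝ) → ℝ := dirDeriv (spaceTime H) (1, (0, 0))
/-- The derivative in the first space variable, up to the boundary. -/
def dX (H : ℝ) : (ℝ × (ℝ × ℝ) → ℝ) → ℝ × (ℝ × ℝ) → ℝ := dirDeriv (spaceTime H) (0, (1, 0))
/-- The derivative in the second space variable, up to the boundary. -/
def dY (H : ℝ) : (ℝ × (ℝ × ℝ) → ℝ) → ℝ × (ℝ × ℝ) → ℝ := dirDeriv (spaceTime H) (0, (0, 1))

section SpaceTime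

variable {f : ℝ × (ℝ × ℝ) → ℝ}

lemma hasDerivAt_dT (hf : ContDiffOn ℝ 1 f (spaceTime H)) (t : ℝ) {x : ℝ × ℝ} (hx : x ∈ channel H) :
    HasDerivAt (fun s => f (s, x)) (dT H f (t, x)) t :=
  hasDerivAt_dirDeriv (γ := fun s => (s, x)) hf (spaceTime_mem_nhds hx)
    ((hasDerivAt_id t).prodMk (hasDerivAt_const _ _)) rfl

lemma hasDerivAt_dX (hf : ContDiffOn ℝ 1 f (spaceTime H)) (t : ℝ) {x : ℝ × ℝ} (hx : x ∈ channel H) :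
    HasDerivAt (fun s => f (t, (s, x.2))) (dX H f (t, x)) x.1 :=
  hasDerivAt_dirDeriv (γ := fun s => (t, (s, x.2))) hf (spaceTime_mem_nhds hx)
    ((hasDerivAt_const _ _).prodMk ((hasDerivAt_id x.1).prodMk (hasDerivAt_const _ _))) rfl

lemma hasDerivAt_dY (hf : ContDiffOn ℝ 1 f (spaceTime H)) (t : ℝ) {x : ℝ × ℝ} (hx : x ∈ channel H) :
    HasDerivAt (fun s => f (t, (x.1, s))) (dY H f (t, x)) x.2 :=
  hasDerivAt_dirDeriv (γ := fun s => (t, (x.1, s))) hf (spaceTime_mem_nhds hx)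
    ((hasDerivAt_const _ _).prodMk ((hasDerivAt_const _ _).prodMk (hasDerivAt_id x.2))) rfl

lemma continuousOn_slice (hf : ContinuousOn f (spaceTime H)) (t : ℝ) :
    ContinuousOn (fun x => f (t, x)) (closedChannel H) :=
  hf.comp (by fun_prop) fun _ hx => mk_mem_spaceTime hx

lemma C1On.slice (hH : 0 < H) (hf : ContDiffOn ℝ 1 f (spaceTime H))
    (hp : ∀ t, PeriodicOn L (fun x => f (t, x)) (closedChannel H)) (t : ℝ) :
    C1On L H (fun x => f (t, x)) (fun x => dX H f (t, x)) (fun x => dY H f (t, x)) where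
  cont := continuousOn_slice hf.continuousOn t
  cont1 := continuousOn_slice (contDiffOn_dirDeriv (uniqueDiffOn_spaceTime hH) (m := 0) hf
    (by norm_num) _).continuousOn t
  cont2 := continuousOn_slice (contDiffOn_dirDeriv (uniqueDiffOn_spaceTime hH) (m := 0) hf
    (by norm_num) _).continuousOn t
  periodic := hp t
  deriv1 _ hx := hasDerivAt_dX hf t hx
  deriv2 _ hx := hasDerivAt_dY hf t hx

lemma periodicOn_dirDeriv_spaceTime (hp : ∀ t, PeriodicOn L (fun x => f (t, x)) (closedChannel H))
    (e : ℝ × (ℝ × ℝ)) (t : ℝ) :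
    PeriodicOn L (fun x => dirDeriv (spaceTime H) e f (t, x)) (closedChannel H) := by
  intro x hx
  have := dirDeriv_add_of_periodic (Ω := spaceTime H) (f := f) (e := e) (a := (0, (L, 0)))
    (fun x => by simp [spaceTime, closedChannel])
    (fun x hx => by simpa [Prod.add_def] using hp x.1 x.2 hx.2) (mk_mem_spaceTime (t := t) hx)
  simpa [Prod.add_def] using this

/-- An integral over the period cell is conserved if its formal time derivative vanishes. -/
lemma setIntegral_conserved (hH : 0 < H) (hf : ContDiffOn ℝ 1 f (spaceTime H))
    (h : ∀ t, ∫ x in cell L H, dT H f (t, x) = 0) (t : ℝ) :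
    ∫ x in cell L H, f (t, x) = ∫ x in cell L H, f (0, x) := by
  have hd : ∀ t, HasDerivAt (fun t => ∫ x in cell L H, f (t, x)) 0 t := fun t => by
    have hsub : ∀ {g : ℝ × (ℝ × ℝ) → ℝ}, ContinuousOn g (spaceTime H) →
        ContinuousOn (fun q : ℝ × (ℝ × ℝ) => g (q.1, q.2))
          (Icc (t - 1) (t + 1) ×ˢ (Icc 0 L ×ˢ Icc 0 H)) := fun hg =>
      hg.mono (prod_mono (subset_univ _) (Icc_subset_closedChannel _ _))
    rw [← h t]
    exact hasDerivAt_setIntegral (μ := volume) (F := fun t x => f (t, x))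
      (F' := fun t x => dT H f (t, x)) (isCompact_Icc.prod isCompact_Icc) measurableSet_cell
      cell_subset_Icc (a := t - 1) (b := t + 1) ⟨by linarith, by linarith⟩ (hsub hf.continuousOn)
      (hsub (contDiffOn_dirDeriv (uniqueDiffOn_spaceTime hH) (m := 0) hf
        (by norm_num) _).continuousOn)
      fun s _ x hx => hasDerivAt_dT hf s (cell_subset_channel hx)
  exact is_const_of_deriv_eq_zero (f := fun t => ∫ x in cell L H, f (t, x))
    (fun t => (hd t).differentiableAt) (fun t => (hd t).deriv) t 0

end SpaceTime

end PeriodicChannel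
end

/-! ### Euler flows: the vorticity equation -/

noncomputable section
namespace PeriodicChannel

variable {L H : ℝ} {v : ℝ → ℝ × ℝ → ℝ × ℝ} {P : ℝ → ℝ × ℝ → ℝ}

/-- The conclusions about an Euler flow that enter the stability argument: regularity of the
velocity `(u, w)` in space and the conservation laws. -/
structure ConservedFlow (L H : ℝ) (u u1 u2 w w1 w2 : ℝ → ℝ × ℝ → ℝ) : Prop where
  c1_u : ∀ t, C1On L H (u t) (u1 t) (u2 t)
  c1_w : ∀ t, C1On L H (w t) (w1 t) (w2 t)
  div_free : ∀ t, ∀ x ∈ channel H, u1 t x + w2 t x = 0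
  bottom : ∀ t s, w t (s, 0) = 0
  top : ∀ t s, w t (s, H) = 0
  casimir : ∀ F : ℝ → ℝ, Continuous F → ∀ t,
    ∫ x in cell L H, F (w1 t x - u2 t x) = ∫ x in cell L H, F (w1 0 x - u2 0 x)
  impulse : ∀ t, ∫ x in cell L H, x.2 * (w1 t x - u2 t x)
    = ∫ x in cell L H, x.2 * (w1 0 x - u2 0 x)
  momentum : ∀ t, ∫ x in cell L H, u t x = ∫ x in cell L H, u 0 x
  energy : ∀ t, ∫ x in cell L H, (u t x ^ 2 + w t x ^ 2) = ∫ x in cell L H, (u 0 x ^ 2 + w 0 x ^ 2)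

/-- A field of class `C¹` that is minus a gradient has zero curl. -/
lemma curl_eq_zero {Q : ℝ × ℝ → ℝ} {a b : ℝ × ℝ → ℝ} {x : ℝ × ℝ} {α β : ℝ}
    (hQ : ∀ᶠ y in nhds x, DifferentiableAt ℝ Q y)
    (h1 : ∀ᶠ y in nhds x, a y = -partial1 Q y) (h2 : ∀ᶠ y in nhds x, b y = -partial2 Q y)
    (ha : DifferentiableAt ℝ a x) (hb : DifferentiableAt ℝ b x)
    (hα : HasDerivAt (fun s => b (s, x.2)) α x.1) (hβ : HasDerivAt (fun s => a (x.1, s)) β x.2) :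
    α = β := by
  -- `Q` need not be assumed `C²`: its gradient is `-(a, b)`, which is differentiable at `x`, and
  -- this suffices for symmetry of the second derivative. It lets a merely `C¹` pressure be
  -- eliminated.
  have hf : ∀ᶠ y in nhds x, HasFDerivAt Q
      ((-a y) • ContinuousLinearMap.fst ℝ ℝ ℝ + (-b y) • ContinuousLinearMap.snd ℝ ℝ ℝ) y := by
    filter_upwards [hQ, h1, h2] with y hy hy1 hy2
    refine hy.hasFDerivAt.congr_fderiv ?_
    rw [hy1, hy2, neg_neg, neg_neg]
    ext <;> simp [partial1, partial2]
  have hd := (ha.hasFDerivAt.neg.smul_const (ContinuousLinearMap.fst ℝ ℝ ℝ)).add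
    (hb.hasFDerivAt.neg.smul_const (ContinuousLinearMap.snd ℝ ℝ ℝ))
  have hs := second_derivative_symmetric_of_eventually hf hd (1, 0) (0, 1)
  simp only [add_apply, ContinuousLinearMap.smulRight_apply,
    neg_apply, smul_apply, ContinuousLinearMap.coe_fst',
    ContinuousLinearMap.coe_snd', smul_eq_mul, mul_zero, mul_one, zero_add, add_zero, neg_inj] at hs
  rw [← partial1_eq hb hα, ← partial2_eq ha hβ]
  exact hs

/-- The horizontal velocity component, as a function on space-time. -/
def vel1 (v : ℝ → ℝ × ℝ → ℝ × ℝ) (q : ℝ × (ℝ × ℝ)) : ℝ := (v q.1 q.2).1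
/-- The vertical velocity component, as a function on space-time. -/
def vel2 (v : ℝ → ℝ × ℝ → ℝ × ℝ) (q : ℝ × (ℝ × ℝ)) : ℝ := (v q.1 q.2).2

/-- The material acceleration of the component `f` of the velocity `v`. -/
def accel (H : ℝ) (v : ℝ → ℝ × ℝ → ℝ × ℝ) (f : ℝ × (ℝ × ℝ) → ℝ) (q : ℝ × (ℝ × ℝ)) : ℝ :=
  dT H f q + (vel1 v q * dX H f q + vel2 v q * dY H f q)

/-- The vorticity on space-time, with its boundary values. -/
def vort (H : ℝ) (v : ℝ → ℝ × ℝ → ℝ × ℝ) (q : ℝ × (ℝ × ℝ)) : ℝ :=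
  dX H (vel2 v) q - dY H (vel1 v) q

section

variable {f : ℝ × (ℝ × ℝ) → ℝ}

lemma differentiableAt_slice (hf : ContDiffOn ℝ 1 f (spaceTime H)) (t : ℝ) {x : ℝ × ℝ}
    (hx : x ∈ channel H) : DifferentiableAt ℝ (fun y => f (t, y)) x :=
  DifferentiableAt.comp x (g := f)
    ((hf.contDiffAt (spaceTime_mem_nhds hx)).differentiableAt (by norm_num)) (by fun_prop)

lemma partial1_slice (hf : ContDiffOn ℝ 1 f (spaceTime H)) (t : ℝ) {x : ℝ × ℝ}
    (hx : x ∈ channel H) : partial1 (fun y => f (t, y)) x = dX H f (t, x) :=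
  partial1_eq (differentiableAt_slice hf t hx) (hasDerivAt_dX hf t hx)

lemma partial2_slice (hf : ContDiffOn ℝ 1 f (spaceTime H)) (t : ℝ) {x : ℝ × ℝ}
    (hx : x ∈ channel H) : partial2 (fun y => f (t, y)) x = dY H f (t, x) :=
  partial2_eq (differentiableAt_slice hf t hx) (hasDerivAt_dY hf t hx)

lemma dX_eq (hf : ContDiffOn ℝ 1 f (spaceTime H)) (t : ℝ) {x : ℝ × ℝ} (hx : x ∈ channel H) {d : ℝ}
    (h : HasDerivAt (fun s => f (t, (s, x.2))) d x.1) : dX H f (t, x) = d :=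
  (hasDerivAt_dX hf t hx).unique h

lemma dY_eq (hf : ContDiffOn ℝ 1 f (spaceTime H)) (t : ℝ) {x : ℝ × ℝ} (hx : x ∈ channel H) {d : ℝ}
    (h : HasDerivAt (fun s => f (t, (x.1, s))) d x.2) : dY H f (t, x) = d :=
  (hasDerivAt_dY hf t hx).unique h

lemma dT_eq (hf : ContDiffOn ℝ 1 f (spaceTime H)) (t : ℝ) {x : ℝ × ℝ} (hx : x ∈ channel H) {d : ℝ}
    (h : HasDerivAt (fun s => f (s, x)) d t) : dT H f (t, x) = d :=
  (hasDerivAt_dT hf t hx).unique h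

lemma contDiffOn_partials (hH : 0 < H) (hf : ContDiffOn ℝ 2 f (spaceTime H)) :
    ContDiffOn ℝ 1 (dT H f) (spaceTime H) ∧ ContDiffOn ℝ 1 (dX H f) (spaceTime H) ∧
      ContDiffOn ℝ 1 (dY H f) (spaceTime H) :=
  ⟨contDiffOn_dirDeriv (uniqueDiffOn_spaceTime hH) hf (by norm_num) _,
    contDiffOn_dirDeriv (uniqueDiffOn_spaceTime hH) hf (by norm_num) _,
    contDiffOn_dirDeriv (uniqueDiffOn_spaceTime hH) hf (by norm_num) _⟩

end

namespace IsEulerFlow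

lemma contDiffOn_vel1 (hv : IsEulerFlow L H v P) : ContDiffOn ℝ 2 (vel1 v) (spaceTime H) :=
  hv.smooth_v.fst

lemma contDiffOn_vel2 (hv : IsEulerFlow L H v P) : ContDiffOn ℝ 2 (vel2 v) (spaceTime H) :=
  hv.smooth_v.snd

lemma contDiffOn_vel1' (hv : IsEulerFlow L H v P) : ContDiffOn ℝ 1 (vel1 v) (spaceTime H) :=
  hv.contDiffOn_vel1.of_le (by norm_num)

lemma contDiffOn_vel2' (hv : IsEulerFlow L H v P) : ContDiffOn ℝ 1 (vel2 v) (spaceTime H) :=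
  hv.contDiffOn_vel2.of_le (by norm_num)

lemma periodic_vel1 (hv : IsEulerFlow L H v P) (t : ℝ) :
    PeriodicOn L (fun x => vel1 v (t, x)) (closedChannel H) :=
  fun x hx => congrArg Prod.fst (hv.periodic_v t x hx)

lemma periodic_vel2 (hv : IsEulerFlow L H v P) (t : ℝ) :
    PeriodicOn L (fun x => vel2 v (t, x)) (closedChannel H) :=
  fun x hx => congrArg Prod.snd (hv.periodic_v t x hx)

lemma contDiffOn_accel (hH : 0 < H) (hv : IsEulerFlow L H v P) {f : ℝ × (ℝ × ℝ) → ℝ}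
    (hf : ContDiffOn ℝ 2 f (spaceTime H)) : ContDiffOn ℝ 1 (accel H v f) (spaceTime H) :=
  (contDiffOn_partials hH hf).1.add
    ((hv.contDiffOn_vel1'.mul (contDiffOn_partials hH hf).2.1).add
      (hv.contDiffOn_vel2'.mul (contDiffOn_partials hH hf).2.2))

lemma periodic_accel (hv : IsEulerFlow L H v P) {f : ℝ × (ℝ × ℝ) → ℝ}
    (hp : ∀ t, PeriodicOn L (fun x => f (t, x)) (closedChannel H)) (t : ℝ) :
    PeriodicOn L (fun x => accel H v f (t, x)) (closedChannel H) := by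
  intro x hx
  have e0 := hv.periodic_vel1 t x hx
  have e1 := hv.periodic_vel2 t x hx
  have e2 := periodicOn_dirDeriv_spaceTime hp (1, (0, 0)) t x hx
  have e3 := periodicOn_dirDeriv_spaceTime hp (0, (1, 0)) t x hx
  have e4 := periodicOn_dirDeriv_spaceTime hp (0, (0, 1)) t x hx
  simp only at e0 e1 e2 e3 e4
  simp only [accel, dT, dX, dY, e0, e1, e2, e3, e4]

lemma accel1_eq (hv : IsEulerFlow L H v P) (t : ℝ) {x : ℝ × ℝ} (hx : x ∈ channel H) :
    accel H v (vel1 v) (t, x) = -partial1 (P t) x := by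
  rw [← hv.momentum1 t x hx, accel, ← partial1_slice hv.contDiffOn_vel1' t hx,
    ← partial2_slice hv.contDiffOn_vel1' t hx, ← (hasDerivAt_dT hv.contDiffOn_vel1' t hx).deriv]
  rfl

lemma accel2_eq (hv : IsEulerFlow L H v P) (t : ℝ) {x : ℝ × ℝ} (hx : x ∈ channel H) :
    accel H v (vel2 v) (t, x) = -partial2 (P t) x := by
  rw [← hv.momentum2 t x hx, accel, ← partial1_slice hv.contDiffOn_vel2' t hx,
    ← partial2_slice hv.contDiffOn_vel2' t hx, ← (hasDerivAt_dT hv.contDiffOn_vel2' t hx).deriv]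
  rfl

lemma solenoidal (hv : IsEulerFlow L H v P) (t : ℝ) {x : ℝ × ℝ} (hx : x ∈ channel H) :
    dX H (vel1 v) (t, x) + dY H (vel2 v) (t, x) = 0 := by
  rw [← hv.div_free t x hx, ← partial1_slice hv.contDiffOn_vel1' t hx,
    ← partial2_slice hv.contDiffOn_vel2' t hx]
  rfl

lemma vorticity_eq (hv : IsEulerFlow L H v P) (t : ℝ) {x : ℝ × ℝ} (hx : x ∈ channel H) :
    vorticity (v t) x = vort H v (t, x) := by
  rw [vort, ← partial1_slice hv.contDiffOn_vel2' t hx, ← partial2_slice hv.contDiffOn_vel1' t hx]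
  rfl

lemma differentiableAt_pressure (hv : IsEulerFlow L H v P) (t : ℝ) {x : ℝ × ℝ}
    (hx : x ∈ channel H) : DifferentiableAt ℝ (P t) x :=
  ((hv.smooth_P t).contDiffAt (isOpen_channel.mem_nhds hx)).differentiableAt (by norm_num)

lemma curl_accel (hH : 0 < H) (hv : IsEulerFlow L H v P) (t : ℝ) {x : ℝ × ℝ} (hx : x ∈ channel H) :
    dX H (accel H v (vel2 v)) (t, x) = dY H (accel H v (vel1 v)) (t, x) := by
  have hx' := isOpen_channel.mem_nhds hx
  refine curl_eq_zero (Q := P t) (a := fun y => accel H v (vel1 v) (t, y))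
    (b := fun y => accel H v (vel2 v) (t, y)) ?_ ?_ ?_
    (differentiableAt_slice (hv.contDiffOn_accel hH hv.contDiffOn_vel1) t hx)
    (differentiableAt_slice (hv.contDiffOn_accel hH hv.contDiffOn_vel2) t hx)
    (hasDerivAt_dX (hv.contDiffOn_accel hH hv.contDiffOn_vel2) t hx)
    (hasDerivAt_dY (hv.contDiffOn_accel hH hv.contDiffOn_vel1) t hx)
  · filter_upwards [hx'] with y hy using hv.differentiableAt_pressure t hy
  · filter_upwards [hx'] with y hy using hv.accel1_eq t hy
  · filter_upwards [hx'] with y hy using hv.accel2_eq t hy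

lemma contDiffOn_vort (hH : 0 < H) (hv : IsEulerFlow L H v P) :
    ContDiffOn ℝ 1 (vort H v) (spaceTime H) :=
  (contDiffOn_partials hH hv.contDiffOn_vel2).2.1.sub
    (contDiffOn_partials hH hv.contDiffOn_vel1).2.2

lemma periodic_vort (hv : IsEulerFlow L H v P) (t : ℝ) :
    PeriodicOn L (fun x => vort H v (t, x)) (closedChannel H) := by
  intro x hx
  have e1 := periodicOn_dirDeriv_spaceTime hv.periodic_vel2 (0, (1, 0)) t x hx
  have e2 := periodicOn_dirDeriv_spaceTime hv.periodic_vel1 (0, (0, 1)) t x hx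
  simp only at e1 e2
  simp only [vort, dX, dY, e1, e2]

/-- The vorticity equation. -/
lemma vorticity_transport (hH : 0 < H) (hv : IsEulerFlow L H v P) (t : ℝ) {x : ℝ × ℝ}
    (hx : x ∈ channel H) :
    dT H (vort H v) (t, x) + (vel1 v (t, x) * dX H (vort H v) (t, x)
      + vel2 v (t, x) * dY H (vort H v) (t, x)) = 0 := by
  have h1 := hv.contDiffOn_vel1; have h2 := hv.contDiffOn_vel2
  have h1' := hv.contDiffOn_vel1'; have h2' := hv.contDiffOn_vel2'
  obtain ⟨pT1, pX1, pY1⟩ := contDiffOn_partials hH h1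
  obtain ⟨pT2, pX2, pY2⟩ := contDiffOn_partials hH h2
  have hn : spaceTime H ∈ nhds (t, x) := spaceTime_mem_nhds hx
  have eT := dT_eq (hv.contDiffOn_vort hH) t hx
    ((hasDerivAt_dT pX2 t hx).sub (hasDerivAt_dT pY1 t hx))
  have eX := dX_eq (hv.contDiffOn_vort hH) t hx
    ((hasDerivAt_dX pX2 t hx).sub (hasDerivAt_dX pY1 t hx))
  have eY := dY_eq (hv.contDiffOn_vort hH) t hx
    ((hasDerivAt_dY pX2 t hx).sub (hasDerivAt_dY pY1 t hx))
  have a2 := dX_eq (hv.contDiffOn_accel hH h2) t hx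
    ((hasDerivAt_dX pT2 t hx).add (((hasDerivAt_dX h1' t hx).mul (hasDerivAt_dX pX2 t hx)).add
      ((hasDerivAt_dX h2' t hx).mul (hasDerivAt_dX pY2 t hx))))
  have a1 := dY_eq (hv.contDiffOn_accel hH h1) t hx
    ((hasDerivAt_dY pT1 t hx).add (((hasDerivAt_dY h1' t hx).mul (hasDerivAt_dY pX1 t hx)).add
      ((hasDerivAt_dY h2' t hx).mul (hasDerivAt_dY pY1 t hx))))
  have c1 : dX H (dT H (vel2 v)) (t, x) = dT H (dX H (vel2 v)) (t, x) := dirDeriv_comm h2 hn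
  have c2 : dY H (dT H (vel1 v)) (t, x) = dT H (dY H (vel1 v)) (t, x) := dirDeriv_comm h1 hn
  have c3 : dX H (dY H (vel2 v)) (t, x) = dY H (dX H (vel2 v)) (t, x) := dirDeriv_comm h2 hn
  have c4 : dY H (dX H (vel1 v)) (t, x) = dX H (dY H (vel1 v)) (t, x) := dirDeriv_comm h1 hn
  have hc := hv.curl_accel hH t hx
  have hd := hv.solenoidal t hx
  rw [a1, a2, c1, c2, c3, c4] at hc
  rw [eT, eX, eY]
  -- The curl of the acceleration is the material derivative of the vorticity plus the vorticity
  -- times the divergence.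
  linear_combination hc - (dX H (vel2 v) (t, x) - dY H (vel1 v) (t, x)) * hd

/-- The horizontal acceleration has mean zero on horizontal lines. -/
lemma integral_accel1 (hH : 0 < H) (hL : 0 < L) (hv : IsEulerFlow L H v P) (t : ℝ) {y : ℝ}
    (hy : y ∈ Icc 0 H) : ∫ x in (0 : ℝ)..L, accel H v (vel1 v) (t, (x, y)) = 0 := by
  have hc := continuousOn_slice (hv.contDiffOn_accel hH hv.contDiffOn_vel1).continuousOn t
  have hoo : EqOn (fun y => ∫ x in (0 : ℝ)..L, accel H v (vel1 v) (t, (x, y))) (fun _ => 0)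
      (Ioo 0 H) := by
    intro y hy
    have hd : ∀ x : ℝ, HasDerivAt (fun s => -P t (s, y)) (accel H v (vel1 v) (t, (x, y))) x := by
      intro x
      have hx : (x, y) ∈ channel H := mk_mem_channel hy
      rw [hv.accel1_eq t hx]
      exact ((hv.differentiableAt_pressure t hx).hasFDerivAt.comp_hasDerivAt x
        ((hasDerivAt_id x).prodMk (hasDerivAt_const x y))).neg
    simp only
    rw [intervalIntegral.integral_eq_sub_of_hasDerivAt (fun x _ => hd x)
      ((continuousOn_row hc (Ioo_subset_Icc_self hy)).intervalIntegrable _ _)]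
    have := hv.periodic_P t (0, y) (mk_mem_channel hy)
    simp only [zero_add] at this
    rw [this, sub_self]
  -- The pressure is controlled only in the open channel. The acceleration is continuous up to the
  -- walls, so the identity extends there, which is where the energy balance uses it.
  have hcl : Icc 0 H = closure (Ioo 0 H) := (closure_Ioo hH.ne).symm
  exact EqOn.of_subset_closure hoo (continuousOn_integral_row hL.le hc) continuousOn_const
    Ioo_subset_Icc_self hcl.subset hy

end IsEulerFlow

end PeriodicChannel
end

/-! ### Conservation laws -/

noncomputable section
namespace PeriodicChannel

variable {L H : ℝ} {v : ℝ → ℝ × ℝ → ℝ × ℝ} {P : ℝ → ℝ × ℝ → ℝ}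

/-- Equality of the integrals of all polynomials implies equality for all continuous functions. -/
lemma setIntegral_comp_eq_of_polynomial (hL : 0 < L) (hH : 0 < H) {a b : ℝ × ℝ → ℝ}
    (ha : ContinuousOn a (closedChannel H)) (hb : ContinuousOn b (closedChannel H))
    (h : ∀ Q : Polynomial ℝ, ∫ x in cell L H, Q.eval (a x) = ∫ x in cell L H, Q.eval (b x))
    {F : ℝ → ℝ} (hF : Continuous F) :
    ∫ x in cell L H, F (a x) = ∫ x in cell L H, F (b x) := by
  obtain ⟨A, hA0, hA⟩ := exists_bound_cell L ha
  obtain ⟨B, hB0, hB⟩ := exists_bound_cell L hb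
  have key : ∀ ε > 0, |(∫ x in cell L H, F (a x)) - ∫ x in cell L H, F (b x)|
      ≤ 2 * (L * H) * ε := by
    intro ε hε
    -- Weierstrass approximation on an interval containing the values of both functions on the cell;
    -- the error is uniform and the cell has finite area.
    obtain ⟨Q, hQ⟩ := exists_polynomial_near_of_continuousOn (-(max A B)) (max A B) F
      hF.continuousOn ε hε
    have close : ∀ {c : ℝ × ℝ → ℝ}, ContinuousOn c (closedChannel H) →
        (∀ x ∈ cell L H, |c x| ≤ max A B) →
        |(∫ x in cell L H, Q.eval (c x)) - ∫ x in cell L H, F (c x)| ≤ L * H * ε := by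
      intro c hc hcb
      rw [← integral_sub (integrableOn_cell (f := fun x => Q.eval (c x))
        (Q.continuous.comp_continuousOn hc))
        (integrableOn_cell (f := fun x => F (c x)) (hF.comp_continuousOn hc))]
      have := norm_setIntegral_le_of_norm_le_const (μ := volume) (s := cell L H)
        (f := fun x => Q.eval (c x) - F (c x)) (C := ε) volume_cell_lt_top
        (fun x hx => (hQ (c x) (abs_le.1 (hcb x hx))).le)
      rw [measureReal_cell hL.le hH.le, Real.norm_eq_abs] at this
      linarith
    have h1 := close ha fun x hx => (hA x hx).trans (le_max_left _ _)
    have h2 := close hb fun x hx => (hB x hx).trans (le_max_right _ _)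
    rw [h Q] at h1
    rw [abs_le] at h1 h2 ⊢
    constructor <;> linarith
  have hLH : 0 < 2 * (L * H) := by positivity
  refine eq_of_abs_sub_le_all fun ε hε => ?_
  have := key (ε / (2 * (L * H))) (by positivity)
  rwa [mul_div_cancel₀ _ hLH.ne'] at this

namespace IsEulerFlow

/-- The integrals of functions along the flow: their time derivative is the integral of the
material derivative. -/
lemma setIntegral_conserved_of_material (hL : 0 < L) (hH : 0 < H) (hv : IsEulerFlow L H v P)
    {f : ℝ × (ℝ × ℝ) → ℝ} (hf : ContDiffOn ℝ 1 f (spaceTime H))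
    (hp : ∀ t, PeriodicOn L (fun x => f (t, x)) (closedChannel H))
    (h : ∀ t, ∫ x in cell L H, (dT H f (t, x) + (vel1 v (t, x) * dX H f (t, x)
      + vel2 v (t, x) * dY H f (t, x))) = 0) (t : ℝ) :
    ∫ x in cell L H, f (t, x) = ∫ x in cell L H, f (0, x) := by
  refine setIntegral_conserved hH hf (fun t => ?_) t
  have hu := C1On.slice hH hv.contDiffOn_vel1' hv.periodic_vel1 t
  have hw := C1On.slice hH hv.contDiffOn_vel2' hv.periodic_vel2 t
  have hfs := C1On.slice hH hf hp t
  have ht := setIntegral_transport hL.le hH.le hu hw (fun x hx => hv.solenoidal t hx)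
    (hv.impermeable_bottom t) (hv.impermeable_top t) hfs
  rw [← h t, integral_add, ht, add_zero]
  · exact integrableOn_cell (continuousOn_slice (contDiffOn_dirDeriv (uniqueDiffOn_spaceTime hH)
      (m := 0) hf (by norm_num) _).continuousOn t)
  · exact integrableOn_cell ((hu.cont.mul hfs.cont1).add (hw.cont.mul hfs.cont2))

/-- By the chain rule `Q(ω)` is transported like `ω`, and no flow map is needed. Polynomials come
first because the densities used later, `|s|ᵖ` and the restricted Legendre transform, are treated
only as continuous functions. -/
lemma casimir_polynomial (hL : 0 < L) (hH : 0 < H) (hv : IsEulerFlow L H v P) (Q : Polynomial ℝ)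
    (t : ℝ) :
    ∫ x in cell L H, Q.eval (vort H v (t, x)) = ∫ x in cell L H, Q.eval (vort H v (0, x)) := by
  have hω := hv.contDiffOn_vort hH
  have hQ : ContDiffOn ℝ 1 (fun q => Q.eval (vort H v q)) (spaceTime H) :=
    ContDiff.comp_contDiffOn (g := fun s => Q.eval s) (by simpa using Q.contDiff_aeval (𝕜 := ℝ) 1) hω
  refine hv.setIntegral_conserved_of_material hL hH (f := fun q => Q.eval (vort H v q)) hQ
    (fun t x hx => congrArg (Q.eval ·) (hv.periodic_vort t x hx)) (fun t => ?_) t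
  rw [setIntegral_congr_fun (g := fun _ => 0) measurableSet_cell fun x hx => ?_]
  · simp
  have hx' := cell_subset_channel hx
  have eT := dT_eq hQ t hx' ((Q.hasDerivAt _).comp t (hasDerivAt_dT hω t hx'))
  have eX := dX_eq hQ t hx' ((Q.hasDerivAt _).comp x.1 (hasDerivAt_dX hω t hx'))
  have eY := dY_eq hQ t hx' ((Q.hasDerivAt _).comp x.2 (hasDerivAt_dY hω t hx'))
  simp only
  rw [eT, eX, eY]
  linear_combination (Q.derivative.eval (vort H v (t, x))) * hv.vorticity_transport hH t hx'

/-- The vertical momentum flux has mean zero. -/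
lemma setIntegral_flux (hL : 0 < L) (hH : 0 < H) (hv : IsEulerFlow L H v P) (t : ℝ) :
    ∫ x in cell L H, vel2 v (t, x) * dY H (vel1 v) (t, x) = 0 := by
  have hu := C1On.slice hH hv.contDiffOn_vel1' hv.periodic_vel1 t
  have hw := C1On.slice hH hv.contDiffOn_vel2' hv.periodic_vel2 t
  -- The velocity transports its own first component with zero mean. The part `v₁ ∂₁v₁` is half of
  -- `∂₁(v₁²)` and integrates to zero, so the other part does too.
  have ht := setIntegral_transport hL.le hH.le hu hw (fun x hx => hv.solenoidal t hx)
    (hv.impermeable_bottom t) (hv.impermeable_top t) hu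
  have h1 := (hu.mul hu).setIntegral_deriv1 hL.le hH.le
  have i1 := integrableOn_cell (L := L) (hu.cont.mul hu.cont1)
  have e : ∫ x in cell L H, vel1 v (t, x) * dX H (vel1 v) (t, x) = 0 := by
    have : ∫ x in cell L H, 2 * (vel1 v (t, x) * dX H (vel1 v) (t, x)) = 0 := by
      rw [← h1]; congr 1; ext x; ring
    rw [integral_const_mul] at this
    linarith
  rw [integral_add, e, zero_add] at ht
  · exact ht
  · exact i1
  · exact integrableOn_cell (hw.cont.mul hu.cont2)

/-- This integral is the rate of change of the impulse `∫x₂ω`. Its two parts are the mean of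
`∂₁(v₂²)/2` and the vertical momentum flux. -/
lemma setIntegral_vel2_mul_vort (hL : 0 < L) (hH : 0 < H) (hv : IsEulerFlow L H v P) (t : ℝ) :
    ∫ x in cell L H, vel2 v (t, x) * vort H v (t, x) = 0 := by
  have hu := C1On.slice hH hv.contDiffOn_vel1' hv.periodic_vel1 t
  have hw := C1On.slice hH hv.contDiffOn_vel2' hv.periodic_vel2 t
  have h1 := (hw.mul hw).setIntegral_deriv1 hL.le hH.le
  have e : ∫ x in cell L H, vel2 v (t, x) * dX H (vel2 v) (t, x) = 0 := by
    have : ∫ x in cell L H, 2 * (vel2 v (t, x) * dX H (vel2 v) (t, x)) = 0 := by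
      rw [← h1]; congr 1; ext x; ring
    rw [integral_const_mul] at this
    linarith
  simp only [vort, mul_sub]
  rw [integral_sub, e, hv.setIntegral_flux hL hH, sub_zero]
  · exact integrableOn_cell (hw.cont.mul hw.cont1)
  · exact integrableOn_cell (hw.cont.mul hu.cont2)

lemma impulse (hL : 0 < L) (hH : 0 < H) (hv : IsEulerFlow L H v P) (t : ℝ) :
    ∫ x in cell L H, x.2 * vort H v (t, x) = ∫ x in cell L H, x.2 * vort H v (0, x) := by
  have hω := hv.contDiffOn_vort hH
  have hf : ContDiffOn ℝ 1 (fun q : ℝ × (ℝ × ℝ) => q.2.2 * vort H v q) (spaceTime H) :=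
    (ContDiff.contDiffOn (by fun_prop)).mul hω
  refine hv.setIntegral_conserved_of_material hL hH (f := fun q => q.2.2 * vort H v q) hf
    (fun t x hx => congrArg (x.2 * ·) (hv.periodic_vort t x hx)) (fun t => ?_) t
  rw [← hv.setIntegral_vel2_mul_vort hL hH t]
  refine setIntegral_congr_fun measurableSet_cell fun x hx => ?_
  have hx' := cell_subset_channel hx
  have eT := dT_eq hf t hx' ((hasDerivAt_dT hω t hx').const_mul x.2)
  have eX := dX_eq hf t hx' ((hasDerivAt_dX hω t hx').const_mul x.2)
  have eY := dY_eq hf t hx' ((hasDerivAt_id x.2).mul (hasDerivAt_dY hω t hx'))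
  rw [eT, eX, eY]
  simp only [id]
  linear_combination x.2 * hv.vorticity_transport hH t hx'

/-- The material derivative of `v₁` is minus a horizontal pressure gradient, which has mean zero on
every line by periodicity of the pressure. -/
lemma momentum (hL : 0 < L) (hH : 0 < H) (hv : IsEulerFlow L H v P) (t : ℝ) :
    ∫ x in cell L H, vel1 v (t, x) = ∫ x in cell L H, vel1 v (0, x) := by
  refine hv.setIntegral_conserved_of_material hL hH hv.contDiffOn_vel1' hv.periodic_vel1
    (fun t => ?_) t
  have hc := continuousOn_slice (hv.contDiffOn_accel hH hv.contDiffOn_vel1).continuousOn t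
  have : ∫ x in cell L H, accel H v (vel1 v) (t, x) = 0 := by
    rw [setIntegral_cell_eq' hL.le hH.le hc, intervalIntegral_congr_Ioo hH.le (g := fun _ => 0)
      fun y hy => hv.integral_accel1 hH hL t (Ioo_subset_Icc_self hy)]
    simp
  exact this

/-- The power of the pressure force vanishes. -/
lemma setIntegral_vel_mul_accel (hL : 0 < L) (hH : 0 < H) (hv : IsEulerFlow L H v P) (t : ℝ) :
    ∫ x in cell L H, (vel1 v (t, x) * accel H v (vel1 v) (t, x)
      + vel2 v (t, x) * accel H v (vel2 v) (t, x)) = 0 := by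
  have hu := C1On.slice hH hv.contDiffOn_vel1' hv.periodic_vel1 t
  have hw := C1On.slice hH hv.contDiffOn_vel2' hv.periodic_vel2 t
  -- Integrating by parts against the pressure would need its behaviour at the walls. Instead the
  -- velocity is written through its stream function and the derivatives are moved onto the
  -- acceleration, whose curl vanishes. The only wall term is the constant `q` times the mean of the
  -- horizontal acceleration on the upper wall.
  obtain ⟨χ, q, hχ, hb, ht⟩ := exists_stream hH hu hw (fun x hx => hv.solenoidal t hx)
    (hv.impermeable_bottom t) (hv.impermeable_top t)
  have k1 := C1On.slice hH (hv.contDiffOn_accel hH hv.contDiffOn_vel1)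
    (hv.periodic_accel hv.periodic_vel1) t
  have k2 := C1On.slice hH (hv.contDiffOn_accel hH hv.contDiffOn_vel2)
    (hv.periodic_accel hv.periodic_vel2) t
  have e1 := (hχ.mul k2).setIntegral_deriv1 hL.le hH.le
  have e2 := (hχ.mul k1).setIntegral_deriv2 hL.le hH.le
  simp only [hb, ht, zero_mul, sub_zero] at e2
  rw [intervalIntegral.integral_const_mul, hv.integral_accel1 hH hL t ⟨hH.le, le_rfl⟩, mul_zero] at e2
  refine Eq.trans ?_ ((congrArg₂ (· - ·) e2 e1).trans (sub_zero 0))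
  rw [← integral_sub (integrableOn_cell (hχ.mul k1).cont2) (integrableOn_cell (hχ.mul k2).cont1)]
  refine setIntegral_congr_fun measurableSet_cell fun x hx => ?_
  have := hv.curl_accel hH t (cell_subset_channel hx)
  linear_combination χ x * this

lemma energy (hL : 0 < L) (hH : 0 < H) (hv : IsEulerFlow L H v P) (t : ℝ) :
    ∫ x in cell L H, (vel1 v (t, x) ^ 2 + vel2 v (t, x) ^ 2)
      = ∫ x in cell L H, (vel1 v (0, x) ^ 2 + vel2 v (0, x) ^ 2) := by
  have h1 := hv.contDiffOn_vel1'; have h2 := hv.contDiffOn_vel2'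
  have hf : ContDiffOn ℝ 1 (fun q => vel1 v q ^ 2 + vel2 v q ^ 2) (spaceTime H) :=
    (h1.pow 2).add (h2.pow 2)
  refine hv.setIntegral_conserved_of_material hL hH (f := fun q => vel1 v q ^ 2 + vel2 v q ^ 2) hf
    (fun t x hx => ?_) (fun t => ?_) t
  · have e1 := hv.periodic_vel1 t x hx
    have e2 := hv.periodic_vel2 t x hx
    simp only at e1 e2 ⊢
    rw [e1, e2]
  rw [setIntegral_congr_fun (g := fun x => 2 * (vel1 v (t, x) * accel H v (vel1 v) (t, x)
    + vel2 v (t, x) * accel H v (vel2 v) (t, x))) measurableSet_cell fun x hx => ?_]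
  · rw [integral_const_mul, hv.setIntegral_vel_mul_accel hL hH, mul_zero]
  have hx' := cell_subset_channel hx
  have eT := dT_eq hf t hx' (((hasDerivAt_dT h1 t hx').pow 2).add ((hasDerivAt_dT h2 t hx').pow 2))
  have eX := dX_eq hf t hx' (((hasDerivAt_dX h1 t hx').pow 2).add ((hasDerivAt_dX h2 t hx').pow 2))
  have eY := dY_eq hf t hx' (((hasDerivAt_dY h1 t hx').pow 2).add ((hasDerivAt_dY h2 t hx').pow 2))
  simp only
  rw [eT, eX, eY]
  simp only [accel, Nat.cast_ofNat, Nat.add_one_sub_one, pow_one]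
  ring

/-- The conservation laws of an Euler flow. -/
lemma conservedFlow (hL : 0 < L) (hH : 0 < H) (hv : IsEulerFlow L H v P) :
    ConservedFlow L H (fun t x => vel1 v (t, x)) (fun t x => dX H (vel1 v) (t, x))
      (fun t x => dY H (vel1 v) (t, x)) (fun t x => vel2 v (t, x))
      (fun t x => dX H (vel2 v) (t, x)) (fun t x => dY H (vel2 v) (t, x)) where
  c1_u := C1On.slice hH hv.contDiffOn_vel1' hv.periodic_vel1
  c1_w := C1On.slice hH hv.contDiffOn_vel2' hv.periodic_vel2
  div_free t _ hx := hv.solenoidal t hx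
  bottom := hv.impermeable_bottom
  top := hv.impermeable_top
  casimir _ hF t := setIntegral_comp_eq_of_polynomial hL hH
    (continuousOn_slice (hv.contDiffOn_vort hH).continuousOn t)
    (continuousOn_slice (hv.contDiffOn_vort hH).continuousOn 0)
    (fun Q => hv.casimir_polynomial hL hH Q t) hF
  impulse := hv.impulse hL hH
  momentum := hv.momentum hL hH
  energy := hv.energy hL hH

end IsEulerFlow

end PeriodicChannel
end

/-! ### Deviation from a shear flow and the energy-Casimir functional -/

noncomputable section
namespace PeriodicChannel

variable {L H : ℝ}

/-- A shear flow with velocity profile `U`, stream function `φ` and vorticity `-U'`, related by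
`-U' = g (φ - lam y)` with a nondecreasing `g` whose slope is below the Poincaré constant. -/
structure StableShear (L H : ℝ) (g : ℝ → ℝ) (lam M : ℝ) (φ U : ℝ → ℝ) : Prop where
  smooth_g : ContDiff ℝ 1 g
  cont_φ : ContinuousOn φ (Icc 0 H)
  cont_U : ContinuousOn U (Icc 0 H)
  deriv_φ : ∀ y ∈ Ioo 0 H, HasDerivAt φ (U y) y
  deriv_U : ∀ y ∈ Ioo 0 H, HasDerivAt U (-g (φ y - lam * y)) y
  nonneg : ∀ y ∈ Icc 0 H, 0 ≤ deriv g (φ y - lam * y)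
  le : ∀ y ∈ Icc 0 H, deriv g (φ y - lam * y) ≤ M
  lt : M < poincareConst L H

section Perturbation

variable {u u1 u2 w w1 w2 : ℝ × ℝ → ℝ} {U Ω : ℝ → ℝ}

/-- The stream function of the deviation of a velocity field from a shear flow, up to a uniform
translation. -/
lemma exists_perturbation_stream (hL : 0 < L) (hH : 0 < H) (hu : C1On L H u u1 u2)
    (hw : C1On L H w w1 w2) (hdiv : ∀ x ∈ channel H, u1 x + w2 x = 0) (h0 : ∀ s, w (s, 0) = 0)
    (h1 : ∀ s, w (s, H) = 0) (hU : C1On L H (fun x => U x.2) (fun _ => 0) (fun x => -Ω x.2)) :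
    ∃ (η : ℝ × ℝ → ℝ) (q c : ℝ), C1On L H η (fun x => -w x) (fun x => u x - U x.2 - q) ∧
      (∀ s, η (s, 0) = c) ∧ (∀ s, η (s, H) = c) ∧ ∫ x in cell L H, η x = 0 ∧
      ∫ x in cell L H, (u x - U x.2) = L * H * q := by
  have hu' := hu.sub hU
  simp only [sub_zero] at hu'
  obtain ⟨χ, q₀, hχ, hb, ht⟩ := exists_stream hH hu' hw hdiv h0 h1
  -- Subtracting `q x₂` equalises the two wall values and corresponds to removing a uniform
  -- horizontal velocity `q`; subtracting `m` makes the mean zero.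
  set q := q₀ / H
  set m := (L * H)⁻¹ * ∫ x in cell L H, (χ x - q * x.2)
  have hlin : C1On L H (fun x => q * x.2 + m) (fun _ => 0) (fun _ => q) :=
    C1On.of_vertical (a := fun y => q * y + m) (a' := fun _ => q) (by fun_prop) (by fun_prop)
      fun y _ => by simpa using ((hasDerivAt_id y).const_mul q).add_const m
  have hη := hχ.sub hlin
  simp only [sub_zero] at hη
  have e0 : ∀ s, χ (s, 0) - (q * (s, (0 : ℝ)).2 + m) = -m := fun s => by rw [hb]; simp
  have e1 : ∀ s, χ (s, H) - (q * (s, H).2 + m) = -m := fun s => by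
    rw [ht]; simp only [q]; field_simp; ring
  have hc := hχ.cont
  refine ⟨_, q, -m, hη, e0, e1, ?_, ?_⟩
  · have : ∀ x : ℝ × ℝ, χ x - (q * x.2 + m) = (χ x - q * x.2) - m := fun x => by ring
    simp_rw [this]
    rw [integral_sub (integrableOn_cell (by fun_prop)) (integrable_const _),
      setIntegral_cell_const hL.le hH.le]
    simp only [m]
    field_simp
    ring
  · have := hη.setIntegral_deriv2_of_eq hL.le hH.le fun s => by rw [e0, e1]
    rw [integral_sub (integrableOn_cell hu'.cont) (integrable_const _),
      setIntegral_cell_const hL.le hH.le] at this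
    linarith

/-- Vertical moments of the vorticity in terms of the velocity. -/
lemma setIntegral_vertical_mul_vort (hL : 0 < L) (hH : 0 < H) (hu : C1On L H u u1 u2)
    (hw : C1On L H w w1 w2) {b b' : ℝ → ℝ}
    (hb : C1On L H (fun x => b x.2) (fun _ => 0) (fun x => b' x.2)) (hb0 : b 0 = 0) (hb1 : b H = 0) :
    ∫ x in cell L H, b x.2 * (w1 x - u2 x) = ∫ x in cell L H, b' x.2 * u x := by
  have e1 := (hb.mul hw).setIntegral_deriv1 hL.le hH.le
  have e2 := (hb.mul hu).setIntegral_deriv2_of_eq hL.le hH.le (by simp [hb0, hb1])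
  rw [← sub_eq_zero]
  refine Eq.trans ?_ ((congrArg₂ (· - ·) e1 e2).trans (sub_zero 0))
  rw [← integral_sub (integrableOn_cell (hb.mul hw).cont1) (integrableOn_cell (hb.mul hu).cont2),
    ← integral_sub (integrableOn_cell (f := fun x => b x.2 * (w1 x - u2 x))
      (hb.cont.mul (hw.cont1.sub hu.cont2)))
      (integrableOn_cell (f := fun x => b' x.2 * u x) (hb.cont2.mul hu.cont))]
  refine setIntegral_congr_fun measurableSet_cell fun x _ => ?_
  ring

/-- Dirichlet energy of the deviation in terms of conserved quantities of the flow. -/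
lemma perturbation_energy (hL : 0 < L) (hH : 0 < H) (hu : C1On L H u u1 u2)
    (hw : C1On L H w w1 w2) {φ : ℝ → ℝ}
    (hφ : C1On L H (fun x => φ x.2) (fun _ => 0) (fun x => U x.2))
    {q : ℝ} (hq : ∫ x in cell L H, (u x - U x.2) = L * H * q) :
    1 / 2 * ∫ x in cell L H, ((-w x) ^ 2 + (u x - U x.2 - q) ^ 2)
      = 1 / 2 * (∫ x in cell L H, (u x ^ 2 + w x ^ 2)) - (φ H - φ 0) / H * (∫ x in cell L H, u x)
        - (∫ x in cell L H, φ x.2 * (w1 x - u2 x)) + φ 0 * (∫ x in cell L H, (w1 x - u2 x))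
        + (φ H - φ 0) / H * (∫ x in cell L H, x.2 * (w1 x - u2 x))
        + 1 / 2 * (∫ x in cell L H, U x.2 ^ 2) - 1 / 2 * (L * H * q ^ 2) := by
  set β := (φ H - φ 0) / H with hβ
  have hlin : C1On L H (fun x => φ 0 + β * x.2) (fun _ => 0) (fun _ => β) :=
    C1On.of_vertical (a := fun y => φ 0 + β * y) (a' := fun _ => β) (by fun_prop) (by fun_prop)
      fun y _ => by simpa using ((hasDerivAt_id y).const_mul β).const_add (φ 0)
  have hφ0 := hφ.sub hlin
  simp only [sub_zero] at hφ0
  -- The affine interpolant is removed from `φ` so that the weight vanishes on both walls. This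
  -- expresses the cross term `∫U u` of the energy expansion through `∫φω`, the total vorticity, the
  -- impulse and the momentum.
  have hmom := setIntegral_vertical_mul_vort hL hH hu hw (b := fun y => φ y - (φ 0 + β * y))
    (b' := fun y => U y - β) hφ0 (by simp) (by simp only [hβ]; field_simp; ring)
  have cu := hu.cont; have cw := hw.cont; have cu2 := hu.cont2; have cw1 := hw.cont1
  have cφ := hφ.cont; have cU := hφ.cont2
  obtain ⟨φ', hφ'⟩ : ∃ k : ℝ × ℝ → ℝ, ∀ x, φ x.2 = k x := ⟨_, fun _ => rfl⟩
  obtain ⟨U', hU'⟩ : ∃ k : ℝ × ℝ → ℝ, ∀ x, U x.2 = k x := ⟨_, fun _ => rfl⟩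
  simp only [hφ', hU'] at cφ cU hmom hq ⊢
  have I : ∀ {k : ℝ × ℝ → ℝ}, ContinuousOn k (closedChannel H) → IntegrableOn k (cell L H) :=
    integrableOn_cell
  have e1 : ∫ x in cell L H, (φ' x - (φ 0 + β * x.2)) * (w1 x - u2 x)
      = (∫ x in cell L H, φ' x * (w1 x - u2 x)) - φ 0 * (∫ x in cell L H, (w1 x - u2 x))
        - β * ∫ x in cell L H, x.2 * (w1 x - u2 x) := by
    rw [← integral_const_mul, ← integral_const_mul, ← integral_sub (I (by fun_prop)) (I (by fun_prop)),
      ← integral_sub (I (by fun_prop)) (I (by fun_prop))]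
    congr 1; ext x; ring
  have e2 : ∫ x in cell L H, (U' x - β) * u x
      = (∫ x in cell L H, U' x * u x) - β * ∫ x in cell L H, u x := by
    rw [← integral_const_mul, ← integral_sub (I (by fun_prop)) (I (by fun_prop))]
    congr 1; ext x; ring
  have e3 : ∫ x in cell L H, ((-w x) ^ 2 + (u x - U' x - q) ^ 2)
      = (∫ x in cell L H, (u x ^ 2 + w x ^ 2)) - 2 * (∫ x in cell L H, U' x * u x)
        + (∫ x in cell L H, U' x ^ 2) - 2 * q * (∫ x in cell L H, (u x - U' x)) + L * H * q ^ 2 := by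
    rw [← setIntegral_cell_const hL.le hH.le (q ^ 2), ← integral_const_mul, ← integral_const_mul,
      ← integral_sub (I (by fun_prop)) (I (by fun_prop)),
      ← integral_add (I (by fun_prop)) (I (by fun_prop)),
      ← integral_sub (I (by fun_prop)) (I (by fun_prop)),
      ← integral_add (I (by fun_prop)) (I (by fun_prop))]
    congr 1; ext x; ring
  rw [e3, hq]
  rw [e1, e2] at hmom
  linear_combination hmom

end Perturbation

section Core

variable {η η1 η2 η11 η12 η21 η22 : ℝ × ℝ → ℝ} {Ψ Ω F : ℝ → ℝ} {c M R K : ℝ}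

/-- The supporting functional estimate for the energy-Casimir functional. -/
lemma energyCasimir_le (hL : 0 < L) (hH : 0 < H) (hη : C1On L H η η1 η2)
    (h1 : C1On L H η1 η11 η12) (h2 : C1On L H η2 η21 η22) (hb : ∀ s, η (s, 0) = c)
    (ht : ∀ s, η (s, H) = c) (hK : 0 < K) (hM : 0 ≤ M)
    (hΨ : ContinuousOn Ψ (Icc 0 H)) (hΩ : ContinuousOn Ω (Icc 0 H)) (hFc : Continuous F)
    (hΨR : ∀ y ∈ Icc 0 H, |Ψ y| + K ≤ R)
    (hF : ∀ y ∈ Icc 0 H, ∀ ρ ∈ Icc (-R) R, ∀ s,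
      (s - Ω y) * ρ - M / 2 * (ρ - Ψ y) ^ 2 ≤ F s - F (Ω y)) :
    1 / 2 * (∫ x in cell L H, (η1 x ^ 2 + η2 x ^ 2)) + (∫ x in cell L H, -(η11 x + η22 x) * Ψ x.2)
        - ∫ x in cell L H, (F (Ω x.2 + -(η11 x + η22 x)) - F (Ω x.2))
      ≤ -(1 / 2) * (∫ x in cell L H, (η1 x ^ 2 + η2 x ^ 2)) + M / 2 * (∫ x in cell L H, η x ^ 2)
        + 1 / K * (∫ x in cell L H, |η11 x + η22 x| * η x ^ 2)
        + c * ∫ x in cell L H, (η11 x + η22 x) := by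
  have hG := hη.green hL.le hH.le h1 h2 hb ht
  have c0 := hη.cont; have c11 := h1.cont1; have c22 := h2.cont2
  have cΨ : ContinuousOn (fun x : ℝ × ℝ => Ψ x.2) (closedChannel H) :=
    hΨ.comp continuousOn_snd fun _ hx => hx.2
  have cΩ : ContinuousOn (fun x : ℝ × ℝ => Ω x.2) (closedChannel H) :=
    hΩ.comp continuousOn_snd fun _ hx => hx.2
  have cF1 : ContinuousOn (fun x : ℝ × ℝ => F (Ω x.2 + -(η11 x + η22 x))) (closedChannel H) :=
    hFc.comp_continuousOn (cΩ.add (by fun_prop))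
  have cF2 : ContinuousOn (fun x : ℝ × ℝ => F (Ω x.2)) (closedChannel H) :=
    hFc.comp_continuousOn cΩ
  have I : ∀ {k : ℝ × ℝ → ℝ}, ContinuousOn k (closedChannel H) → IntegrableOn k (cell L H) :=
    integrableOn_cell
  have point : ∀ x ∈ cell L H, -(η11 x + η22 x) * Ψ x.2
        - (F (Ω x.2 + -(η11 x + η22 x)) - F (Ω x.2))
      ≤ η x * (η11 x + η22 x) + (M / 2 * η x ^ 2 + 1 / K * (|η11 x + η22 x| * η x ^ 2)) := by
    intro x hx
    have hy : x.2 ∈ Icc 0 H := Ioo_subset_Icc_self hx.2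
    -- The competitor in the supremum would ideally be `Ψ + η`. Cutting `η` at height `K` keeps `Ψ +
    -- θ` in `[-R, R]`, at the cost of an error at most `η²/K`.
    set θ := max (-K) (min K (η x)) with hθ
    have hθK : |θ| ≤ K := abs_le.2 ⟨le_max_left _ _, max_le (by linarith) (min_le_left _ _)⟩
    have hθ2 : θ ^ 2 ≤ η x ^ 2 ∧ |η x - θ| ≤ 1 / K * η x ^ 2 := by
      rw [div_mul_eq_mul_div, one_mul, le_div_iff₀ hK]
      rcases le_total (η x) K with hk | hk
      · rcases le_total (-K) (η x) with hk' | hk'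
        · have : θ = η x := by rw [hθ, min_eq_right hk, max_eq_right hk']
          rw [this, sub_self, abs_zero, zero_mul]
          exact ⟨le_rfl, sq_nonneg _⟩
        · have : θ = -K := by rw [hθ, min_eq_right hk, max_eq_left hk']
          rw [this, abs_of_nonpos (by linarith)]
          constructor <;> nlinarith
      · have : θ = K := by rw [hθ, min_eq_left hk, max_eq_right (by linarith)]
        rw [this, abs_of_nonneg (by linarith)]
        constructor <;> nlinarith
    have hρ : Ψ x.2 + θ ∈ Icc (-R) R :=
      abs_le.1 ((abs_add_le _ _).trans ((add_le_add le_rfl hθK).trans (hΨR _ hy)))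
    have h := hF x.2 hy _ hρ (Ω x.2 + -(η11 x + η22 x))
    set ϖ := η11 x + η22 x
    have h3 : ϖ * (θ - η x) ≤ 1 / K * (|ϖ| * η x ^ 2) := by
      refine (le_abs_self _).trans ?_
      rw [abs_mul, abs_sub_comm, mul_left_comm]
      exact mul_le_mul_of_nonneg_left hθ2.2 (abs_nonneg _)
    have h4 := mul_le_mul_of_nonneg_left hθ2.1 hM
    rw [add_sub_cancel_left, add_sub_cancel_left] at h
    linarith
  obtain ⟨Ψ', hΨ'⟩ : ∃ k : ℝ × ℝ → ℝ, ∀ x, Ψ x.2 = k x := ⟨_, fun _ => rfl⟩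
  obtain ⟨F1, hF1⟩ : ∃ k : ℝ × ℝ → ℝ, ∀ x, F (Ω x.2 + -(η11 x + η22 x)) = k x := ⟨_, fun _ => rfl⟩
  obtain ⟨F2, hF2⟩ : ∃ k : ℝ × ℝ → ℝ, ∀ x, F (Ω x.2) = k x := ⟨_, fun _ => rfl⟩
  simp only [hΨ', hF1, hF2] at cΨ cF1 cF2 point ⊢
  have hint := setIntegral_mono_on (I (by fun_prop)) (I (by fun_prop)) measurableSet_cell point
  rw [integral_sub (I (by fun_prop)) (I (by fun_prop)), integral_add (I (by fun_prop))
    (I (by fun_prop)), integral_add (I (by fun_prop)) (I (by fun_prop)), integral_const_mul,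
    integral_const_mul] at hint
  linarith

end Core

end PeriodicChannel
end

/-! ### A priori bounds and conserved quantities of the deviation -/

noncomputable section
namespace PeriodicChannel

variable {L H p : ℝ}

lemma continuous_abs_rpow (hp : 1 < p) : Continuous fun s : ℝ => |s| ^ p :=
  continuous_abs.rpow_const fun _ => Or.inr (by linarith)

/-- Converts smallness in `Lᵖ` into smallness in `L¹` without Hölder's inequality; `τ` is a free
error. -/
lemma setIntegral_abs_le (hL : 0 < L) (hH : 0 < H) (hp : 1 < p) {τ : ℝ} (hτ : 0 < τ)
    {k : ℝ × ℝ → ℝ} (hk : ContinuousOn k (closedChannel H)) :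
    ∫ x in cell L H, |k x| ≤ L * H * τ + τ ^ (1 - p) * ∫ x in cell L H, |k x| ^ p := by
  have hkp : IntegrableOn (fun x => |k x| ^ p) (cell L H) :=
    integrableOn_cell ((continuous_abs_rpow hp).comp_continuousOn hk)
  have := setIntegral_mono (integrableOn_cell hk.abs) ((integrable_const τ).add (hkp.const_mul _))
    fun x => abs_le_add_rpow hp hτ (k x)
  simp only [Pi.add_apply] at this
  rwa [integral_add (integrable_const τ) (hkp.const_mul _), setIntegral_cell_const hL.le hH.le,
    integral_const_mul] at this

/-- The cross term between a vorticity bounded in `Lᵖ` and the square of a stream function. -/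
lemma exists_cross_bound (hL : 0 < L) (hH : 0 < H) (hp : 1 < p) :
    ∃ C : ℝ, 0 ≤ C ∧ ∀ (η η1 η2 ϖ : ℝ × ℝ → ℝ) (c : ℝ), C1On L H η η1 η2 → (∀ s, η (s, 0) = c) →
      ∫ x in cell L H, η x = 0 → ContinuousOn ϖ (closedChannel H) →
      ∫ x in cell L H, |ϖ x| * η x ^ 2 ≤ ((∫ x in cell L H, |ϖ x| ^ p) + C)
        * ∫ x in cell L H, (η1 x ^ 2 + η2 x ^ 2) := by
  obtain ⟨k, hk⟩ := exists_young hp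
  obtain ⟨C, hC, hS⟩ := sobolev hL hH k
  refine ⟨L * H + C, by positivity, fun η η1 η2 ϖ c hη hb hm hϖ => ?_⟩
  have hS := hS η η1 η2 c hη hb hm
  set X := ∫ x in cell L H, (η1 x ^ 2 + η2 x ^ 2)
  have hX : 0 ≤ X := integral_nonneg fun x => by positivity
  have hcη := hη.cont
  have hϖp : ContinuousOn (fun x => |ϖ x| ^ p) (closedChannel H) :=
    (continuous_abs_rpow hp).comp_continuousOn hϖ
  -- Young's inequality is applied to `|ϖ|` and `η²/Y`. Working with `Y > X` and then letting `Y`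
  -- decrease to `X` avoids dividing by a vanishing Dirichlet energy.
  have key : ∀ Y, X < Y → ∫ x in cell L H, |ϖ x| * η x ^ 2
      ≤ ((∫ x in cell L H, |ϖ x| ^ p) + (L * H + C)) * Y := by
    intro Y hY
    have hY0 : 0 < Y := hX.trans_lt hY
    have h1 : ∀ x, |ϖ x| * η x ^ 2 ≤ Y * (|ϖ x| ^ p + 1 + (Y ^ k)⁻¹ * η x ^ (2 * k)) := fun x => by
      have := hk |ϖ x| (η x ^ 2 / Y) (abs_nonneg _) (by positivity)
      rw [div_pow, ← pow_mul, mul_div_assoc', div_le_iff₀ hY0] at this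
      refine this.trans_eq ?_
      ring
    have h2 := setIntegral_mono (integrableOn_cell (L := L) (by fun_prop))
      (integrableOn_cell (by fun_prop)) h1
    rw [integral_const_mul, integral_add (integrableOn_cell (by fun_prop))
      (integrableOn_cell (by fun_prop)), integral_add (integrableOn_cell (by fun_prop))
      (integrable_const _), integral_const_mul, setIntegral_cell_const hL.le hH.le] at h2
    have h3 : (Y ^ k)⁻¹ * ∫ x in cell L H, η x ^ (2 * k) ≤ C := by
      rw [inv_mul_le_iff₀ (by positivity), mul_comm (Y ^ k)]
      exact hS.trans (by gcongr)
    refine h2.trans ?_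
    rw [mul_comm]
    refine mul_le_mul_of_nonneg_right ?_ hY0.le
    linarith
  have hcont : Filter.Tendsto (fun Y => ((∫ x in cell L H, |ϖ x| ^ p) + (L * H + C)) * Y)
      (nhdsWithin X (Ioi X)) (nhds (((∫ x in cell L H, |ϖ x| ^ p) + (L * H + C)) * X)) :=
    (Continuous.tendsto (by fun_prop) _).mono_left nhdsWithin_le_nhds
  exact ge_of_tendsto hcont (by filter_upwards [self_mem_nhdsWithin] with Y hY using key Y hY)

/-- Moments of the vorticity against functions of the vertical coordinate are controlled by the
energy and the two affine moments. -/
lemma exists_weak_bound (hL : 0 < L) (hH : 0 < H) {f : ℝ → ℝ} (hf : ContinuousOn f (Icc 0 H)) {τ : ℝ}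
    (hτ : 0 < τ) : ∃ C : ℝ, 0 ≤ C ∧ ∀ u u1 u2 w w1 w2 : ℝ × ℝ → ℝ, C1On L H u u1 u2 →
      C1On L H w w1 w2 → |∫ x in cell L H, f x.2 * (w1 x - u2 x)|
        ≤ τ * ((∫ x in cell L H, |w1 x - u2 x|) + 1)
          + C * ((∫ x in cell L H, u x ^ 2) + |∫ x in cell L H, (w1 x - u2 x)|
            + |∫ x in cell L H, x.2 * (w1 x - u2 x)|) := by
  -- A smooth weight is needed to move the derivative onto it. After subtraction of the affine
  -- interpolant the weight vanishes on the walls and its vorticity moment becomes `∫b'u`. The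
  -- affine part leaves the total vorticity and the impulse, which are conserved.
  obtain ⟨Q, hQ⟩ := exists_polynomial_near_of_continuousOn 0 H f hf τ hτ
  set α := Q.eval 0
  set β := (Q.eval H - Q.eval 0) / H
  set b : ℝ → ℝ := fun y => Q.eval y - (α + β * y) with hb
  set b' : ℝ → ℝ := fun y => Q.derivative.eval y - β with hb'
  have hbc : C1On L H (fun x => b x.2) (fun _ => 0) (fun x => b' x.2) :=
    C1On.of_vertical (a := b) (a' := b') (by fun_prop) (by fun_prop) fun y _ => by
      exact ((Q.hasDerivAt y).sub (((hasDerivAt_id y).const_mul β).const_add α)).congr_deriv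
        (by simp [hb'])
  set D := ∫ x in cell L H, b' x.2 ^ 2
  have hD : 0 ≤ D := integral_nonneg fun x => sq_nonneg _
  refine ⟨D / (4 * τ) + |α| + |β|, by positivity, fun u u1 u2 w w1 w2 hu hw => ?_⟩
  have hmom := setIntegral_vertical_mul_vort hL hH hu hw hbc (by simp [hb, α])
    (by simp only [hb, α, β]; field_simp; ring)
  have cs := sq_setIntegral_mul_le (L := L) hbc.cont2 hu.cont
  rw [← hmom] at cs
  have cf : ContinuousOn (fun x : ℝ × ℝ => f x.2) (closedChannel H) :=
    hf.comp continuousOn_snd fun _ hx => hx.2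
  have cb := hbc.cont
  have cw1 := hw.cont1; have cu2 := hu.cont2
  have e1 : ∫ x in cell L H, f x.2 * (w1 x - u2 x)
      = (∫ x in cell L H, (f x.2 - Q.eval x.2) * (w1 x - u2 x))
        + (∫ x in cell L H, b x.2 * (w1 x - u2 x))
        + (α * (∫ x in cell L H, (w1 x - u2 x)) + β * ∫ x in cell L H, x.2 * (w1 x - u2 x)) := by
    have cQ : ContinuousOn (fun x : ℝ × ℝ => Q.eval x.2) (closedChannel H) :=
      (Q.continuous.comp continuous_snd).continuousOn
    obtain ⟨f', hf'⟩ : ∃ k : ℝ × ℝ → ℝ, ∀ x, f x.2 = k x := ⟨_, fun _ => rfl⟩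
    obtain ⟨b'', hb''⟩ : ∃ k : ℝ × ℝ → ℝ, ∀ x, b x.2 = k x := ⟨_, fun _ => rfl⟩
    obtain ⟨Q', hQ'⟩ : ∃ k : ℝ × ℝ → ℝ, ∀ x, Q.eval x.2 = k x := ⟨_, fun _ => rfl⟩
    have hbQ : ∀ x : ℝ × ℝ, b'' x = Q' x - (α + β * x.2) := fun x => by rw [← hb'', ← hQ']
    simp only [hf', hb'', hQ'] at cf cb cQ ⊢
    have I : ∀ {k : ℝ × ℝ → ℝ}, ContinuousOn k (closedChannel H) → IntegrableOn k (cell L H) :=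
      integrableOn_cell
    rw [← integral_const_mul, ← integral_const_mul, ← integral_add (I (by fun_prop)) (I (by fun_prop)),
      ← integral_add (I (by fun_prop)) (I (by fun_prop)),
      ← integral_add (I (by fun_prop)) (I (by fun_prop))]
    congr 1; ext x; rw [hbQ]; ring
  have e2 : |∫ x in cell L H, (f x.2 - Q.eval x.2) * (w1 x - u2 x)|
      ≤ τ * ∫ x in cell L H, |w1 x - u2 x| := by
    refine abs_integral_le_integral_abs.trans ?_
    rw [← integral_const_mul]
    refine setIntegral_mono_on (integrableOn_cell ?_) (integrableOn_cell (by fun_prop))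
      measurableSet_cell fun x hx => ?_
    · exact ((cf.sub (Q.continuous.comp continuous_snd).continuousOn).mul (cw1.sub cu2)).abs
    · rw [abs_mul, abs_sub_comm]
      exact mul_le_mul_of_nonneg_right (hQ x.2 (Ioo_subset_Icc_self hx.2)).le (abs_nonneg _)
  set I0 := ∫ x in cell L H, b x.2 * (w1 x - u2 x)
  set V := ∫ x in cell L H, u x ^ 2
  have hV : 0 ≤ V := integral_nonneg fun x => sq_nonneg _
  set m0 := ∫ x in cell L H, (w1 x - u2 x)
  set m1 := ∫ x in cell L H, x.2 * (w1 x - u2 x)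
  -- Cauchy–Schwarz gives `I0² ≤ D V`, and `|I0| ≤ τ + I0²/(4τ)` makes the bound linear in the
  -- energy `V`.
  have e3 : |I0| ≤ τ + D / (4 * τ) * V := by
    have h4 : I0 ^ 2 / (4 * τ) ≤ D / (4 * τ) * V := by
      rw [div_mul_eq_mul_div]; gcongr
    have h5 : |I0| ≤ τ + I0 ^ 2 / (4 * τ) := by
      rw [← sub_le_iff_le_add', le_div_iff₀ (by positivity), ← sq_abs]
      nlinarith [sq_nonneg (|I0| - 2 * τ)]
    linarith
  rw [e1]
  have t1 := abs_add_le ((∫ x in cell L H, (f x.2 - Q.eval x.2) * (w1 x - u2 x)) + I0)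
    (α * m0 + β * m1)
  have t2 := abs_add_le (∫ x in cell L H, (f x.2 - Q.eval x.2) * (w1 x - u2 x)) I0
  have t3 := abs_add_le (α * m0) (β * m1)
  rw [abs_mul, abs_mul] at t3
  have n1 := mul_nonneg (abs_nonneg α) hV
  have n2 := mul_nonneg (abs_nonneg β) hV
  have n3 : 0 ≤ D / (4 * τ) * |m0| := by positivity
  have n4 : 0 ≤ D / (4 * τ) * |m1| := by positivity
  have n5 := mul_nonneg (abs_nonneg α) (abs_nonneg m1)
  have n6 := mul_nonneg (abs_nonneg β) (abs_nonneg m0)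
  linarith

section Flow

variable {u u1 u2 w w1 w2 : ℝ → ℝ × ℝ → ℝ} {g φ U Ω : ℝ → ℝ} {lam M : ℝ}

lemma ConservedFlow.continuousOn_vort (hv : ConservedFlow L H u u1 u2 w w1 w2) (t : ℝ) :
    ContinuousOn (fun x => w1 t x - u2 t x) (closedChannel H) :=
  (hv.c1_w t).cont1.sub (hv.c1_u t).cont2

/-- The translation `q` is fixed by the conserved momentum, and every other term of
`perturbation_energy` except `∫φω` is a conserved quantity or independent of the flow. -/
lemma ConservedFlow.deviation_sq_conserved (hL : 0 < L) (hH : 0 < H)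
    (hv : ConservedFlow L H u u1 u2 w w1 w2)
    (hφ : C1On L H (fun x => φ x.2) (fun _ => 0) (fun x => U x.2)) (t : ℝ) {q q₀ : ℝ}
    (hq : ∫ x in cell L H, (u t x - U x.2) = L * H * q)
    (hq₀ : ∫ x in cell L H, (u 0 x - U x.2) = L * H * q₀) :
    1 / 2 * (∫ x in cell L H, ((-w t x) ^ 2 + (u t x - U x.2 - q) ^ 2))
        + (∫ x in cell L H, φ x.2 * (w1 t x - u2 t x))
      = 1 / 2 * (∫ x in cell L H, ((-w 0 x) ^ 2 + (u 0 x - U x.2 - q₀) ^ 2))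
        + ∫ x in cell L H, φ x.2 * (w1 0 x - u2 0 x) := by
  have hqq : q = q₀ := by
    have h1 : ∀ t, ∫ x in cell L H, (u t x - U x.2)
        = (∫ x in cell L H, u 0 x) - ∫ x in cell L H, U x.2 := fun t => by
      rw [integral_sub (integrableOn_cell (hv.c1_u t).cont) (integrableOn_cell hφ.cont2),
        hv.momentum]
    rw [h1] at hq hq₀
    exact mul_left_cancel₀ (mul_pos hL hH).ne' (hq.symm.trans hq₀)
  have hc := hv.casimir id continuous_id t
  simp only [id] at hc
  rw [perturbation_energy hL hH (hv.c1_u t) (hv.c1_w t) hφ hq,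
    perturbation_energy hL hH (hv.c1_u 0) (hv.c1_w 0) hφ hq₀, hv.energy, hv.momentum, hv.impulse, hc,
    hqq]
  ring

/-- The `Lᵖ` norm of the vorticity deviation stays bounded. -/
lemma exists_deviation_bound (hp : 1 < p) (hΩ : ContinuousOn (fun x : ℝ × ℝ => Ω x.2) (closedChannel H)) :
    ∃ N : ℝ, 0 ≤ N ∧ ∀ u u1 u2 w w1 w2 : ℝ → ℝ × ℝ → ℝ, ConservedFlow L H u u1 u2 w w1 w2 →
      ∫ x in cell L H, |w1 0 x - u2 0 x - Ω x.2| ^ p ≤ 1 → ∀ t,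
        ∫ x in cell L H, |w1 t x - u2 t x| ^ p ≤ N ∧
        ∫ x in cell L H, |w1 t x - u2 t x - Ω x.2| ^ p ≤ N := by
  have hpc := continuous_abs_rpow hp
  set A := ∫ x in cell L H, |Ω x.2| ^ p
  have hA : 0 ≤ A := integral_nonneg fun x => by positivity
  have h2p : (1 : ℝ) ≤ 2 ^ p := Real.one_le_rpow (by norm_num) (by linarith)
  refine ⟨2 ^ p * (2 ^ p * (A + 1) + A), by positivity, fun u u1 u2 w w1 w2 hv h0 t => ?_⟩
  have add : ∀ {a b : ℝ × ℝ → ℝ}, ContinuousOn a (closedChannel H) →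
      ContinuousOn b (closedChannel H) → ∫ x in cell L H, |a x + b x| ^ p
        ≤ 2 ^ p * ((∫ x in cell L H, |a x| ^ p) + ∫ x in cell L H, |b x| ^ p) := by
    intro a b ha hb
    have hap := hpc.comp_continuousOn ha
    have hbp := hpc.comp_continuousOn hb
    rw [← integral_add (integrableOn_cell (f := fun x => |a x| ^ p) hap)
      (integrableOn_cell (f := fun x => |b x| ^ p) hbp), ← integral_const_mul]
    exact setIntegral_mono (integrableOn_cell (hpc.comp_continuousOn (ha.add hb)))
      (integrableOn_cell (continuousOn_const.mul (hap.add hbp))) fun x => abs_add_rpow_le hp _ _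
  have e1 := hv.casimir _ hpc t
  have e2 := add ((hv.continuousOn_vort 0).sub hΩ) hΩ
  simp only [Pi.sub_apply, sub_add_cancel] at e2
  have e3 := add (hv.continuousOn_vort t) hΩ.neg
  simp only [Pi.neg_apply, abs_neg, ← sub_eq_add_neg] at e3
  rw [e1] at e3 ⊢
  have e4 : ∫ x in cell L H, |w1 0 x - u2 0 x| ^ p ≤ 2 ^ p * (A + 1) :=
    e2.trans (mul_le_mul_of_nonneg_left (by linarith) (by linarith))
  constructor
  · have : 0 ≤ 2 ^ p * (A + 1) := by positivity
    nlinarith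
  · exact e3.trans (mul_le_mul_of_nonneg_left (by linarith) (by linarith))

end Flow

end PeriodicChannel
end

/-! ### Concavity of the energy-Casimir functional and control of the energy -/

noncomputable section
namespace PeriodicChannel

variable {L H p : ℝ} {g φ U : ℝ → ℝ} {lam M : ℝ}

namespace StableShear

lemma cont_vort (S : StableShear L H g lam M φ U) :
    ContinuousOn (fun y => g (φ y - lam * y)) (Icc 0 H) := by
  have := S.cont_φ
  exact S.smooth_g.continuous.comp_continuousOn (by fun_prop)

lemma c1On_stream (S : StableShear L H g lam M φ U) :
    C1On L H (fun x => φ x.2) (fun _ => 0) (fun x => U x.2) :=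
  C1On.of_vertical S.cont_φ S.cont_U S.deriv_φ

lemma c1On_profile (S : StableShear L H g lam M φ U) :
    C1On L H (fun x => U x.2) (fun _ => 0) (fun x => -g (φ x.2 - lam * x.2)) :=
  C1On.of_vertical (a' := fun y => -g (φ y - lam * y)) S.cont_U S.cont_vort.neg S.deriv_U

lemma continuousOn_vort (S : StableShear L H g lam M φ U) :
    ContinuousOn (fun x : ℝ × ℝ => g (φ x.2 - lam * x.2)) (closedChannel H) :=
  S.cont_vort.comp continuousOn_snd fun _ hx => hx.2

/-- Strict concavity of the energy-Casimir functional, up to the total vorticity. -/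
lemma exists_concave (S : StableShear L H g lam M φ U) (hL : 0 < L) (hH : 0 < H) (hp : 1 < p)
    {N : ℝ} (hN : 0 ≤ N) : ∃ (F : ℝ → ℝ) (κ C R : ℝ), Continuous F ∧ 0 < κ ∧ 0 ≤ C ∧ 0 ≤ R ∧
      (∀ s s', F s - F s' ≤ R * |s - s'|) ∧ (∀ y ∈ Icc 0 H, |φ y - lam * y| ≤ R) ∧
      ∀ u u1 u2 w w1 w2 : ℝ × ℝ → ℝ, C1On L H u u1 u2 → C1On L H w w1 w2 →
        (∀ x ∈ channel H, u1 x + w2 x = 0) → (∀ s, w (s, 0) = 0) → (∀ s, w (s, H) = 0) →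
        ∫ x in cell L H, |w1 x - u2 x - g (φ x.2 - lam * x.2)| ^ p ≤ N →
        ∃ q, ∫ x in cell L H, (u x - U x.2) = L * H * q ∧
          κ * (∫ x in cell L H, ((-w x) ^ 2 + (u x - U x.2 - q) ^ 2))
            + (1 / 2 * (∫ x in cell L H, ((-w x) ^ 2 + (u x - U x.2 - q) ^ 2))
              + (∫ x in cell L H, (w1 x - u2 x - g (φ x.2 - lam * x.2)) * (φ x.2 - lam * x.2))
              - ∫ x in cell L H, (F (w1 x - u2 x) - F (g (φ x.2 - lam * x.2))))
          ≤ C * (∫ x in cell L H, (w1 x - u2 x - g (φ x.2 - lam * x.2))) ^ 2 := by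
  have hP := poincareConst_pos hL hH
  have hM : 0 ≤ M := (S.nonneg 0 (by simp [hH.le])).trans (S.le 0 (by simp [hH.le]))
  -- `κ` is the relative gap between the slope of `g` and the Poincaré constant. The height `K =
  -- 4D/κ` is chosen so that the cut-off error takes at most `κ/4` of the Dirichlet energy, and `R`
  -- leaves room for `|Ψ| + K`.
  set κ := 1 - M / poincareConst L H with hκ
  have hκ0 : 0 < κ := by rw [hκ, sub_pos, div_lt_one hP]; exact S.lt
  obtain ⟨Cc, hCc, hcross⟩ := exists_cross_bound hL hH hp
  set D := N + Cc + 1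
  have hD : 0 < D := by positivity
  set K := 4 * D / κ with hK
  have hK0 : 0 < K := by positivity
  have cΨ : ContinuousOn (fun y => φ y - lam * y) (Icc 0 H) := by
    have := S.cont_φ; fun_prop
  obtain ⟨R₀, hR₀⟩ := isCompact_Icc.exists_bound_of_continuousOn cΨ
  have hR₀0 : 0 ≤ R₀ := (norm_nonneg _).trans (hR₀ 0 (by simp [hH.le]))
  set R := R₀ + K
  have hR : 0 ≤ R := by positivity
  have him := cΨ.image_Icc hH.le
  set a := sInf ((fun y => φ y - lam * y) '' Icc 0 H)
  set b := sSup ((fun y => φ y - lam * y) '' Icc 0 H)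
  have hmem : ∀ y ∈ Icc 0 H, φ y - lam * y ∈ Icc a b := fun y hy => him ▸ mem_image_of_mem _ hy
  have hab : a ≤ b := by
    have := hmem 0 (by simp [hH.le]); exact this.1.trans this.2
  have hrange : ∀ r ∈ Icc a b, ∃ y ∈ Icc 0 H, φ y - lam * y = r := fun r hr => by
    rw [← him] at hr; exact hr
  obtain ⟨F, hFL, hF⟩ := exists_casimir S.smooth_g (M := M) hab
    (fun r hr => by obtain ⟨y, hy, rfl⟩ := hrange r hr; exact S.nonneg y hy)
    (fun r hr => by obtain ⟨y, hy, rfl⟩ := hrange r hr; exact S.le y hy) hR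
  have hFc : Continuous F := by
    refine (LipschitzWith.of_dist_le_mul (K := R.toNNReal) fun s s' => ?_).continuous
    rw [Real.dist_eq, Real.dist_eq, Real.coe_toNNReal _ hR, abs_le]
    have h1 := hFL s s'
    have h2 := hFL s' s
    rw [abs_sub_comm] at h2
    exact ⟨by linarith, h1⟩
  refine ⟨F, κ / 8, 2 * H / (κ * L), R, hFc, by positivity, by positivity, hR, hFL,
    fun y hy => (hR₀ y hy).trans (by simp only [R]; linarith), ?_⟩
  intro u u1 u2 w w1 w2 hu hw hdiv h0 h1 hϖN
  obtain ⟨η, q, c, hη, hb, ht, hm, hq⟩ :=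
    exists_perturbation_stream (Ω := fun y => g (φ y - lam * y)) hL hH hu hw hdiv h0 h1 S.c1On_profile
  refine ⟨q, hq, ?_⟩
  have k2 : C1On L H (fun x => u x - U x.2 - q) u1 (fun x => u2 x + g (φ x.2 - lam * x.2)) := by
    simpa using (hu.sub S.c1On_profile).sub (C1On.const q)
  have key := energyCasimir_le hL hH hη hw.neg k2 hb ht hK0 hM cΨ S.cont_vort hFc
    (R := R) (fun y hy => by have := hR₀ y hy; rw [Real.norm_eq_abs] at this; linarith)
    fun y hy => hF _ (hmem y hy)
  have e2 : ∀ x, -w1 x + (u2 x + g (φ x.2 - lam * x.2)) = -(w1 x - u2 x - g (φ x.2 - lam * x.2)) :=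
    fun x => by ring
  have e3 : ∀ s r : ℝ, r + (s - r) = s := fun s r => by ring
  simp only [e2, neg_neg, abs_neg, e3, integral_neg] at key
  have hcr := hcross η _ _ _ c hη hb hm ((hw.cont1.sub hu.cont2).sub S.continuousOn_vort)
  simp only [Pi.sub_apply] at hcr
  have hpo := hη.poincare hL hH hb ht hm
  have hcw := hη.sq_wall_le hL hH hb hm
  set X := ∫ x in cell L H, ((-w x) ^ 2 + (u x - U x.2 - q) ^ 2)
  set V := ∫ x in cell L H, η x ^ 2
  set Y := ∫ x in cell L H, |w1 x - u2 x - g (φ x.2 - lam * x.2)| * η x ^ 2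
  set m := ∫ x in cell L H, (w1 x - u2 x - g (φ x.2 - lam * x.2))
  have hX : 0 ≤ X := integral_nonneg fun x => by positivity
  have b1 : M / 2 * V ≤ (1 - κ) / 2 * X := by
    have : V ≤ X / poincareConst L H := by rw [le_div_iff₀ hP]; linarith
    calc M / 2 * V ≤ M / 2 * (X / poincareConst L H) := by gcongr
      _ = (1 - κ) / 2 * X := by rw [hκ]; ring
  have b2 : 1 / K * Y ≤ κ / 4 * X := by
    have : Y ≤ D * X := hcr.trans (by gcongr; simp only [D]; linarith)
    calc 1 / K * Y ≤ 1 / K * (D * X) := by gcongr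
      _ = κ / 4 * X := by rw [hK]; field_simp
  -- The wall value satisfies `c² ≤ (H/L) X`, so completing the square spends another `κ/8`. Of the
  -- available `κ/2` there remains `κ/2 - κ/4 - κ/8 = κ/8`.
  have b3 : -(c * m) ≤ κ / 8 * X + 2 * H / (κ * L) * m ^ 2 := by
    have h3 : κ * L / (8 * H) * c ^ 2 ≤ κ / 8 * X := by
      calc κ * L / (8 * H) * c ^ 2 ≤ κ * L / (8 * H) * (H / L * X) := by gcongr
        _ = κ / 8 * X := by field_simp
    have h4 : κ * L / (8 * H) * c ^ 2 + 2 * H / (κ * L) * m ^ 2 + c * m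
        = κ * L / (8 * H) * (c + 4 * H / (κ * L) * m) ^ 2 := by field_simp; ring
    have h5 : 0 ≤ κ * L / (8 * H) * (c + 4 * H / (κ * L) * m) ^ 2 := by positivity
    linarith
  linarith

/-- Kinetic energy of the deviation, up to a uniform translation, is controlled by the initial
vorticity deviation. -/
lemma exists_energy_control (S : StableShear L H g lam M φ U) (hL : 0 < L) (hH : 0 < H)
    (hp : 1 < p) : ∃ C : ℝ, 0 ≤ C ∧ ∀ u u1 u2 w w1 w2 : ℝ → ℝ × ℝ → ℝ,
      ConservedFlow L H u u1 u2 w w1 w2 →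
      ∫ x in cell L H, |w1 0 x - u2 0 x - g (φ x.2 - lam * x.2)| ^ p ≤ 1 → ∀ t, ∃ q,
        ∫ x in cell L H, ((-w t x) ^ 2 + (u t x - U x.2 - q) ^ 2)
          ≤ C * ∫ x in cell L H, |w1 0 x - u2 0 x - g (φ x.2 - lam * x.2)| := by
  obtain ⟨N, hN, hdev⟩ := exists_deviation_bound (L := L) (Ω := fun y => g (φ y - lam * y)) hp
    S.continuousOn_vort
  obtain ⟨F, κ, C, R, hFc, hκ, hC, hR, hFL, hΨR, hconc⟩ := S.exists_concave hL hH hp hN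
  refine ⟨(C * (L * H + 1) + 2 * R) / κ, by positivity, fun u u1 u2 w w1 w2 hv h0 t => ?_⟩
  have cω := hv.continuousOn_vort
  have cΩ := S.continuousOn_vort
  have cφ := S.c1On_stream (L := L).cont
  have cF : ∀ t, ContinuousOn (fun x => F (w1 t x - u2 t x)) (closedChannel H) := fun t =>
    hFc.comp_continuousOn (cω t)
  have cF' : ContinuousOn (fun x : ℝ × ℝ => F (g (φ x.2 - lam * x.2))) (closedChannel H) :=
    hFc.comp_continuousOn cΩ
  obtain ⟨q, hq, hqt⟩ := hconc _ _ _ _ _ _ (hv.c1_u t) (hv.c1_w t) (hv.div_free t) (hv.bottom t)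
    (hv.top t) (hdev _ _ _ _ _ _ hv h0 t).2
  obtain ⟨q₀, hq₀, -⟩ := hconc _ _ _ _ _ _ (hv.c1_u 0) (hv.c1_w 0) (hv.div_free 0) (hv.bottom 0)
    (hv.top 0) (hdev _ _ _ _ _ _ hv h0 0).2
  have hcons := hv.deviation_sq_conserved hL hH S.c1On_stream t hq hq₀
  have hcas := hv.casimir F hFc t
  have himp := hv.impulse t
  have htot := hv.casimir id continuous_id t
  simp only [id] at htot
  have hd1 := setIntegral_abs_le hL hH hp one_pos ((cω 0).sub cΩ)
  simp only [Pi.sub_apply, mul_one, Real.one_rpow, one_mul] at hd1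
  refine ⟨q, ?_⟩
  have hΨR' : ∀ x ∈ cell L H, |φ x.2 - lam * x.2| ≤ R := fun x hx => hΨR _ (Ioo_subset_Icc_self hx.2)
  have hFL' := fun (t : ℝ) (x : ℝ × ℝ) => hFL (w1 t x - u2 t x) (g (φ x.2 - lam * x.2))
  obtain ⟨φ', hφ'⟩ : ∃ k : ℝ × ℝ → ℝ, ∀ x, φ x.2 = k x := ⟨_, fun _ => rfl⟩
  obtain ⟨Ω', hΩ'⟩ : ∃ k : ℝ × ℝ → ℝ, ∀ x, g (φ x.2 - lam * x.2) = k x := ⟨_, fun _ => rfl⟩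
  obtain ⟨ω, hω⟩ : ∃ k : ℝ → ℝ × ℝ → ℝ, ∀ t x, w1 t x - u2 t x = k t x := ⟨_, fun _ _ => rfl⟩
  simp only [hΩ', hω] at *
  simp only [hφ'] at *
  obtain ⟨F1, hF1⟩ : ∃ k : ℝ → ℝ × ℝ → ℝ, ∀ t x, F (ω t x) = k t x := ⟨_, fun _ _ => rfl⟩
  obtain ⟨F2, hF2⟩ : ∃ k : ℝ × ℝ → ℝ, ∀ x, F (Ω' x) = k x := ⟨_, fun _ => rfl⟩
  simp only [hF1, hF2] at *
  have cω0 := cω 0; have cωt := cω t; have cF0 := cF 0; have cFt := cF t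
  have I : ∀ {k : ℝ × ℝ → ℝ}, ContinuousOn k (closedChannel H) → IntegrableOn k (cell L H) :=
    integrableOn_cell
  set d := ∫ x in cell L H, |ω 0 x - Ω' x|
  have hd0 : 0 ≤ d := integral_nonneg fun x => abs_nonneg _
  have hm : ∀ t, ∫ x in cell L H, (ω t x - Ω' x) = (∫ x in cell L H, ω t x) - ∫ x in cell L H, Ω' x :=
    fun t => integral_sub (I (cω t)) (I cΩ)
  have hlin : ∀ t, ∫ x in cell L H, (ω t x - Ω' x) * (φ' x - lam * x.2)
      = (∫ x in cell L H, φ' x * ω t x) - lam * (∫ x in cell L H, x.2 * ω t x)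
        - ∫ x in cell L H, Ω' x * (φ' x - lam * x.2) := fun t => by
    have cωt := cω t
    rw [← integral_const_mul, ← integral_sub (I (by fun_prop)) (I (by fun_prop)),
      ← integral_sub (I (by fun_prop)) (I (by fun_prop))]
    congr 1; ext x; ring
  have hFs : ∀ t, ∫ x in cell L H, (F1 t x - F2 x)
      = (∫ x in cell L H, F1 t x) - ∫ x in cell L H, F2 x := fun t => integral_sub (I (cF t)) (I cF')
  have hm0 : |∫ x in cell L H, (ω t x - Ω' x)| ≤ d := by
    rw [hm, htot, ← hm 0]
    exact abs_integral_le_integral_abs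
  have hl0 : -(R * d) ≤ ∫ x in cell L H, (ω 0 x - Ω' x) * (φ' x - lam * x.2) := by
    rw [← neg_mul, ← integral_const_mul]
    refine setIntegral_mono_on (I (by fun_prop)) (I (by fun_prop)) measurableSet_cell fun x hx => ?_
    have h1 := neg_abs_le ((ω 0 x - Ω' x) * (φ' x - lam * x.2))
    rw [abs_mul] at h1
    have h2 := mul_le_mul_of_nonneg_left (hΨR' x hx) (abs_nonneg (ω 0 x - Ω' x))
    linarith
  have hf0 : ∫ x in cell L H, (F1 0 x - F2 x) ≤ R * d := by
    rw [← integral_const_mul]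
    exact setIntegral_mono (I (by fun_prop)) (I (by fun_prop)) fun x => hFL' 0 x
  have hX0 : 0 ≤ ∫ x in cell L H, ((-w 0 x) ^ 2 + (u 0 x - U x.2 - q₀) ^ 2) :=
    integral_nonneg fun x => by positivity
  -- The total vorticity deviation is conserved and at most `d`; one factor `d` is bounded by `L H +
  -- 1` because the initial `p`-th power integral is at most `1`.
  have hm2 : (∫ x in cell L H, (ω t x - Ω' x)) ^ 2 ≤ (L * H + 1) * d := by
    rw [← sq_abs]
    have := pow_le_pow_left₀ (abs_nonneg _) hm0 2
    nlinarith
  have hm3 := mul_le_mul_of_nonneg_left hm2 hC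
  rw [hlin, hFs] at hqt
  rw [hlin] at hl0
  rw [hFs] at hf0
  -- The functional at time `t` is now expressed by its initial value. Initially its kinetic part is
  -- nonnegative and the linear and Casimir parts are each at least `-R d`, whence the `2 R` in the
  -- constant.
  rw [himp, hcas] at hqt
  rw [div_mul_eq_mul_div, le_div_iff₀ hκ]
  linarith

end StableShear

end PeriodicChannel
end

/-! ### Moment control and stability in the vorticity norm -/

noncomputable section
namespace PeriodicChannel

variable {L H p : ℝ} {g φ U : ℝ → ℝ} {lam M : ℝ}

/-- Vorticity moments against a fixed vertical profile stay small. -/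
lemma StableShear.exists_moment_control (S : StableShear L H g lam M φ U) (hL : 0 < L) (hH : 0 < H)
    (hp : 1 < p) {f : ℝ → ℝ} (hf : ContinuousOn f (Icc 0 H)) {τ : ℝ} (hτ : 0 < τ) :
    ∃ C : ℝ, 0 ≤ C ∧ ∀ u u1 u2 w w1 w2 : ℝ → ℝ × ℝ → ℝ,
      ConservedFlow L H u u1 u2 w w1 w2 →
      ∫ x in cell L H, |w1 0 x - u2 0 x - g (φ x.2 - lam * x.2)| ^ p ≤ 1 → ∀ t,
        |∫ x in cell L H, f x.2 * (w1 t x - u2 t x - g (φ x.2 - lam * x.2))|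
          ≤ τ + C * ∫ x in cell L H, |w1 0 x - u2 0 x - g (φ x.2 - lam * x.2)| := by
  obtain ⟨N, hN, hdev⟩ := exists_deviation_bound (L := L) (Ω := fun y => g (φ y - lam * y)) hp
    S.continuousOn_vort
  obtain ⟨E, hE, hen⟩ := S.exists_energy_control hL hH hp
  -- The error is divided by a bound for `∫|ω - Ω| + 1`. In the final constant, `E` accounts for the
  -- energy, `1` for the total vorticity and `H` for the impulse.
  obtain ⟨C, hC, hweak⟩ := exists_weak_bound hL hH hf (τ := τ / (L * H + N + 1)) (by positivity)
  refine ⟨C * (E + 1 + H), by positivity, fun u u1 u2 w w1 w2 hv h0 t => ?_⟩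
  obtain ⟨q, hq⟩ := hen _ _ _ _ _ _ hv h0 t
  -- The weak bound is applied to the deviation velocity: subtracting `q` leaves the vorticity `ω -
  -- Ω` unchanged and makes the kinetic energy small.
  have k2 : C1On L H (fun x => u t x - U x.2 - q) (u1 t)
      (fun x => u2 t x + g (φ x.2 - lam * x.2)) := by
    simpa using ((hv.c1_u t).sub S.c1On_profile).sub (C1On.const q)
  have hw := hweak _ _ _ _ _ _ k2 (hv.c1_w t)
  simp only [← sub_sub] at hw
  have hN1 := (hdev _ _ _ _ _ _ hv h0 t).2
  have hd1 := setIntegral_abs_le hL hH hp one_pos ((hv.continuousOn_vort t).sub S.continuousOn_vort)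
  simp only [Pi.sub_apply, mul_one, Real.one_rpow, one_mul] at hd1
  have cω := hv.continuousOn_vort
  have cΩ := S.continuousOn_vort
  have hX : ∫ x in cell L H, (u t x - U x.2 - q) ^ 2
      ≤ ∫ x in cell L H, ((-w t x) ^ 2 + (u t x - U x.2 - q) ^ 2) := by
    refine setIntegral_mono (integrableOn_cell (k2.cont.pow 2))
      (integrableOn_cell (((hv.c1_w t).cont.neg.pow 2).add (k2.cont.pow 2))) fun x => ?_
    have := sq_nonneg (-w t x)
    simp only; linarith
  have himp := hv.impulse t
  have htot := hv.casimir id continuous_id t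
  simp only [id] at htot
  obtain ⟨Ω', hΩ'⟩ : ∃ k : ℝ × ℝ → ℝ, ∀ x, g (φ x.2 - lam * x.2) = k x := ⟨_, fun _ => rfl⟩
  obtain ⟨ω, hω⟩ : ∃ k : ℝ → ℝ × ℝ → ℝ, ∀ t x, w1 t x - u2 t x = k t x := ⟨_, fun _ _ => rfl⟩
  simp only [hΩ', hω] at *
  have I : ∀ {k : ℝ × ℝ → ℝ}, ContinuousOn k (closedChannel H) → IntegrableOn k (cell L H) :=
    integrableOn_cell
  have hm0 : |∫ x in cell L H, (ω t x - Ω' x)| ≤ ∫ x in cell L H, |ω 0 x - Ω' x| := by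
    rw [integral_sub (I (cω t)) (I cΩ), htot, ← integral_sub (I (cω 0)) (I cΩ)]
    exact abs_integral_le_integral_abs
  have hm1 : |∫ x in cell L H, x.2 * (ω t x - Ω' x)| ≤ H * ∫ x in cell L H, |ω 0 x - Ω' x| := by
    have e : ∀ t, ∫ x in cell L H, x.2 * (ω t x - Ω' x)
        = (∫ x in cell L H, x.2 * ω t x) - ∫ x in cell L H, x.2 * Ω' x := fun t => by
      have := cω t
      rw [← integral_sub (I (by fun_prop)) (I (by fun_prop))]
      congr 1; ext x; ring
    have c0 := cω 0
    rw [e, himp, ← e 0, ← integral_const_mul]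
    refine abs_integral_le_integral_abs.trans ?_
    refine setIntegral_mono_on (I (by fun_prop)) (I (by fun_prop)) measurableSet_cell fun x hx => ?_
    rw [abs_mul, abs_of_pos hx.2.1]
    exact mul_le_mul_of_nonneg_right hx.2.2.le (abs_nonneg _)
  set d := ∫ x in cell L H, |ω 0 x - Ω' x|
  set G := ∫ x in cell L H, |ω t x - Ω' x|
  refine hw.trans (add_le_add ?_ ?_)
  · rw [div_mul_eq_mul_div, div_le_iff₀ (by positivity)]
    exact mul_le_mul_of_nonneg_left (by linarith) hτ.le
  · rw [mul_assoc]
    exact mul_le_mul_of_nonneg_left (by linarith) hC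

/-- Lyapunov stability of a stable shear flow in the `Lᵖ` norm of the vorticity. -/
lemma StableShear.stable (S : StableShear L H g lam M φ U) (hL : 0 < L) (hH : 0 < H)
    (hp : 1 < p) {ε : ℝ} (hε : 0 < ε) :
    ∃ δ : ℝ, 0 < δ ∧ ∀ u u1 u2 w w1 w2 : ℝ → ℝ × ℝ → ℝ, ConservedFlow L H u u1 u2 w w1 w2 →
      ∫ x in cell L H, |w1 0 x - u2 0 x - g (φ x.2 - lam * x.2)| ^ p < δ → ∀ t,
        ∫ x in cell L H, |w1 t x - u2 t x - g (φ x.2 - lam * x.2)| ^ p < ε := by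
  have cΩ := S.continuousOn_vort
  have hpc := continuous_abs_rpow hp
  obtain ⟨N, hN, hdev⟩ := exists_deviation_bound (L := L) (Ω := fun y => g (φ y - lam * y)) hp cΩ
  obtain ⟨B, hB, hBΩ⟩ := exists_bound_cell L cΩ
  set A := ∫ x in cell L H, |g (φ x.2 - lam * x.2)| ^ p
  have hA : 0 ≤ A := integral_nonneg fun x => by positivity
  obtain ⟨C1, hC1, hbreg⟩ := exists_abs_sub_rpow_le_bregman hp
    (ε := ε / (8 * (N + A + 1))) (by positivity)
  set τ₁ := ε / (8 * (C1 + 1) * (L * H + 1))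
  have hτ₁ : 0 < τ₁ := by positivity
  obtain ⟨C2, hC2, hadd⟩ := exists_abs_add_rpow_le hp hB hτ₁
  -- The weight is the derivative of `|s|ᵖ` at `Ω`. Because the base flow is a shear it depends on
  -- `x₂` alone, so its moment against `ω - Ω` is controlled.
  obtain ⟨C3, hC3, hmom⟩ := S.exists_moment_control hL hH hp
    (f := fun y => p * |g (φ y - lam * y)| ^ (p - 2) * g (φ y - lam * y))
    ((continuous_abs_rpow_mul hp).comp_continuousOn S.cont_vort)
    (τ := ε / (8 * (C1 + 1))) (by positivity)
  set τ₃ := ε / (8 * (C1 * C3 + 1) * (L * H + 1))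
  have hτ₃ : 0 < τ₃ := by positivity
  set C4 := C1 * C2 + C1 * C3 * τ₃ ^ (1 - p)
  have hC4 : 0 ≤ C4 := by positivity
  refine ⟨min 1 (ε / (8 * (C4 + 1))), by positivity, fun u u1 u2 w w1 w2 hv h0 t => ?_⟩
  have h01 := (h0.trans_le (min_le_left _ _)).le
  have h02 := h0.trans_le (min_le_right _ _)
  have hm := (abs_le.1 (hmom _ _ _ _ _ _ hv h01 t)).1
  have hNt := (hdev _ _ _ _ _ _ hv h01 t).1
  have cω := hv.continuousOn_vort
  have hd := setIntegral_abs_le hL hH hp hτ₃ ((cω 0).sub cΩ)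
  simp only [Pi.sub_apply] at hd
  -- Conservation replaces `∫|ω(t)|ᵖ` by its initial value, which `hadd` compares with `∫|Ω|ᵖ`. The
  -- resulting five error terms are each at most `ε/8`.
  have hcas := hv.casimir _ hpc t
  have I : ∀ {k : ℝ × ℝ → ℝ}, ContinuousOn k (closedChannel H) → IntegrableOn k (cell L H) :=
    integrableOn_cell
  have cΩp : ContinuousOn (fun x : ℝ × ℝ => |g (φ x.2 - lam * x.2)| ^ p) (closedChannel H) :=
    hpc.comp_continuousOn cΩ
  have cωp : ∀ t, ContinuousOn (fun x => |w1 t x - u2 t x| ^ p) (closedChannel H) :=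
    fun t => hpc.comp_continuousOn (cω t)
  have cdp : ∀ t, ContinuousOn (fun x => |w1 t x - u2 t x - g (φ x.2 - lam * x.2)| ^ p)
      (closedChannel H) := fun t => hpc.comp_continuousOn ((cω t).sub cΩ)
  have cf : ContinuousOn (fun x : ℝ × ℝ => p * |g (φ x.2 - lam * x.2)| ^ (p - 2)
      * g (φ x.2 - lam * x.2)) (closedChannel H) :=
    (continuous_abs_rpow_mul hp).comp_continuousOn cΩ
  have h1 : ∫ x in cell L H, |w1 t x - u2 t x - g (φ x.2 - lam * x.2)| ^ p
      ≤ ε / (8 * (N + A + 1)) * ((∫ x in cell L H, |w1 t x - u2 t x| ^ p) + A)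
        + C1 * ((∫ x in cell L H, |w1 t x - u2 t x| ^ p) - A
          - ∫ x in cell L H, p * |g (φ x.2 - lam * x.2)| ^ (p - 2) * g (φ x.2 - lam * x.2)
            * (w1 t x - u2 t x - g (φ x.2 - lam * x.2))) := by
    have := fun x => hbreg (w1 t x - u2 t x) (g (φ x.2 - lam * x.2))
    simp only [bregman] at this
    have iadd := (I (cωp t)).add (I cΩp)
    have isub := (I (cωp t)).sub (I cΩp)
    have imul : IntegrableOn (fun x => p * |g (φ x.2 - lam * x.2)| ^ (p - 2) * g (φ x.2 - lam * x.2)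
      * (w1 t x - u2 t x - g (φ x.2 - lam * x.2))) (cell L H) := I (cf.mul ((cω t).sub cΩ))
    have isub' := isub.sub imul
    simp only [Pi.add_def, Pi.sub_def] at iadd isub isub'
    rw [← integral_add (I (cωp t)) (I cΩp), ← integral_sub (I (cωp t)) (I cΩp),
      ← integral_sub isub imul, ← integral_const_mul, ← integral_const_mul,
      ← integral_add (iadd.const_mul _) (isub'.const_mul _)]
    exact setIntegral_mono (I (cdp t)) ((iadd.const_mul _).add (isub'.const_mul _)) this
  have h2 : ∫ x in cell L H, |w1 0 x - u2 0 x| ^ p ≤ A + L * H * τ₁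
      + C2 * ∫ x in cell L H, |w1 0 x - u2 0 x - g (φ x.2 - lam * x.2)| ^ p := by
    have iadd := (I cΩp).add (integrable_const τ₁)
    have imul := (I (cdp 0)).const_mul C2
    simp only [Pi.add_def] at iadd
    rw [← setIntegral_cell_const hL.le hH.le, ← integral_const_mul,
      ← integral_add (I cΩp) (integrable_const τ₁), ← integral_add iadd imul]
    refine setIntegral_mono_on (I (cωp 0)) (iadd.add imul) measurableSet_cell fun x hx => ?_
    have := hadd _ (w1 0 x - u2 0 x - g (φ x.2 - lam * x.2)) (hBΩ x hx)
    rwa [add_sub_cancel] at this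
  set e0 := ∫ x in cell L H, |w1 0 x - u2 0 x - g (φ x.2 - lam * x.2)| ^ p
  set d := ∫ x in cell L H, |w1 0 x - u2 0 x - g (φ x.2 - lam * x.2)|
  set W := ∫ x in cell L H, |w1 t x - u2 t x| ^ p
  set I1 := ∫ x in cell L H, p * |g (φ x.2 - lam * x.2)| ^ (p - 2) * g (φ x.2 - lam * x.2)
            * (w1 t x - u2 t x - g (φ x.2 - lam * x.2))
  have b1 : ε / (8 * (N + A + 1)) * (W + A) ≤ ε / 8 := by
    rw [div_mul_eq_mul_div, div_le_div_iff₀ (by positivity) (by positivity)]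
    nlinarith
  have b2 : W - A - I1 ≤ L * H * τ₁ + C2 * e0 + (ε / (8 * (C1 + 1)) + C3 * (L * H * τ₃ + τ₃ ^ (1 - p) * e0)) := by
    have := mul_le_mul_of_nonneg_left hd hC3
    linarith
  have b3 := mul_le_mul_of_nonneg_left b2 hC1
  have hLH : 0 < L * H := mul_pos hL hH
  have b4 : C1 * (L * H * τ₁) ≤ ε / 8 := by
    calc C1 * (L * H * τ₁) = ε / 8 * (C1 / (C1 + 1)) * (L * H / (L * H + 1)) := by
          simp only [τ₁]; field_simp
      _ ≤ ε / 8 * 1 * 1 := by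
          gcongr
          · rw [div_le_one (by positivity)]; linarith
          · rw [div_le_one (by positivity)]; linarith
      _ = ε / 8 := by ring
  have b5 : C1 * (ε / (8 * (C1 + 1))) ≤ ε / 8 := by
    rw [mul_div_assoc', div_le_div_iff₀ (by positivity) (by positivity)]
    nlinarith
  have b6 : C1 * (C3 * (L * H * τ₃)) ≤ ε / 8 := by
    calc C1 * (C3 * (L * H * τ₃)) = ε / 8 * (C1 * C3 / (C1 * C3 + 1)) * (L * H / (L * H + 1)) := by
          simp only [τ₃]; field_simp
      _ ≤ ε / 8 * 1 * 1 := by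
          gcongr
          · rw [div_le_one (by positivity)]; linarith
          · rw [div_le_one (by positivity)]; linarith
      _ = ε / 8 := by ring
  have b7 : C4 * e0 ≤ ε / 8 := by
    calc C4 * e0 ≤ C4 * (ε / (8 * (C4 + 1))) := by gcongr
      _ ≤ ε / 8 := by
        rw [mul_div_assoc', div_le_div_iff₀ (by positivity) (by positivity)]
        nlinarith
  have b8 : C1 * (L * H * τ₁ + C2 * e0 + (ε / (8 * (C1 + 1)) + C3 * (L * H * τ₃ + τ₃ ^ (1 - p) * e0)))
      = C1 * (L * H * τ₁) + C1 * (ε / (8 * (C1 + 1))) + C1 * (C3 * (L * H * τ₃)) + C4 * e0 := by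
    simp only [C4]; ring
  linarith

end PeriodicChannel
end

/-! ### Passage to the original formulation -/

noncomputable section
namespace PeriodicChannel

variable {L H : ℝ}

lemma eLpNorm_cell_lt_iff {f : ℝ × ℝ → ℝ} (hf : ContinuousOn f (closedChannel H)) {p : ENNReal}
    (hp1 : 1 < p) (hp : p < ⊤) {r : ℝ} (hr : 0 < r) :
    eLpNorm f p (volume.restrict (cell L H)) < ENNReal.ofReal r
      ↔ ∫ x in cell L H, |f x| ^ p.toReal < r ^ p.toReal := by
  have hp0 : p ≠ 0 := (zero_lt_one.trans hp1).ne'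
  obtain ⟨B, -, hB⟩ := exists_bound_cell L hf
  have hm : MemLp f p (volume.restrict (cell L H)) :=
    MemLp.of_bound ((hf.mono cell_subset_closedChannel).aestronglyMeasurable measurableSet_cell) B
      (ae_restrict_of_forall_mem measurableSet_cell hB)
  have h0 : 0 ≤ ∫ x in cell L H, |f x| ^ p.toReal := integral_nonneg fun x => by positivity
  rw [hm.eLpNorm_eq_integral_rpow_norm hp0 hp.ne, ENNReal.ofReal_lt_ofReal_iff hr]
  simp only [Real.norm_eq_abs]
  exact Real.rpow_inv_lt_iff_of_pos h0 hr.le (ENNReal.toReal_pos hp0 hp.ne)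

/-- Invariance under every shift gives the profile `ψ(0, ·)`. The horizontal second derivative then
vanishes, and the equation becomes an ordinary differential equation for the velocity profile. -/
lemma IsSemilinearSolution.exists_stableShear {g : ℝ → ℝ} (hg : ContDiff ℝ 1 g) {ψ : ℝ × ℝ → ℝ}
    {lam : ℝ} (hL : 0 < L) (hH : 0 < H) (hψ : IsSemilinearSolution L H g lam ψ)
    (hmin : ∀ x ∈ closedChannel H, 0 ≤ deriv g (ψ x - lam * x.2))
    (hmax : ∀ x ∈ closedChannel H, deriv g (ψ x - lam * x.2) < firstEigenvalue L H) :
    ∃ (φ U : ℝ → ℝ) (M : ℝ), StableShear L H g lam M φ U ∧ ∀ x ∈ closedChannel H, ψ x = φ x.2 := by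
  obtain ⟨M, hMΛ, hM⟩ := exists_max_deriv hg hL hH hψ.c2.1 hψ.c2.2.continuousOn hmax
  have hMP := hMΛ.trans_le (firstEigenvalue_le_poincareConst hL hH)
  have hinv : ∀ x ∈ closedChannel H, ψ x = ψ (0, x.2) := fun x hx => by
    have := hψ.translation_invariant hg hL hH hMP hM (-x.1) x hx
    rwa [add_neg_cancel, eq_comm] at this
  obtain ⟨ψ1, ψ2, ψ11, ψ12, ψ21, ψ22, h0, h1, h2, hlap⟩ := hψ.c2.exists_derivs hH
  have hψ1 : ∀ x ∈ channel H, ψ1 x = 0 := fun x hx => by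
    have := h0.deriv1 x hx
    simp_rw [fun s => hinv (s, x.2) (channel_subset_closedChannel (mk_mem_channel hx.2))] at this
    exact this.unique (hasDerivAt_const _ _)
  have hψ11 : ∀ x ∈ channel H, ψ11 x = 0 := fun x hx => by
    have := h1.deriv1 x hx
    simp_rw [fun s => hψ1 (s, x.2) (mk_mem_channel hx.2)] at this
    exact this.unique (hasDerivAt_const _ _)
  refine ⟨fun y => ψ (0, y), fun y => ψ2 (0, y), M,
    ⟨hg, continuousOn_column h0.cont 0, continuousOn_column h2.cont 0,
      fun y hy => h0.deriv2 (0, y) (mk_mem_channel hy), fun y hy => ?_,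
      fun y hy => hmin (0, y) (mk_mem_closedChannel hy),
      fun y hy => hM (0, y) (mk_mem_closedChannel hy), hMP⟩, hinv⟩
  have hx := mk_mem_channel (x := 0) hy
  have e := hψ.eqn _ hx
  rw [hlap _ hx, hψ11 _ hx, zero_add] at e
  simp only at e
  rw [← e, neg_neg]
  exact h2.deriv2 (0, y) hx

/-- The unrestricted derivatives in `vorticity` and `laplacian` depend on values off the closed
strip at the walls. On the open cell they agree with the derivatives relative to the closed domain,
which are continuous up to the boundary. -/
lemma eLpNorm_vorticity_sub_eq {v : ℝ → ℝ × ℝ → ℝ × ℝ} {P : ℝ → ℝ × ℝ → ℝ} {g φ : ℝ → ℝ}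
    {ψ : ℝ × ℝ → ℝ} {lam : ℝ} (hv : IsEulerFlow L H v P) (hψ : IsSemilinearSolution L H g lam ψ)
    (hφ : ∀ x ∈ closedChannel H, ψ x = φ x.2) (p : ENNReal) (t : ℝ) :
    eLpNorm (fun x => vorticity (v t) x - -laplacian ψ x) p (volume.restrict (cell L H))
      = eLpNorm (fun x => dX H (vel2 v) (t, x) - dY H (vel1 v) (t, x) - g (φ x.2 - lam * x.2)) p
        (volume.restrict (cell L H)) := by
  refine eLpNorm_congr_ae (ae_restrict_of_forall_mem measurableSet_cell fun x hx => ?_)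
  have hx' := cell_subset_channel hx
  simp only
  rw [hv.vorticity_eq t hx', hψ.eqn x hx', hφ x (cell_subset_closedChannel hx), vort]

end PeriodicChannel
end

theorem mainTheorem1 (L H : ℝ) (hL : 0 < L) (hH : 0 < H)
    (g : ℝ → ℝ) (hg : ContDiff ℝ 1 g) (lam : ℝ) (ψ : ℝ × ℝ → ℝ)
    (hψ : PeriodicChannel.IsSemilinearSolution L H g lam ψ)
    (hmin : ∀ x ∈ PeriodicChannel.closedChannel H, 0 ≤ deriv g (ψ x - lam * x.2))
    (hmax : ∀ x ∈ PeriodicChannel.closedChannel H,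
      deriv g (ψ x - lam * x.2) < PeriodicChannel.firstEigenvalue L H)
    (p : ENNReal) (hp1 : 1 < p) (hp : p < ⊤) :
    (∃ φ : ℝ → ℝ, ∀ x ∈ PeriodicChannel.closedChannel H, ψ x = φ x.2) ∧
    (∀ ε : ℝ, 0 < ε → ∃ δ : ℝ, 0 < δ ∧
      ∀ (v : ℝ → ℝ × ℝ → ℝ × ℝ) (P : ℝ → ℝ × ℝ → ℝ), PeriodicChannel.IsEulerFlow L H v P →
        eLpNorm (fun x => PeriodicChannel.vorticity (v 0) x - -PeriodicChannel.laplacian ψ x) p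
            (volume.restrict (PeriodicChannel.cell L H)) < ENNReal.ofReal δ →
        ∀ t : ℝ,
          eLpNorm (fun x => PeriodicChannel.vorticity (v t) x - -PeriodicChannel.laplacian ψ x) p
            (volume.restrict (PeriodicChannel.cell L H)) < ENNReal.ofReal ε) := by
  obtain ⟨φ, U, M, S, hφ⟩ := hψ.exists_stableShear hg hL hH hmin hmax
  refine ⟨⟨φ, hφ⟩, fun ε hε => ?_⟩
  have hpr : 1 < p.toReal := by
    rw [← ENNReal.toReal_one]; exact (ENNReal.toReal_lt_toReal ENNReal.one_ne_top hp.ne).2 hp1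
  have hp0 : p.toReal ≠ 0 := by linarith
  obtain ⟨δ, hδ, hstab⟩ := S.stable hL hH hpr (Real.rpow_pos_of_pos hε p.toReal)
  -- The stability estimate is stated for `p`-th powers of the norm, so `ε` enters as `εᵖ` and `δ`
  -- leaves through its `p`-th root.
  refine ⟨δ ^ p.toReal⁻¹, Real.rpow_pos_of_pos hδ _, fun v P hv h0 t => ?_⟩
  have hc := hv.conservedFlow hL hH
  have hcont := fun t => (hc.continuousOn_vort t).sub S.continuousOn_vort
  simp only [Pi.sub_def] at hcont
  rw [PeriodicChannel.eLpNorm_vorticity_sub_eq hv hψ hφ,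
    PeriodicChannel.eLpNorm_cell_lt_iff (hcont _) hp1 hp (by positivity)] at h0 ⊢
  rw [Real.rpow_inv_rpow hδ.le hp0] at h0
  exact hstab _ _ _ _ _ _ hc h0 t
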